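/- **Setting.** Let $\mathcal M$ be an operad in the category $\mathcal{C}at$ of small categories: categories $\mathcal M(n)$, $n\ge 0$, with right $\Sigma_n$-actions, a unit $\mathrm{id}\in\mathcal M(1)$ and unital, associative, equivariant composition functors, written $A\ast(C_1\oplus\dots\oplus C_n)$. Assume that $\mathcal M$ is $\Sigma$-free, i.e. each $\Sigma_n$ acts freely on $\mathcal M(n)$. An $\mathcal M$-algebra is a small category $S$ with functors $\mathcal M(n)\times S^n\to S$, $(A;K_1,\dots,K_n)\mapsto A(K_1,\dots,K_n)$, compatible with unit, composition and symmetric group actions; here $(A\cdot\sigma)(K_1,\dots,K_n)=A(K_{\sigma^{-1}(1)},\dots,K_{\sigma^{-1}(n)})$. Let $\mathcal{C}at^{\mathbb M}$ be the 2-category of $\mathcal M$-algebras, strict homomorphisms, and natural transformations $t$ with $t_{A(K_1,\dots,K_n)}=A(t_{K_1},\dots,t_{K_n})$. Let $\mathcal{C}at^{\mathbb M}\mathrm{Lax}$ be the 2-category of $\mathcal M$-algebras and lax morphisms $(f,\bar f)$: functors $f$ with morphisms $\bar f(A;K_1,\dots,K_n):A(fK_1,\dots,fK_n)\to f(A(K_1,\dots,K_n))$,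 natural in $A$ and the $K_i$, and compatible with the operad composition, the unit and the symmetric group actions; its 2-cells are the natural transformations $s:f\Rightarrow g$ compatible with $\bar f$ and $\bar g$. Let $\mathcal L$ be a small category. The 2-category $\mathcal{F}unc(\mathcal L,\mathcal{C}at^{\mathbb M}\mathrm{Lax})$ has as objects the functors $X:\mathcal L\to\mathcal{C}at^{\mathbb M}\mathrm{Lax}$. Its 1-cells $j:D\to F$ (homotopy morphisms) are families of lax morphisms $j_L:DL\to FL$ and 2-cells $j_\lambda:F\lambda\circ j_{L_0}\Rightarrow j_{L_1}\circ D\lambda$ for $\lambda:L_0\to L_1$ in $\mathcal L$, such that $j_{\mathrm{id}}=\mathrm{id}$ and $j_{\lambda_1\circ\lambda_0}$ is the composite $F\lambda_1 F\lambda_0 j_{L_0}\Rightarrow F\lambda_1 j_{L_1} D\lambda_0\Rightarrow j_{L_2}D\lambda_1D\lambda_0$ of $F\lambda_1 (j_{\lambda_0})$ and $j_{\lambda_1}D\lambda_0$. Its 2-cells $s:j\Rightarrow k$ are families of 2-cells $s_L:j_L\Rightarrow k_L$ such that $k_\lambda$ after $F\lambda(s_{L_0})$ equals $s_{L_1}D\lambda$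 after $j_\lambda$. Let $c:\mathcal{C}at^{\mathbb M}\to\mathcal{F}unc(\mathcal L,\mathcal{C}at^{\mathbb M}\mathrm{Lax})$ be the constant diagram 2-functor. **The category of representatives $\mathcal R_X$.** For $\lambda:L\to L'$ in $\mathcal L$ write $\lambda K=X(\lambda)(K)$ and $\bar\lambda$ for the lax structure of $X(\lambda)$. Objects of $\mathcal R_X$ are tuples $(A;(K_i,L_i)_{i=1}^n)$ with $A\in\mathcal M(n)$, $L_i\in\mathcal L$, $K_i\in X(L_i)$. A morphism $(A_1;(K_i,L_i)_{i=1}^m)\to(A_2;(K'_k,L'_k)_{k=1}^n)$ consists of a map $\varphi:\{1,\dots,m\}\to\{1,\dots,n\}$ with a total order on each fibre $\varphi^{-1}(k)$, objects $C_k\in\mathcal M(|\varphi^{-1}(k)|)$, a morphism $\gamma:A_1\to A_2\ast(C_1\oplus\dots\oplus C_n)\cdot\sigma$, where $\sigma^{-1}(1),\dots,\sigma^{-1}(m)$ lists $\varphi^{-1}(1),\dots,\varphi^{-1}(n)$ one after the other, each in its order, morphisms $\lambda_i:L_i\to L'_{\varphi(i)}$ in $\mathcal L$, and morphisms $f_k:C_k(\lambda_{i_1}K_{i_1},\dots,\lambda_{i_r}K_{i_r})\to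 K'_k$ in $X(L'_k)$, where $i_1,\dots,i_r$ are the elements of $\varphi^{-1}(k)$ in their order. The composite with a second morphism $(\psi,D_l,\gamma_2,\rho_k,g_l)$ has as underlying map $\psi\varphi$, with the elements of $(\psi\varphi)^{-1}(l)$ listed by running through $\varphi^{-1}(k)$ for $k\in\psi^{-1}(l)$ in order; with $k_1,\dots,k_s$ the elements of $\psi^{-1}(l)$ in order, it has the operations $D_l\ast(C_{k_1}\oplus\dots\oplus C_{k_s})$, the morphisms $(\gamma_2\ast\mathrm{id})\circ\gamma$ and $\rho_{\varphi(i)}\circ\lambda_i$, and the morphisms $g_l\circ D_l(\rho_{k_1}(f_{k_1}),\dots,\rho_{k_s}(f_{k_s}))\circ D_l(\bar\rho_{k_1},\dots,\bar\rho_{k_s})$. There are functors $\mathcal M(n)\times\mathcal R_X^n\to\mathcal R_X$ sending $B$ and $Y_i=(A_i;(K_{ij},L_{ij})_j)$ to $(B\ast(A_1\oplus\dots\oplus A_n);(K_{11},L_{11}),\dots,(K_{nr_n},L_{nr_n}))$, and defined on morphisms by composing the $\gamma$'s and juxtaposing the remaining data. **The relations.** On objects: $(A\cdot\sigma;(K_i,L_i)_i)\sim(A;(K_{\sigma^{-1}(i)},L_{\sigma^{-1}(i)})_i)$.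 On morphisms as above, the equivalence relation generated by the following moves. 1. For $\tau\in\Sigma_n$, replace the target by $(A_2\cdot\tau;(K'_{\tau(k)},L'_{\tau(k)})_k)$, the family $(C_k,f_k)_k$ by $(C_{\tau(k)},f_{\tau(k)})_k$, and $\varphi$ by $\tau^{-1}\varphi$, with the same ordered fibres; $\gamma$ and the $\lambda_i$ are unchanged. 2. For permutations $\rho_k\in\Sigma_{|\varphi^{-1}(k)|}$, replace the ordered fibre $(i_1,\dots,i_r)$ over $k$ by $(i_{\rho_k(1)},\dots,i_{\rho_k(r)})$ and $C_k$ by $C_k\cdot\rho_k$; the rest is unchanged. 3. If $\gamma=(\mathrm{id}_{A_2}\ast(\alpha_1\oplus\dots\oplus\alpha_n)\cdot\sigma)\circ\delta$ with $\alpha_k:D_k\to C_k$ and $\delta:A_1\to A_2\ast(D_1\oplus\dots\oplus D_n)\cdot\sigma$, replace $C_k$ by $D_k$, $\gamma$ by $\delta$, and $f_k$ by $f_k\circ\alpha_k(\lambda_{i_1}K_{i_1},\dots,\lambda_{i_r}K_{i_r})$. 4. For $\tau\in\Sigma_m$, replace the source by $(A_1\cdot\tau;(K_{\tau(i)},L_{\tau(i)})_i)$,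 $\gamma$ by $\gamma\cdot\tau$, each fibre element $i$ by $\tau^{-1}(i)$, and $\lambda_i$ by $\lambda_{\tau(i)}$; the rest is unchanged. Let $\mathrm{hocolim}\,X$ be the quotient of $\mathcal R_X$ by these relations, and write $[\ ]$ for classes. **Theorem.** (a) For each $X$ there is exactly one structure of an $\mathcal M$-algebra (identities, composition, and action of $\mathcal M$ on objects and morphisms) on $\mathrm{hocolim}\,X$ for which identities are represented by identities of $\mathcal R_X$, composites by composites in $\mathcal R_X$ of composable representatives, and the action by the functors $\mathcal M(n)\times\mathcal R_X^n\to\mathcal R_X$. (b) There is a homotopy morphism $j:X\to c(\mathrm{hocolim}\,X)$ given as follows. The functor $j_L$ sends $K$ to $[\mathrm{id};(K,L)]$, and $f:K\to K'$ to the class of the morphism $(\mathrm{id};(K,L))\to(\mathrm{id};(K',L))$ given by $f$, with all other data identities. The lax structure $\bar j_L(A;K_1,\dots,K_n)$ is the class of the evaluation $(A;(K_1,L),\dots,(K_n,L))\to(\mathrm{id};(A(K_1,\dots,K_n),L))$, i.e. the morphism with $C_1=A$ and all other data identities. For $\lambda:L_0\to L_1$ the component $j_\lambda(K)$ is the class of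 the morphism $(\mathrm{id};(K,L_0))\to(\mathrm{id};(\lambda K,L_1))$ given by $\lambda$, with all other data identities. (c) For each $\mathcal M$-algebra $S$ and each homotopy morphism $k:X\to cS$ there is a unique strict homomorphism $r:\mathrm{hocolim}\,X\to S$ with $c(r)\circ j=k$. For strict homomorphisms $r,r':\mathrm{hocolim}\,X\to S$, each 2-cell $s:c(r)\circ j\Rightarrow c(r')\circ j$ is of the form $c(t)\circ j$ for a unique 2-cell $t:r\Rightarrow r'$ in $\mathcal{C}at^{\mathbb M}$. (d) The assignment $X\mapsto\mathrm{hocolim}\,X$ is the object part of a 2-functor $$\mathrm{hocolim}:\mathcal{F}unc(\mathcal L,\mathcal{C}at^{\mathbb M}\mathrm{Lax})\to\mathcal{C}at^{\mathbb M}$$ which is left 2-adjoint to $c$, with unit $j$: the morphisms $j$ are strictly 2-natural in $X$, and $r\mapsto c(r)\circ j$, $t\mapsto c(t)\circ j$ is an isomorphism of categories $\mathcal{C}at^{\mathbb M}(\mathrm{hocolim}\,X,S)\cong\mathcal{F}unc(\mathcal L,\mathcal{C}at^{\mathbb M}\mathrm{Lax})(X,cS)$. -/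

import Mathlib

open CategoryTheory

universe u

namespace CatOp

/-- The lexicographic bijection `{(i, j) | i < n, j < r i} ≃ {0, …, m - 1}`, where `m = ∑ r i`. -/
def lex {n m : ℕ} (r : Fin n → ℕ) (h : ∑ i, r i = m) : (Σ i, Fin (r i)) ≃ Fin m :=
  finSigmaFinEquiv.trans (finCongr h)

theorem lex_lt_iff {n m : ℕ} (r : Fin n → ℕ) (h : ∑ i, r i = m) (x y : Σ i, Fin (r i)) :
    lex r h x < lex r h y ↔ x.1 < y.1 ∨ (x.1 = y.1 ∧ (x.2 : ℕ) < y.2) := by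
  subst h
  have key : ∀ x : (Σ i, Fin (r i)),
      ((lex r rfl x : Fin _) : ℕ) = ∑ i ∈ Finset.univ.filter (· < x.1), r i + x.2 := by
    intro x
    have : ((lex r rfl x : Fin _) : ℕ) = _ := finSigmaFinEquiv_apply x
    rw [this]
    congr 1
    refine Finset.sum_bij (fun i _ => Fin.castLE x.1.2.le i) ?_ ?_ ?_ ?_
    · intro i _; simp; exact i.2
    · intro a _ b _ hab; simpa using hab
    · intro b hb
      simp only [Finset.mem_filter, Finset.mem_univ, true_and] at hb
      exact ⟨⟨b, hb⟩, by simp, by ext; simp⟩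
    · intro a _; rfl
  have step : ∀ x y : (Σ i, Fin (r i)), x.1 < y.1 → lex r rfl x < lex r rfl y := by
    intro x y hxy
    rw [Fin.lt_def, key, key]
    have h1 : ∑ i ∈ Finset.univ.filter (· < x.1), r i + r x.1
        ≤ ∑ i ∈ Finset.univ.filter (· < y.1), r i := by
      rw [add_comm, ← Finset.sum_insert (by simp)]
      apply Finset.sum_le_sum_of_subset
      intro i hi
      simp only [Finset.mem_insert, Finset.mem_filter, Finset.mem_univ, true_and] at hi ⊢
      rcases hi with rfl | hi
      · exact hxy
      · exact hi.trans hxy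
    have := x.2.2
    omega
  rcases lt_trichotomy x.1 y.1 with hxy | hxy | hxy
  · exact ⟨fun _ => Or.inl hxy, fun _ => step x y hxy⟩
  · have h2 : ∑ i ∈ Finset.univ.filter (· < x.1), r i =
        ∑ i ∈ Finset.univ.filter (· < y.1), r i := by rw [hxy]
    rw [Fin.lt_def, key, key, h2]
    simp [hxy]
  · have h1 := step y x hxy
    refine ⟨fun h2 => absurd (h1.trans h2) (lt_irrefl _), ?_⟩
    rintro (h2 | ⟨h2, -⟩)
    · exact absurd (h2.trans hxy) (lt_irrefl _)
    · rw [h2] at hxy; exact absurd hxy (lt_irrefl _)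

theorem lex_lex_lt_iff {n m q : ℕ} (r : Fin n → ℕ) (h : ∑ i, r i = m) (s : ∀ i, Fin (r i) → ℕ)
    (t : Fin n → ℕ) (ht : ∀ i, ∑ j, s i j = t i) (h' : ∑ i, t i = q)
    (i i' : Fin n) (j : Fin (r i)) (j' : Fin (r i')) (k : Fin (s i j)) (k' : Fin (s i' j')) :
    lex t h' ⟨i, lex (s i) (ht i) ⟨j, k⟩⟩ < lex t h' ⟨i', lex (s i') (ht i') ⟨j', k'⟩⟩ ↔
      lex r h ⟨i, j⟩ < lex r h ⟨i', j'⟩ ∨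
        (lex r h ⟨i, j⟩ = lex r h ⟨i', j'⟩ ∧ (k : ℕ) < k') := by
  rw [lex_lt_iff, lex_lt_iff, (lex r h).apply_eq_iff_eq]
  by_cases hi : i = i'
  · subst hi
    have := lex_lt_iff (s i) (ht i) ⟨j, k⟩ ⟨j', k'⟩
    rw [Fin.lt_def] at this
    simp only [lt_self_iff_false, true_and, false_or]
    rw [this]
    simp
  · simp [hi]

theorem equiv_fin_ext {T : Type*} {q : ℕ} (e e' : T ≃ Fin q)
    (h : ∀ x y, e x < e y ↔ e' x < e' y) : e = e' := by
  let o : Fin q ≃o Fin q :=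
    { toEquiv := e.symm.trans e'
      map_rel_iff' := by
        intro a b
        have := h (e.symm b) (e.symm a)
        simp only [Equiv.apply_symm_apply] at this
        simp only [Equiv.trans_apply]
        rw [← not_lt, ← not_lt, this] }
  have ho : o = OrderIso.refl _ := Subsingleton.elim _ _
  ext x
  have := congrArg (fun f : Fin q ≃o Fin q => f (e x)) ho
  simp [o] at this
  rw [this]

/-- The two-level labelling obtained by grafting trees with labellings `e i` to a root, the inputs
being labelled from left to right. -/
def graft {n m q : ℕ} (r : Fin n → ℕ) (h : ∑ i, r i = m) (s : ∀ i, Fin (r i) → ℕ)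
    (t : Fin n → ℕ) (e : ∀ i, (Σ j, Fin (s i j)) ≃ Fin (t i)) (h' : ∑ i, t i = q) :
    (Σ l : Fin m, Fin (s ((lex r h).symm l).1 ((lex r h).symm l).2)) ≃ Fin q :=
  (Equiv.sigmaCongrLeft (β := fun p : (Σ i, Fin (r i)) => Fin (s p.1 p.2)) (lex r h).symm).trans
    ((Equiv.sigmaAssoc fun i j => Fin (s i j)).trans
      ((Equiv.sigmaCongrRight e).trans (lex t h')))

theorem graft_lex {n m q : ℕ} (r : Fin n → ℕ) (h : ∑ i, r i = m) (s : ∀ i, Fin (r i) → ℕ)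
    (t : Fin n → ℕ) (ht : ∀ i, ∑ j, s i j = t i) (h' : ∑ i, t i = q)
    (h'' : ∑ l : Fin m, s ((lex r h).symm l).1 ((lex r h).symm l).2 = q) :
    graft r h s t (fun i => lex (s i) (ht i)) h' =
      lex (fun l : Fin m => s ((lex r h).symm l).1 ((lex r h).symm l).2) h'' := by
  apply equiv_fin_ext
  intro x y
  rw [lex_lt_iff]
  refine (lex_lex_lt_iff r h s t ht h' _ _ _ _ x.2 y.2).trans ?_
  simp

/-- The two-level labelling obtained by composing a three-level tree: the labelled nodes of the
tree labelled by `e` are grafted to the inputs of the tree labelled by `e'`, and the two upper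
levels are then merged into one. -/
def nest {p n m : ℕ} {s : Fin p → ℕ} {r : Fin n → ℕ} (e' : (Σ k, Fin (s k)) ≃ Fin n)
    (e : (Σ l, Fin (r l)) ≃ Fin m) : (Σ k, Fin (∑ j, r (e' ⟨k, j⟩))) ≃ Fin m :=
  (Equiv.sigmaCongrRight fun k => (lex (fun j => r (e' ⟨k, j⟩)) rfl).symm).trans
    ((Equiv.sigmaAssoc fun k j => Fin (r (e' ⟨k, j⟩))).symm.trans
      ((Equiv.sigmaCongrLeft (β := fun l => Fin (r l)) e').trans e))

theorem lex_one {n : ℕ} (h : ∑ _i : Fin n, 1 = n) :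
    lex (fun _ : Fin n => 1) h = Equiv.sigmaUnique (Fin n) fun _ => Fin 1 := by
  apply equiv_fin_ext
  rintro ⟨i, j⟩ ⟨i', j'⟩
  rw [lex_lt_iff]
  simp

/-- The labelling of a tree with a unary root and one node of the upper level. -/
def single (n : ℕ) : (Σ _i : Fin 1, Fin n) ≃ Fin n :=
  (Equiv.sigmaEquivProd (Fin 1) (Fin n)).trans (Equiv.uniqueProd (Fin n) (Fin 1))

theorem lex_single {n : ℕ} (h : ∑ _i : Fin 1, n = n) :
    lex (fun _ : Fin 1 => n) h = single n := by
  apply equiv_fin_ext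
  rintro ⟨i, j⟩ ⟨i', j'⟩
  rw [lex_lt_iff]
  obtain rfl := Subsingleton.elim i i'
  simp [single]

/-- The block permutation which moves the `i`-th block of size `r (τ i)` to the `τ i`-th place. -/
def blockPerm {n m : ℕ} (r : Fin n → ℕ) (τ : Equiv.Perm (Fin n)) (h : ∑ i, r i = m)
    (h' : ∑ i, r (τ i) = m) : Equiv.Perm (Fin m) :=
  (lex (fun i => r (τ i)) h').symm.trans
    ((Equiv.sigmaCongrLeft (β := fun i => Fin (r i)) τ).trans (lex r h))

/-- The permutation `ρ 1 ⊕ … ⊕ ρ n`. -/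
def sumPerm {n m : ℕ} (r : Fin n → ℕ) (ρ : ∀ i, Equiv.Perm (Fin (r i))) (h : ∑ i, r i = m) :
    Equiv.Perm (Fin m) :=
  (lex r h).symm.trans ((Equiv.sigmaCongrRight ρ).trans (lex r h))

/-- An operad in the category of small categories, given by its categories `Op n` of `n`-ary
operations, the right actions of the symmetric groups, the identity operation and the operadic
composition functors `Op n × Op (r 1) × … × Op (r n) ⥤ Op (r 1 + … + r n)`.
Equations between functors are stated on objects and (with `HEq`) on morphisms. -/
structure CatOperad : Type (u + 1) where
  Op : ℕ → Type u
  [cat : ∀ n, Category.{u} (Op n)]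
  /-- the right action `A ↦ A · σ` -/
  perm : ∀ {n : ℕ}, Equiv.Perm (Fin n) → (Op n ⥤ Op n)
  perm_one : ∀ n : ℕ, perm (1 : Equiv.Perm (Fin n)) = 𝟭 (Op n)
  perm_mul : ∀ {n : ℕ} (σ τ : Equiv.Perm (Fin n)), perm (σ * τ) = perm σ ⋙ perm τ
  /-- the identity operation -/
  one : Op 1
  /-- the composition `A ∗ (C 1 ⊕ … ⊕ C n)` -/
  comp : ∀ {n m : ℕ} (r : Fin n → ℕ), ∑ i, r i = m → Op n → (∀ i, Op (r i)) → Op m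
  compMap : ∀ {n m : ℕ} (r : Fin n → ℕ) (h : ∑ i, r i = m) {A A' : Op n} {C C' : ∀ i, Op (r i)},
    (A ⟶ A') → (∀ i, C i ⟶ C' i) → (comp r h A C ⟶ comp r h A' C')
  compMap_id : ∀ {n m : ℕ} (r : Fin n → ℕ) (h : ∑ i, r i = m) (A : Op n) (C : ∀ i, Op (r i)),
    compMap r h (𝟙 A) (fun i => 𝟙 (C i)) = 𝟙 (comp r h A C)
  compMap_comp : ∀ {n m : ℕ} (r : Fin n → ℕ) (h : ∑ i, r i = m) {A A' A'' : Op n}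
    {C C' C'' : ∀ i, Op (r i)} (α : A ⟶ A') (α' : A' ⟶ A'') (c : ∀ i, C i ⟶ C' i)
    (c' : ∀ i, C' i ⟶ C'' i),
    compMap r h (α ≫ α') (fun i => c i ≫ c' i) = compMap r h α c ≫ compMap r h α' c'
  one_comp : ∀ {n : ℕ} (h : ∑ _i : Fin 1, n = n) (A : Op n),
    comp (fun _ : Fin 1 => n) h one (fun _ => A) = A
  one_compMap : ∀ {n : ℕ} (h : ∑ _i : Fin 1, n = n) {A A' : Op n} (α : A ⟶ A'),
    HEq (compMap (fun _ : Fin 1 => n) h (𝟙 one) (fun _ => α)) α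
  comp_one : ∀ {n : ℕ} (h : ∑ _i : Fin n, 1 = n) (A : Op n),
    comp (fun _ : Fin n => 1) h A (fun _ => one) = A
  compMap_one : ∀ {n : ℕ} (h : ∑ _i : Fin n, 1 = n) {A A' : Op n} (α : A ⟶ A'),
    HEq (compMap (fun _ : Fin n => 1) h α (fun _ => 𝟙 one)) α
  assoc : ∀ {n m q : ℕ} (r : Fin n → ℕ) (h : ∑ i, r i = m) (s : ∀ i, Fin (r i) → ℕ)
    (t : Fin n → ℕ) (ht : ∀ i, ∑ j, s i j = t i) (h' : ∑ i, t i = q)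
    (h'' : ∑ l : Fin m, s ((lex r h).symm l).1 ((lex r h).symm l).2 = q)
    (A : Op n) (B : ∀ i, Op (r i)) (C : ∀ i j, Op (s i j)),
    comp (fun l => s ((lex r h).symm l).1 ((lex r h).symm l).2) h'' (comp r h A B)
        (fun l => C ((lex r h).symm l).1 ((lex r h).symm l).2) =
      comp t h' A (fun i => comp (s i) (ht i) (B i) (C i))
  assocMap : ∀ {n m q : ℕ} (r : Fin n → ℕ) (h : ∑ i, r i = m) (s : ∀ i, Fin (r i) → ℕ)
    (t : Fin n → ℕ) (ht : ∀ i, ∑ j, s i j = t i) (h' : ∑ i, t i = q)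
    (h'' : ∑ l : Fin m, s ((lex r h).symm l).1 ((lex r h).symm l).2 = q)
    {A A' : Op n} {B B' : ∀ i, Op (r i)} {C C' : ∀ i j, Op (s i j)}
    (α : A ⟶ A') (b : ∀ i, B i ⟶ B' i) (c : ∀ i j, C i j ⟶ C' i j),
    HEq (compMap (fun l => s ((lex r h).symm l).1 ((lex r h).symm l).2) h'' (compMap r h α b)
        (fun l => c ((lex r h).symm l).1 ((lex r h).symm l).2))
      (compMap t h' α (fun i => compMap (s i) (ht i) (b i) (c i)))
  perm_comp : ∀ {n m : ℕ} (r : Fin n → ℕ) (τ : Equiv.Perm (Fin n)) (h : ∑ i, r i = m)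
    (h' : ∑ i, r (τ i) = m) (A : Op n) (C : ∀ i, Op (r i)),
    comp (fun i => r (τ i)) h' ((perm τ).obj A) (fun i => C (τ i)) =
      (perm (blockPerm r τ h h')).obj (comp r h A C)
  perm_compMap : ∀ {n m : ℕ} (r : Fin n → ℕ) (τ : Equiv.Perm (Fin n)) (h : ∑ i, r i = m)
    (h' : ∑ i, r (τ i) = m) {A A' : Op n} {C C' : ∀ i, Op (r i)} (α : A ⟶ A')
    (c : ∀ i, C i ⟶ C' i),
    HEq (compMap (fun i => r (τ i)) h' ((perm τ).map α) (fun i => c (τ i)))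
      ((perm (blockPerm r τ h h')).map (compMap r h α c))
  comp_perm : ∀ {n m : ℕ} (r : Fin n → ℕ) (ρ : ∀ i, Equiv.Perm (Fin (r i))) (h : ∑ i, r i = m)
    (A : Op n) (C : ∀ i, Op (r i)),
    comp r h A (fun i => (perm (ρ i)).obj (C i)) = (perm (sumPerm r ρ h)).obj (comp r h A C)
  compMap_perm : ∀ {n m : ℕ} (r : Fin n → ℕ) (ρ : ∀ i, Equiv.Perm (Fin (r i))) (h : ∑ i, r i = m)
    {A A' : Op n} {C C' : ∀ i, Op (r i)} (α : A ⟶ A') (c : ∀ i, C i ⟶ C' i),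
    HEq (compMap r h α (fun i => (perm (ρ i)).map (c i)))
      ((perm (sumPerm r ρ h)).map (compMap r h α c))

attribute [instance] CatOperad.cat

namespace CatOperad

/-- The symmetric groups act freely on the objects, and therefore also on the morphisms, of the
categories of operations. -/
def SigmaFree (M : CatOperad.{u}) : Prop :=
  ∀ (n : ℕ) (A : M.Op n) (σ : Equiv.Perm (Fin n)), (M.perm σ).obj A = A → σ = 1

variable (M : CatOperad.{u})

theorem sum_eq_of_equiv {n m : ℕ} {r : Fin n → ℕ} (e : (Σ i, Fin (r i)) ≃ Fin m) :
    ∑ i, r i = m := by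
  simpa using Fintype.card_congr e

/-- The permutation `σ` such that `σ⁻¹ : {0, …, m - 1} → {0, …, m - 1}` lists the labels
`e ⟨0, 0⟩, e ⟨0, 1⟩, …` in lexicographic order. -/
def shuffle {n m : ℕ} {r : Fin n → ℕ} (e : (Σ i, Fin (r i)) ≃ Fin m) : Equiv.Perm (Fin m) :=
  e.symm.trans (lex r (sum_eq_of_equiv e))

/-- `A ∗ (C 1 ⊕ … ⊕ C n) · σ`: the two-level tree whose inputs are labelled by `e`. -/
def compE {n m : ℕ} {r : Fin n → ℕ} (e : (Σ i, Fin (r i)) ≃ Fin m) (A : M.Op n)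
    (C : ∀ i, M.Op (r i)) : M.Op m :=
  (M.perm (shuffle e)).obj (M.comp r (sum_eq_of_equiv e) A C)

def compEMap {n m : ℕ} {r : Fin n → ℕ} (e : (Σ i, Fin (r i)) ≃ Fin m) {A A' : M.Op n}
    {C C' : ∀ i, M.Op (r i)} (α : A ⟶ A') (c : ∀ i, C i ⟶ C' i) :
    M.compE e A C ⟶ M.compE e A' C' :=
  (M.perm (shuffle e)).map (M.compMap r (sum_eq_of_equiv e) α c)

theorem perm_perm_obj {n : ℕ} (σ τ : Equiv.Perm (Fin n)) (A : M.Op n) :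
    (M.perm τ).obj ((M.perm σ).obj A) = (M.perm (σ * τ)).obj A := by
  rw [M.perm_mul]; rfl

theorem perm_one_obj {n : ℕ} (A : M.Op n) : (M.perm (1 : Equiv.Perm (Fin n))).obj A = A := by
  rw [M.perm_one]; rfl

theorem compE_lex {n m : ℕ} {r : Fin n → ℕ} (h : ∑ i, r i = m) (A : M.Op n)
    (C : ∀ i, M.Op (r i)) : M.compE (lex r h) A C = M.comp r h A C := by
  have : shuffle (lex r h) = 1 := by ext x; simp [shuffle]
  rw [compE, this, perm_one_obj]

/-- Permuting the labels of the inputs. -/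
theorem compE_perm {n m : ℕ} {r : Fin n → ℕ} (e : (Σ i, Fin (r i)) ≃ Fin m) (A : M.Op n)
    (C : ∀ i, M.Op (r i)) (τ : Equiv.Perm (Fin m)) :
    (M.perm τ).obj (M.compE e A C) = M.compE (e.trans τ.symm) A C := by
  rw [compE, perm_perm_obj]; rfl

/-- Permuting the nodes of the upper level. -/
theorem compE_perm_root {n m : ℕ} {r : Fin n → ℕ} (e : (Σ i, Fin (r i)) ≃ Fin m) (A : M.Op n)
    (C : ∀ i, M.Op (r i)) (τ : Equiv.Perm (Fin n)) :
    M.compE ((Equiv.sigmaCongrLeft (β := fun i => Fin (r i)) τ).trans e) ((M.perm τ).obj A)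
      (fun i => C (τ i)) = M.compE e A C := by
  rw [compE, M.perm_comp r τ (sum_eq_of_equiv e), perm_perm_obj]
  have : blockPerm r τ (sum_eq_of_equiv e) (sum_eq_of_equiv
      ((Equiv.sigmaCongrLeft (β := fun i => Fin (r i)) τ).trans e)) *
      shuffle ((Equiv.sigmaCongrLeft (β := fun i => Fin (r i)) τ).trans e) = shuffle e := by
    apply Equiv.ext
    intro x
    simp [blockPerm, shuffle]
  rw [this]; rfl

/-- Permuting the inputs of the nodes of the upper level. -/
theorem compE_perm_nodes {n m : ℕ} {r : Fin n → ℕ} (e : (Σ i, Fin (r i)) ≃ Fin m) (A : M.Op n)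
    (C : ∀ i, M.Op (r i)) (ρ : ∀ i, Equiv.Perm (Fin (r i))) :
    M.compE ((Equiv.sigmaCongrRight ρ).trans e) A (fun i => (M.perm (ρ i)).obj (C i)) =
      M.compE e A C := by
  rw [compE, M.comp_perm r ρ, perm_perm_obj]
  have : sumPerm r ρ (sum_eq_of_equiv e) * shuffle ((Equiv.sigmaCongrRight ρ).trans e) =
      shuffle e := by
    apply Equiv.ext
    intro x
    simp [sumPerm, shuffle]
  rw [this]; rfl

theorem compE_perm_root' {n m : ℕ} {r : Fin n → ℕ} (e : (Σ i, Fin (r i)) ≃ Fin m) (A : M.Op n)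
    (C : ∀ i, M.Op (r i)) (τ : Equiv.Perm (Fin n)) :
    M.compE e ((M.perm τ).obj A) C =
      M.compE ((Equiv.sigmaCongrLeft (β := fun i => Fin (r i)) τ.symm).trans e) A
        (fun i => C (τ.symm i)) := by
  rw [← M.compE_perm_root e _ C τ.symm, perm_perm_obj]
  have : τ * Equiv.symm τ = 1 := mul_inv_cancel τ
  rw [this, perm_one_obj]

/-- Merging the two upper levels of a three-level tree. -/
theorem compE_compE {p n m : ℕ} {s : Fin p → ℕ} {r : Fin n → ℕ} (e' : (Σ k, Fin (s k)) ≃ Fin n)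
    (e : (Σ l, Fin (r l)) ≃ Fin m) (A : M.Op p) (D : ∀ k, M.Op (s k)) (C : ∀ l, M.Op (r l)) :
    M.compE e (M.compE e' A D) C =
      M.compE (nest e' e) A (fun k => M.comp (fun j => r (e' ⟨k, j⟩)) rfl (D k)
        (fun j => C (e' ⟨k, j⟩))) := by
  conv_lhs => rw [compE.eq_def M e']
  rw [compE_perm_root']
  have h'' := sum_eq_of_equiv
    ((Equiv.sigmaCongrLeft (β := fun i => Fin (r i)) (shuffle e').symm).trans e)
  have hA := M.assoc s (sum_eq_of_equiv e') (fun k j => r (e' ⟨k, j⟩)) _ (fun _ => rfl)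
    (sum_eq_of_equiv (nest e' e)) h'' A D (fun k j => C (e' ⟨k, j⟩))
  rw [compE, compE, ← hA]
  have hs : shuffle ((Equiv.sigmaCongrLeft (β := fun i => Fin (r i)) (shuffle e').symm).trans e) =
      shuffle (nest e' e) := by
    have hg := graft_lex s (sum_eq_of_equiv e') (fun k j => r (e' ⟨k, j⟩)) _ (fun _ => rfl)
      (sum_eq_of_equiv (nest e' e)) h''
    apply Equiv.ext
    intro x
    obtain ⟨⟨l, y⟩, rfl⟩ :=
      ((Equiv.sigmaCongrLeft (β := fun i => Fin (r i)) (shuffle e').symm).trans e).surjective x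
    have h1 := Equiv.congr_fun hg ⟨l, y⟩
    rw [shuffle, Equiv.trans_apply, Equiv.symm_apply_apply]
    refine h1.symm.trans ?_
    rw [shuffle, Equiv.trans_apply]
    refine congrArg (lex (fun k => ∑ j, r (e' ⟨k, j⟩)) (sum_eq_of_equiv (nest e' e))) ?_
    rw [Equiv.eq_symm_apply]
    simp only [nest, Equiv.trans_apply, Equiv.sigmaCongrRight_apply, Equiv.symm_apply_apply,
      Equiv.sigmaAssoc]
    rfl
  rw [hs]
  rfl

/-- Grafting two-level trees to a root. -/
theorem comp_compE {n m q : ℕ} (r : Fin n → ℕ) (h : ∑ i, r i = m) (s : ∀ i, Fin (r i) → ℕ)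
    (t : Fin n → ℕ) (e : ∀ i, (Σ j, Fin (s i j)) ≃ Fin (t i)) (h' : ∑ i, t i = q)
    (B : M.Op n) (A : ∀ i, M.Op (r i)) (C : ∀ i j, M.Op (s i j)) :
    M.comp t h' B (fun i => M.compE (e i) (A i) (C i)) =
      M.compE (graft r h s t e h') (M.comp r h B A)
        (fun l => C ((lex r h).symm l).1 ((lex r h).symm l).2) := by
  have hc := M.comp_perm t (fun i => shuffle (e i)) h' B
    (fun i => M.comp (s i) (sum_eq_of_equiv (e i)) (A i) (C i))
  refine hc.trans ?_
  have h'' := sum_eq_of_equiv (graft r h s t e h')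
  have hA := M.assoc r h s t (fun i => sum_eq_of_equiv (e i)) h' h'' B A C
  rw [compE, ← hA]
  congr 2
  have hg := graft_lex r h s t (fun i => sum_eq_of_equiv (e i)) h' h''
  apply Equiv.ext
  intro x
  rw [shuffle, ← hg]
  simp [sumPerm, shuffle, graft]
  exact ⟨rfl, HEq.rfl⟩

theorem compE_one {n : ℕ} (A : M.Op n) :
    M.compE (Equiv.sigmaUnique (Fin n) fun _ => Fin 1) A (fun _ => M.one) = A := by
  rw [← lex_one (by simp), compE_lex, M.comp_one]

theorem one_compE {n : ℕ} (A : M.Op n) : M.compE (single n) M.one (fun _ => A) = A := by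
  rw [← lex_single (by simp), compE_lex, M.one_comp]

end CatOperad
end CatOp

namespace CatOp

/-- An algebra over the operad `M`: a small category with functors
`M n × A × … × A ⥤ A` compatible with the structure of the operad. -/
structure Alg (M : CatOperad.{u}) : Type (u + 1) where
  carrier : Type u
  [cat : Category.{u} carrier]
  act : ∀ {n : ℕ}, M.Op n → (Fin n → carrier) → carrier
  actMap : ∀ {n : ℕ} {A A' : M.Op n} {x x' : Fin n → carrier}, (A ⟶ A') → (∀ i, x i ⟶ x' i) →
    (act A x ⟶ act A' x')
  actMap_id : ∀ {n : ℕ} (A : M.Op n) (x : Fin n → carrier),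
    actMap (𝟙 A) (fun i => 𝟙 (x i)) = 𝟙 (act A x)
  actMap_comp : ∀ {n : ℕ} {A A' A'' : M.Op n} {x x' x'' : Fin n → carrier} (α : A ⟶ A')
    (α' : A' ⟶ A'') (k : ∀ i, x i ⟶ x' i) (k' : ∀ i, x' i ⟶ x'' i),
    actMap (α ≫ α') (fun i => k i ≫ k' i) = actMap α k ≫ actMap α' k'
  one_act : ∀ x : Fin 1 → carrier, act M.one x = x 0
  one_actMap : ∀ {x x' : Fin 1 → carrier} (k : ∀ i, x i ⟶ x' i), HEq (actMap (𝟙 M.one) k) (k 0)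
  comp_act : ∀ {n m : ℕ} (r : Fin n → ℕ) (h : ∑ i, r i = m) (A : M.Op n) (C : ∀ i, M.Op (r i))
    (x : Fin m → carrier),
    act (M.comp r h A C) x = act A (fun i => act (C i) (fun j => x (lex r h ⟨i, j⟩)))
  comp_actMap : ∀ {n m : ℕ} (r : Fin n → ℕ) (h : ∑ i, r i = m) {A A' : M.Op n}
    {C C' : ∀ i, M.Op (r i)} {x x' : Fin m → carrier} (α : A ⟶ A') (c : ∀ i, C i ⟶ C' i)
    (k : ∀ l, x l ⟶ x' l),
    HEq (actMap (M.compMap r h α c) k)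
      (actMap α (fun i => actMap (c i) (fun j => k (lex r h ⟨i, j⟩))))
  perm_act : ∀ {n : ℕ} (σ : Equiv.Perm (Fin n)) (A : M.Op n) (x : Fin n → carrier),
    act ((M.perm σ).obj A) x = act A (fun i => x (σ.symm i))
  perm_actMap : ∀ {n : ℕ} (σ : Equiv.Perm (Fin n)) {A A' : M.Op n} {x x' : Fin n → carrier}
    (α : A ⟶ A') (k : ∀ i, x i ⟶ x' i),
    HEq (actMap ((M.perm σ).map α) k) (actMap α (fun i => k (σ.symm i)))

attribute [instance] Alg.cat

variable {M : CatOperad.{u}}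

theorem Alg.actMap_heq (B : Alg M) {n : ℕ} {A A' A₁ A₁' : M.Op n} {x x' y y' : Fin n → B.carrier}
    {α : A ⟶ A'} {β : A₁ ⟶ A₁'} {k : ∀ i, x i ⟶ x' i} {l : ∀ i, y i ⟶ y' i}
    (hA : A = A₁) (hA' : A' = A₁') (hx : ∀ i, x i = y i) (hx' : ∀ i, x' i = y' i)
    (hα : HEq α β) (hk : ∀ i, HEq (k i) (l i)) : HEq (B.actMap α k) (B.actMap β l) := by
  obtain rfl := funext hx
  obtain rfl := funext hx'
  subst hA hA'
  obtain rfl := eq_of_heq hα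
  obtain rfl : k = l := funext fun i => eq_of_heq (hk i)
  rfl

theorem map_heq {C D : Type*} [Category C] [Category D] (F : C ⥤ D) {x y x' y' : C} {k : x ⟶ y}
    {k' : x' ⟶ y'} (hx : x = x') (hy : y = y') (h : HEq k k') : HEq (F.map k) (F.map k') := by
  subst hx hy
  obtain rfl := eq_of_heq h
  rfl

theorem id_heq {C : Type*} [Category C] {x y : C} (h : x = y) : HEq (𝟙 x) (𝟙 y) := by
  rw [h]

/-! ### Lax morphisms -/

/-- A lax morphism of `M`-algebras: a functor `f` with natural morphisms
`A (f K₁, …, f Kₙ) ⟶ f (A (K₁, …, Kₙ))` compatible with operadic composition, the identity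
operation and the actions of the symmetric groups. -/
structure LaxHom (S T : Alg M) where
  functor : S.carrier ⥤ T.carrier
  lax : ∀ {n : ℕ} (A : M.Op n) (x : Fin n → S.carrier),
    T.act A (fun i => functor.obj (x i)) ⟶ functor.obj (S.act A x)
  lax_natural : ∀ {n : ℕ} {A A' : M.Op n} {x x' : Fin n → S.carrier} (α : A ⟶ A')
    (k : ∀ i, x i ⟶ x' i),
    lax A x ≫ functor.map (S.actMap α k) = T.actMap α (fun i => functor.map (k i)) ≫ lax A' x'
  lax_comp : ∀ {n m : ℕ} (r : Fin n → ℕ) (h : ∑ i, r i = m) (A : M.Op n) (C : ∀ i, M.Op (r i))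
    (x : Fin m → S.carrier),
    HEq (lax (M.comp r h A C) x)
      (T.actMap (𝟙 A) (fun i => lax (C i) (fun j => x (lex r h ⟨i, j⟩))) ≫
        lax A (fun i => S.act (C i) (fun j => x (lex r h ⟨i, j⟩))))
  lax_one : ∀ x : Fin 1 → S.carrier, HEq (lax M.one x) (𝟙 (functor.obj (x 0)))
  lax_perm : ∀ {n : ℕ} (σ : Equiv.Perm (Fin n)) (A : M.Op n) (x : Fin n → S.carrier),
    HEq (lax ((M.perm σ).obj A) x) (lax A (fun i => x (σ.symm i)))

namespace LaxHom

variable {S T U V : Alg M}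

theorem ext_of {f g : LaxHom S T} (h : f.functor = g.functor)
    (h' : ∀ (n : ℕ) (A : M.Op n) (x : Fin n → S.carrier), HEq (f.lax A x) (g.lax A x)) :
    f = g := by
  obtain ⟨F, l, _, _, _, _⟩ := f
  obtain ⟨G, l', _, _, _, _⟩ := g
  obtain rfl : F = G := h
  obtain rfl : @l = @l' := by
    funext n A x
    exact eq_of_heq (h' n A x)
  rfl

def id (S : Alg M) : LaxHom S S where
  functor := 𝟭 _
  lax A x := 𝟙 (S.act A x)
  lax_natural α k := by simp
  lax_comp r h A C x := by
    have : S.actMap (𝟙 A) (fun i => 𝟙 (S.act (C i) (fun j => x (lex r h ⟨i, j⟩)))) = 𝟙 _ :=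
      S.actMap_id _ _
    simp only [Functor.id_obj, Category.comp_id]
    rw [this, S.comp_act]
  lax_one x := id_heq (S.one_act x)
  lax_perm σ A x := id_heq (S.perm_act σ A x)

/-- The composite of two lax morphisms, in diagrammatic order. -/
def comp (f : LaxHom S T) (g : LaxHom T U) : LaxHom S U where
  functor := f.functor ⋙ g.functor
  lax A x := g.lax A (fun i => f.functor.obj (x i)) ≫ g.functor.map (f.lax A x)
  lax_natural α k := by
    have h1 := g.lax_natural α (fun i => f.functor.map (k i))
    have h2 := congrArg g.functor.map (f.lax_natural α k)
    simp only [Functor.map_comp] at h2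
    simp only [Functor.comp_map, Category.assoc, h2]
    rw [← Category.assoc, h1, Category.assoc]
  lax_comp r h A C x := by
    have e1 := g.lax_comp r h A C (fun l => f.functor.obj (x l))
    have e2 := map_heq g.functor (by rw [T.comp_act]) (by rw [S.comp_act]) (f.lax_comp r h A C x)
    refine (heq_comp (by rw [U.comp_act]) (by rw [T.comp_act]) (by rw [S.comp_act])
      e1 e2).trans (heq_of_eq ?_)
    have h1 := g.lax_natural (𝟙 A) (fun i => f.lax (C i) (fun j => x (lex r h ⟨i, j⟩)))
    have h2 := U.actMap_comp (𝟙 A) (𝟙 A)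
      (fun i => g.lax (C i) (fun j => f.functor.obj (x (lex r h ⟨i, j⟩))))
      (fun i => g.functor.map (f.lax (C i) (fun j => x (lex r h ⟨i, j⟩))))
    rw [Category.comp_id] at h2
    rw [h2, Functor.map_comp, Category.assoc, Category.assoc, ← Category.assoc (g.lax A _), h1,
      Category.assoc]
  lax_one x := by
    have e1 := g.lax_one (fun i => f.functor.obj (x i))
    have e2 := map_heq g.functor (by rw [T.one_act]) (by rw [S.one_act]) (f.lax_one x)
    refine (heq_comp (by rw [U.one_act]) (by rw [T.one_act]) (by rw [S.one_act])
      e1 e2).trans ?_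
    simp
  lax_perm σ A x := by
    have e1 := g.lax_perm σ A (fun i => f.functor.obj (x i))
    have e2 := map_heq g.functor (by rw [T.perm_act]) (by rw [S.perm_act]) (f.lax_perm σ A x)
    exact heq_comp (by rw [U.perm_act]) (by rw [T.perm_act]) (by rw [S.perm_act]) e1 e2

end LaxHom

/-- A 2-cell between lax morphisms of `M`-algebras. -/
@[ext]
structure LaxHom₂ {S T : Alg M} (f g : LaxHom S T) where
  nat : f.functor ⟶ g.functor
  nat_lax : ∀ {n : ℕ} (A : M.Op n) (x : Fin n → S.carrier),
    T.actMap (𝟙 A) (fun i => nat.app (x i)) ≫ g.lax A x = f.lax A x ≫ nat.app (S.act A x)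

instance laxHomCategory (S T : Alg M) : Category (LaxHom S T) where
  Hom f g := LaxHom₂ f g
  id f := { nat := 𝟙 _
            nat_lax := fun A x => by
              have := T.actMap_id A (fun i => f.functor.obj (x i))
              simp [this] }
  comp {f g h} s t :=
    { nat := s.nat ≫ t.nat
      nat_lax := fun A x => by
        have := T.actMap_comp (𝟙 A) (𝟙 A) (fun i => s.nat.app (x i)) (fun i => t.nat.app (x i))
        rw [Category.comp_id] at this
        simp only [NatTrans.comp_app]
        rw [this, Category.assoc, t.nat_lax, ← Category.assoc, s.nat_lax, Category.assoc] }
  id_comp s := LaxHom₂.ext (Category.id_comp _)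
  comp_id s := LaxHom₂.ext (Category.comp_id _)
  assoc s t r := LaxHom₂.ext (Category.assoc _ _ _)

namespace LaxHom

variable {S T U V : Alg M}

theorem hom_ext {f g : LaxHom S T} {s t : f ⟶ g}
    (h : ∀ x, s.nat.app x = t.nat.app x) : s = t :=
  LaxHom₂.ext (NatTrans.ext (funext h))

@[simp]
theorem comp_functor (f : LaxHom S T) (g : LaxHom T U) :
    (f.comp g).functor = f.functor ⋙ g.functor := rfl

@[simp]
theorem id_functor : (LaxHom.id S).functor = 𝟭 _ := rfl

@[simp]
theorem id_nat_app (f : LaxHom S T) (x : S.carrier) :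
    (LaxHom₂.nat (𝟙 f)).app x = 𝟙 (f.functor.obj x) := rfl

@[simp]
theorem comp_nat_app {f g h : LaxHom S T} (s : f ⟶ g) (t : g ⟶ h) (x : S.carrier) :
    (LaxHom₂.nat (s ≫ t)).app x = s.nat.app x ≫ t.nat.app x := rfl

theorem eqToHom_nat_app {f g : LaxHom S T} (h : f = g) (x : S.carrier) :
    (LaxHom₂.nat (eqToHom h)).app x = eqToHom (by rw [h]) := by
  subst h; rfl

/-- The 2-cell `g ∘ s`. -/
def whiskerR {f f' : LaxHom S T} (s : f ⟶ f') (g : LaxHom T U) : f.comp g ⟶ f'.comp g where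
  nat := Functor.whiskerRight s.nat g.functor
  nat_lax A x := by
    have h1 := g.lax_natural (𝟙 A) (fun i => s.nat.app (x i))
    have h2 := congrArg g.functor.map (s.nat_lax A x)
    simp only [Functor.map_comp] at h2
    simp only [comp, Functor.whiskerRight_app, Category.assoc]
    rw [← h2, ← Category.assoc, ← h1, Category.assoc]

/-- The 2-cell `s ∘ f`. -/
def whiskerL (f : LaxHom S T) {g g' : LaxHom T U} (s : g ⟶ g') : f.comp g ⟶ f.comp g' where
  nat := Functor.whiskerLeft f.functor s.nat
  nat_lax A x := by
    have h1 := s.nat_lax A (fun i => f.functor.obj (x i))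
    simp only [comp, Functor.whiskerLeft_app, Category.assoc]
    rw [← Category.assoc, h1, Category.assoc, s.nat.naturality]

@[simp]
theorem whiskerR_nat_app {f f' : LaxHom S T} (s : f ⟶ f') (g : LaxHom T U) (x : S.carrier) :
    (whiskerR s g).nat.app x = g.functor.map (s.nat.app x) := rfl

@[simp]
theorem whiskerL_nat_app (f : LaxHom S T) {g g' : LaxHom T U} (s : g ⟶ g') (x : S.carrier) :
    (whiskerL f s).nat.app x = s.nat.app (f.functor.obj x) := rfl

theorem id_comp' (f : LaxHom S T) : (LaxHom.id S).comp f = f :=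
  ext_of rfl fun n A x => by simp [comp, LaxHom.id]

theorem comp_id' (f : LaxHom S T) : f.comp (LaxHom.id T) = f :=
  ext_of rfl fun n A x => by simp [comp, LaxHom.id]

theorem assoc' (f : LaxHom S T) (g : LaxHom T U) (h : LaxHom U V) :
    (f.comp g).comp h = f.comp (g.comp h) :=
  ext_of rfl fun n A x => by simp [comp]

def associator (f : LaxHom S T) (g : LaxHom T U) (h : LaxHom U V) :
    (f.comp g).comp h ≅ f.comp (g.comp h) :=
  eqToIso (assoc' f g h)

def leftUnitor (f : LaxHom S T) : (LaxHom.id S).comp f ≅ f :=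
  eqToIso (id_comp' f)

def rightUnitor (f : LaxHom S T) : f.comp (LaxHom.id T) ≅ f :=
  eqToIso (comp_id' f)

@[simp]
theorem associator_hom_app (f : LaxHom S T) (g : LaxHom T U) (h : LaxHom U V) (x : S.carrier) :
    (associator f g h).hom.nat.app x = 𝟙 (h.functor.obj (g.functor.obj (f.functor.obj x))) :=
  eqToHom_nat_app (assoc' f g h) x

@[simp]
theorem associator_inv_app (f : LaxHom S T) (g : LaxHom T U) (h : LaxHom U V) (x : S.carrier) :
    (associator f g h).inv.nat.app x = 𝟙 (h.functor.obj (g.functor.obj (f.functor.obj x))) :=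
  eqToHom_nat_app ((assoc' f g h).symm) x

@[simp]
theorem leftUnitor_hom_app (f : LaxHom S T) (x : S.carrier) :
    (leftUnitor f).hom.nat.app x = 𝟙 (f.functor.obj x) :=
  eqToHom_nat_app (id_comp' f) x

@[simp]
theorem leftUnitor_inv_app (f : LaxHom S T) (x : S.carrier) :
    (leftUnitor f).inv.nat.app x = 𝟙 (f.functor.obj x) :=
  eqToHom_nat_app ((id_comp' f).symm) x

@[simp]
theorem rightUnitor_hom_app (f : LaxHom S T) (x : S.carrier) :
    (rightUnitor f).hom.nat.app x = 𝟙 (f.functor.obj x) :=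
  eqToHom_nat_app (comp_id' f) x

@[simp]
theorem rightUnitor_inv_app (f : LaxHom S T) (x : S.carrier) :
    (rightUnitor f).inv.nat.app x = 𝟙 (f.functor.obj x) :=
  eqToHom_nat_app ((comp_id' f).symm) x

end LaxHom

/-- The 2-category of `M`-algebras, lax morphisms and 2-cells. -/
structure LaxAlg (M : CatOperad.{u}) : Type (u + 1) where
  alg : Alg M

instance : Bicategory (LaxAlg M) where
  Hom S T := LaxHom S.alg T.alg
  id S := LaxHom.id S.alg
  comp f g := f.comp g
  homCategory S T := laxHomCategory S.alg T.alg
  whiskerLeft f _ _ s := LaxHom.whiskerL f s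
  whiskerRight s g := LaxHom.whiskerR s g
  associator f g h := LaxHom.associator f g h
  leftUnitor f := LaxHom.leftUnitor f
  rightUnitor f := LaxHom.rightUnitor f
  whiskerLeft_id f g := LaxHom.hom_ext fun x => rfl
  whiskerLeft_comp f _ _ _ s t := LaxHom.hom_ext fun x => rfl
  id_whiskerLeft s := LaxHom.hom_ext fun x => by simp
  comp_whiskerLeft f g _ _ s := LaxHom.hom_ext fun x => by simp
  id_whiskerRight f g := LaxHom.hom_ext fun x => by simp
  comp_whiskerRight s t g := LaxHom.hom_ext fun x => by simp
  whiskerRight_id s := LaxHom.hom_ext fun x => by simp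
  whiskerRight_comp s g h := LaxHom.hom_ext fun x => by simp
  whisker_assoc f _ _ s h := LaxHom.hom_ext fun x => by simp
  whisker_exchange s t := LaxHom.hom_ext fun x => by simp
  pentagon f g h i := LaxHom.hom_ext fun x => by simp
  triangle f g := LaxHom.hom_ext fun x => by simp

instance : Bicategory.Strict (LaxAlg M) where
  id_comp := LaxHom.id_comp'
  comp_id := LaxHom.comp_id'
  assoc := LaxHom.assoc'

end CatOp

namespace CatOp

variable {M : CatOperad.{u}}

/-! ### Strict morphisms -/

/-- A (strict) morphism of `M`-algebras. -/
structure StrictHom (S T : Alg M) where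
  functor : S.carrier ⥤ T.carrier
  map_act : ∀ {n : ℕ} (A : M.Op n) (x : Fin n → S.carrier),
    functor.obj (S.act A x) = T.act A (fun i => functor.obj (x i))
  map_actMap : ∀ {n : ℕ} {A A' : M.Op n} {x x' : Fin n → S.carrier} (α : A ⟶ A')
    (k : ∀ i, x i ⟶ x' i),
    HEq (functor.map (S.actMap α k)) (T.actMap α (fun i => functor.map (k i)))

theorem app_heq {C D : Type*} [Category C] [Category D] {F G : C ⥤ D} (s : F ⟶ G) {x y : C}
    (h : x = y) : HEq (s.app x) (s.app y) := by
  rw [h]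

/-- A 2-cell between strict morphisms of `M`-algebras. -/
@[ext]
structure StrictHom₂ {S T : Alg M} (f g : StrictHom S T) where
  nat : f.functor ⟶ g.functor
  nat_act : ∀ {n : ℕ} (A : M.Op n) (x : Fin n → S.carrier),
    HEq (nat.app (S.act A x)) (T.actMap (𝟙 A) (fun i => nat.app (x i)))

instance strictHomCategory (S T : Alg M) : Category (StrictHom S T) where
  Hom f g := StrictHom₂ f g
  id f := { nat := 𝟙 _
            nat_act := fun A x => by
              have := T.actMap_id A (fun i => f.functor.obj (x i))
              simp only [NatTrans.id_app, this]
              exact id_heq (f.map_act A x) }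
  comp {f g h} s t :=
    { nat := s.nat ≫ t.nat
      nat_act := fun A x => by
        have := T.actMap_comp (𝟙 A) (𝟙 A) (fun i => s.nat.app (x i)) (fun i => t.nat.app (x i))
        rw [Category.comp_id] at this
        simp only [NatTrans.comp_app, this]
        exact heq_comp (f.map_act A x) (g.map_act A x) (h.map_act A x) (s.nat_act A x)
          (t.nat_act A x) }
  id_comp s := StrictHom₂.ext (Category.id_comp _)
  comp_id s := StrictHom₂.ext (Category.comp_id _)
  assoc s t r := StrictHom₂.ext (Category.assoc _ _ _)

namespace StrictHom

variable {S T U V : Alg M}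

theorem ext_of {f g : StrictHom S T} (h : f.functor = g.functor) : f = g := by
  obtain ⟨F, _, _⟩ := f
  obtain ⟨G, _, _⟩ := g
  obtain rfl : F = G := h
  rfl

theorem hom_ext {f g : StrictHom S T} {s t : f ⟶ g}
    (h : ∀ x, s.nat.app x = t.nat.app x) : s = t :=
  StrictHom₂.ext (NatTrans.ext (funext h))

def id (S : Alg M) : StrictHom S S where
  functor := 𝟭 _
  map_act _ _ := rfl
  map_actMap _ _ := HEq.rfl

/-- The composite of two strict morphisms, in diagrammatic order. -/
def comp (f : StrictHom S T) (g : StrictHom T U) : StrictHom S U where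
  functor := f.functor ⋙ g.functor
  map_act A x := (congrArg g.functor.obj (f.map_act A x)).trans (g.map_act A _)
  map_actMap {_ A A' x x'} α k :=
    (map_heq g.functor (f.map_act A x) (f.map_act A' x') (f.map_actMap α k)).trans
      (g.map_actMap α _)

@[simp]
theorem comp_functor (f : StrictHom S T) (g : StrictHom T U) :
    (f.comp g).functor = f.functor ⋙ g.functor := rfl

@[simp]
theorem id_functor : (StrictHom.id S).functor = 𝟭 _ := rfl

@[simp]
theorem id_nat_app (f : StrictHom S T) (x : S.carrier) :
    (StrictHom₂.nat (𝟙 f)).app x = 𝟙 (f.functor.obj x) := rfl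

@[simp]
theorem comp_nat_app {f g h : StrictHom S T} (s : f ⟶ g) (t : g ⟶ h) (x : S.carrier) :
    (StrictHom₂.nat (s ≫ t)).app x = s.nat.app x ≫ t.nat.app x := rfl

theorem eqToHom_nat_app {f g : StrictHom S T} (h : f = g) (x : S.carrier) :
    (StrictHom₂.nat (eqToHom h)).app x = eqToHom (by rw [h]) := by
  subst h; rfl

/-- The 2-cell `g ∘ s`. -/
def whiskerR {f f' : StrictHom S T} (s : f ⟶ f') (g : StrictHom T U) : f.comp g ⟶ f'.comp g where
  nat := Functor.whiskerRight s.nat g.functor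
  nat_act A x :=
    (map_heq g.functor (f.map_act A x) (f'.map_act A x) (s.nat_act A x)).trans
      (g.map_actMap (𝟙 A) _)

/-- The 2-cell `s ∘ f`. -/
def whiskerL (f : StrictHom S T) {g g' : StrictHom T U} (s : g ⟶ g') : f.comp g ⟶ f.comp g' where
  nat := Functor.whiskerLeft f.functor s.nat
  nat_act A x := by
    have h := s.nat_act A (fun i => f.functor.obj (x i))
    exact (app_heq s.nat (f.map_act A x)).trans h

@[simp]
theorem whiskerR_nat_app {f f' : StrictHom S T} (s : f ⟶ f') (g : StrictHom T U) (x : S.carrier) :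
    (whiskerR s g).nat.app x = g.functor.map (s.nat.app x) := rfl

@[simp]
theorem whiskerL_nat_app (f : StrictHom S T) {g g' : StrictHom T U} (s : g ⟶ g')
    (x : S.carrier) : (whiskerL f s).nat.app x = s.nat.app (f.functor.obj x) := rfl

def associator (f : StrictHom S T) (g : StrictHom T U) (h : StrictHom U V) :
    (f.comp g).comp h ≅ f.comp (g.comp h) :=
  eqToIso rfl

@[simp]
theorem associator_hom_app (f : StrictHom S T) (g : StrictHom T U) (h : StrictHom U V)
    (x : S.carrier) :
    (associator f g h).hom.nat.app x = 𝟙 (h.functor.obj (g.functor.obj (f.functor.obj x))) := rfl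

@[simp]
theorem associator_inv_app (f : StrictHom S T) (g : StrictHom T U) (h : StrictHom U V)
    (x : S.carrier) :
    (associator f g h).inv.nat.app x = 𝟙 (h.functor.obj (g.functor.obj (f.functor.obj x))) := rfl

def leftUnitor (f : StrictHom S T) :
    (StrictHom.id S).comp f ≅ f :=
  eqToIso rfl

@[simp]
theorem leftUnitor_hom_app (f : StrictHom S T)
    (x : S.carrier) :
    (leftUnitor f).hom.nat.app x = 𝟙 (f.functor.obj x) := rfl

@[simp]
theorem leftUnitor_inv_app (f : StrictHom S T)
    (x : S.carrier) :
    (leftUnitor f).inv.nat.app x = 𝟙 (f.functor.obj x) := rfl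

def rightUnitor (f : StrictHom S T) :
    f.comp (StrictHom.id T) ≅ f :=
  eqToIso rfl

@[simp]
theorem rightUnitor_hom_app (f : StrictHom S T)
    (x : S.carrier) :
    (rightUnitor f).hom.nat.app x = 𝟙 (f.functor.obj x) := rfl

@[simp]
theorem rightUnitor_inv_app (f : StrictHom S T)
    (x : S.carrier) :
    (rightUnitor f).inv.nat.app x = 𝟙 (f.functor.obj x) := rfl

end StrictHom

/-- The 2-category of `M`-algebras, strict morphisms and 2-cells. -/
instance : Bicategory (Alg M) where
  Hom S T := StrictHom S T
  id S := StrictHom.id S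
  comp f g := f.comp g
  homCategory S T := strictHomCategory S T
  whiskerLeft f _ _ s := StrictHom.whiskerL f s
  whiskerRight s g := StrictHom.whiskerR s g
  associator f g h := StrictHom.associator f g h
  leftUnitor f := StrictHom.leftUnitor f
  rightUnitor f := StrictHom.rightUnitor f
  whiskerLeft_id f g := StrictHom.hom_ext fun x => rfl
  whiskerLeft_comp f _ _ _ s t := StrictHom.hom_ext fun x => rfl
  id_whiskerLeft s := StrictHom.hom_ext fun x => by simp
  comp_whiskerLeft f g _ _ s := StrictHom.hom_ext fun x => by simp
  id_whiskerRight f g := StrictHom.hom_ext fun x => by simp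
  comp_whiskerRight s t g := StrictHom.hom_ext fun x => by simp
  whiskerRight_id s := StrictHom.hom_ext fun x => by simp
  whiskerRight_comp s g h := StrictHom.hom_ext fun x => by simp
  whisker_assoc f _ _ s h := StrictHom.hom_ext fun x => by simp
  whisker_exchange s t := StrictHom.hom_ext fun x => by simp
  pentagon f g h i := StrictHom.hom_ext fun x => by simp
  triangle f g := StrictHom.hom_ext fun x => by simp

instance : Bicategory.Strict (Alg M) where
  id_comp _ := rfl
  comp_id _ := rfl
  assoc _ _ _ := rfl
  leftUnitor_eqToIso _ := rfl
  rightUnitor_eqToIso _ := rfl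
  associator_eqToIso _ _ _ := rfl

theorem comm_of_heq {C : Type*} [Category C] {x y x' y' : C} {p : x ⟶ y} {q : x' ⟶ y'}
    (h : HEq p q) (hx : x' = x) (hy : y' = y) : eqToHom hx ≫ p = q ≫ eqToHom hy := by
  subst hx hy
  obtain rfl := eq_of_heq h
  simp

theorem eqToHom_heq_id {C : Type*} [Category C] {x y : C} (h : x = y) :
    HEq (eqToHom h) (𝟙 y) := by
  subst h; rfl

theorem Alg.actMap_eqToHom (S : Alg M) {n : ℕ} (A : M.Op n) {x y : Fin n → S.carrier}
    (h : ∀ i, x i = y i) :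
    S.actMap (𝟙 A) (fun i => eqToHom (h i)) = eqToHom (by rw [funext h]) := by
  obtain rfl := funext h
  exact S.actMap_id A x

/-- A strict morphism, regarded as a lax morphism whose structure morphisms are identities. -/
def StrictHom.toLax {S T : Alg M} (f : StrictHom S T) : LaxHom S T where
  functor := f.functor
  lax A x := eqToHom (f.map_act A x).symm
  lax_natural α k := comm_of_heq (f.map_actMap α k) _ _
  lax_comp r h A C x := by
    rw [T.actMap_eqToHom A
      (fun i => (f.map_act (C i) (fun j => x (lex r h ⟨i, j⟩))).symm), eqToHom_trans]
    exact (eqToHom_heq_id _).trans ((id_heq (by rw [S.comp_act])).trans (eqToHom_heq_id _).symm)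
  lax_one x := (eqToHom_heq_id _).trans (id_heq (by rw [S.one_act]))
  lax_perm σ A x :=
    (eqToHom_heq_id _).trans ((id_heq (by rw [S.perm_act])).trans (eqToHom_heq_id _).symm)

def StrictHom₂.toLax {S T : Alg M} {f g : StrictHom S T} (s : f ⟶ g) : f.toLax ⟶ g.toLax where
  nat := s.nat
  nat_lax A x := (comm_of_heq (s.nat_act A x) (f.map_act A x).symm (g.map_act A x).symm).symm

/-! ### Diagrams and homotopy morphisms -/

namespace LaxAlg

variable {S T U V : LaxAlg M}

open Bicategory

@[simp]
theorem comp_functor (f : S ⟶ T) (g : T ⟶ U) :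
    LaxHom.functor (f ≫ g) = LaxHom.functor f ⋙ LaxHom.functor g := rfl

@[simp]
theorem id_functor : LaxHom.functor (𝟙 S) = 𝟭 _ := rfl

@[simp]
theorem comp_nat_app {f g h : S ⟶ T} (s : f ⟶ g) (t : g ⟶ h) (x : S.alg.carrier) :
    (LaxHom₂.nat (s ≫ t)).app x = (LaxHom₂.nat s).app x ≫ (LaxHom₂.nat t).app x := rfl

@[simp]
theorem id_nat_app (f : S ⟶ T) (x : S.alg.carrier) :
    (LaxHom₂.nat (𝟙 f)).app x = 𝟙 ((LaxHom.functor f).obj x) := rfl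

@[simp]
theorem whiskerRight_nat_app {f f' : S ⟶ T} (s : f ⟶ f') (g : T ⟶ U) (x : S.alg.carrier) :
    (LaxHom₂.nat (s ▷ g)).app x = (LaxHom.functor g).map ((LaxHom₂.nat s).app x) := rfl

@[simp]
theorem whiskerLeft_nat_app (f : S ⟶ T) {g g' : T ⟶ U} (s : g ⟶ g') (x : S.alg.carrier) :
    (LaxHom₂.nat (f ◁ s)).app x = (LaxHom₂.nat s).app ((LaxHom.functor f).obj x) := rfl

@[simp]
theorem associator_hom_app (f : S ⟶ T) (g : T ⟶ U) (h : U ⟶ V) (x : S.alg.carrier) :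
    (LaxHom₂.nat (α_ f g h).hom).app x =
      𝟙 ((LaxHom.functor h).obj ((LaxHom.functor g).obj ((LaxHom.functor f).obj x))) :=
  LaxHom.associator_hom_app f g h x

@[simp]
theorem associator_inv_app (f : S ⟶ T) (g : T ⟶ U) (h : U ⟶ V) (x : S.alg.carrier) :
    (LaxHom₂.nat (α_ f g h).inv).app x =
      𝟙 ((LaxHom.functor h).obj ((LaxHom.functor g).obj ((LaxHom.functor f).obj x))) :=
  LaxHom.associator_inv_app f g h x

@[simp]
theorem leftUnitor_hom_app (f : S ⟶ T) (x : S.alg.carrier) :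
    (LaxHom₂.nat (λ_ f).hom).app x = 𝟙 ((LaxHom.functor f).obj x) :=
  LaxHom.leftUnitor_hom_app f x

@[simp]
theorem leftUnitor_inv_app (f : S ⟶ T) (x : S.alg.carrier) :
    (LaxHom₂.nat (λ_ f).inv).app x = 𝟙 ((LaxHom.functor f).obj x) :=
  LaxHom.leftUnitor_inv_app f x

@[simp]
theorem rightUnitor_hom_app (f : S ⟶ T) (x : S.alg.carrier) :
    (LaxHom₂.nat (ρ_ f).hom).app x = 𝟙 ((LaxHom.functor f).obj x) :=
  LaxHom.rightUnitor_hom_app f x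

@[simp]
theorem rightUnitor_inv_app (f : S ⟶ T) (x : S.alg.carrier) :
    (LaxHom₂.nat (ρ_ f).inv).app x = 𝟙 ((LaxHom.functor f).obj x) :=
  LaxHom.rightUnitor_inv_app f x

end LaxAlg

theorem comm_assoc {C : Type*} [Category C] {a b b' c d : C} {p : a ⟶ b} {q : b ⟶ c} {p' : a ⟶ b'}
    {q' : b' ⟶ c} (h : p ≫ q = p' ≫ q') (r : c ⟶ d) : p ≫ q ≫ r = p' ≫ q' ≫ r := by
  rw [← Category.assoc, h, Category.assoc]

variable {L : Type u} [SmallCategory L]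

open Bicategory

/-- A homotopy morphism between diagrams of `M`-algebras and lax morphisms. -/
structure HMor (D F : L ⥤ LaxAlg M) where
  app : ∀ l : L, D.obj l ⟶ F.obj l
  nat : ∀ {l l' : L} (a : l ⟶ l'), app l ≫ F.map a ⟶ D.map a ≫ app l'
  nat_id : ∀ (l : L) (x : (D.obj l).alg.carrier),
    HEq ((nat (𝟙 l)).nat.app x) (𝟙 ((app l).functor.obj x))
  nat_comp : ∀ {l l' l'' : L} (a : l ⟶ l') (b : l' ⟶ l'') (x : (D.obj l).alg.carrier),
    HEq ((nat (a ≫ b)).nat.app x)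
      ((F.map b).functor.map ((nat a).nat.app x) ≫ (nat b).nat.app ((D.map a).functor.obj x))


namespace HMor

variable {D F G H : L ⥤ LaxAlg M}

theorem ext_of {j k : HMor D F} (h : ∀ l, j.app l = k.app l)
    (h' : ∀ (l l' : L) (a : l ⟶ l') (x : (D.obj l).alg.carrier),
      HEq ((j.nat a).nat.app x) ((k.nat a).nat.app x)) : j = k := by
  obtain ⟨p, n, _, _⟩ := j
  obtain ⟨p', n', _, _⟩ := k
  obtain rfl : p = p' := funext h
  obtain rfl : @n = @n' := by
    funext l l' a
    exact LaxHom.hom_ext fun x => eq_of_heq (h' l l' a x)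
  rfl

theorem map_id_obj (D : L ⥤ LaxAlg M) (l : L) (x : (D.obj l).alg.carrier) :
    (D.map (𝟙 l)).functor.obj x = x := by
  rw [D.map_id]; rfl

theorem map_comp_obj (D : L ⥤ LaxAlg M) {l l' l'' : L} (a : l ⟶ l') (b : l' ⟶ l'')
    (x : (D.obj l).alg.carrier) :
    (D.map (a ≫ b)).functor.obj x = (D.map b).functor.obj ((D.map a).functor.obj x) := by
  rw [D.map_comp]; rfl

theorem map_id_map (D : L ⥤ LaxAlg M) (l : L) {x y : (D.obj l).alg.carrier} (k : x ⟶ y) :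
    HEq ((D.map (𝟙 l)).functor.map k) k := by
  rw [D.map_id]; rfl

theorem map_comp_map (D : L ⥤ LaxAlg M) {l l' l'' : L} (a : l ⟶ l') (b : l' ⟶ l'')
    {x y : (D.obj l).alg.carrier} (k : x ⟶ y) :
    HEq ((D.map (a ≫ b)).functor.map k) ((D.map b).functor.map ((D.map a).functor.map k)) := by
  rw [D.map_comp]; rfl

def id (D : L ⥤ LaxAlg M) : HMor D D where
  app l := 𝟙 (D.obj l)
  nat a := (λ_ (D.map a)).hom ≫ (ρ_ (D.map a)).inv
  nat_id l x := by
    refine HEq.trans (b := 𝟙 ((D.map (𝟙 l)).functor.obj x)) (heq_of_eq ?_)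
      (id_heq (map_id_obj D l x))
    simp
  nat_comp a b x := by
    simpa using id_heq (map_comp_obj D a b x)

/-- The composite of two homotopy morphisms, in diagrammatic order. -/
def comp (j : HMor D F) (k : HMor F G) : HMor D G where
  app l := j.app l ≫ k.app l
  nat {l l'} a := (α_ _ _ _).hom ≫ j.app l ◁ k.nat a ≫ (α_ _ _ _).inv ≫ j.nat a ▷ k.app l' ≫
    (α_ _ _ _).hom
  nat_id l x := by
    have h1 := k.nat_id l ((j.app l).functor.obj x)
    have h2 := map_heq (k.app l).functor
      (map_id_obj F l ((j.app l).functor.obj x))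
      (congrArg (j.app l).functor.obj (map_id_obj D l x)) (j.nat_id l x)
    have h3 := heq_comp (map_id_obj G l ((k.app l).functor.obj ((j.app l).functor.obj x)))
      (congrArg (k.app l).functor.obj (map_id_obj F l ((j.app l).functor.obj x)))
      (congrArg (fun y => (k.app l).functor.obj ((j.app l).functor.obj y)) (map_id_obj D l x))
      h1 h2
    simpa using h3
  nat_comp {l l' l''} a b x := by
    have h1 := k.nat_comp a b ((j.app l).functor.obj x)
    have h2 := map_heq (k.app l'').functor
      (map_comp_obj F a b ((j.app l).functor.obj x))
      (congrArg (j.app l'').functor.obj (map_comp_obj D a b x)) (j.nat_comp a b x)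
    have h3 := heq_comp (map_comp_obj G a b ((k.app l).functor.obj ((j.app l).functor.obj x)))
      (congrArg (k.app l'').functor.obj (map_comp_obj F a b ((j.app l).functor.obj x)))
      (congrArg (fun y => (k.app l'').functor.obj ((j.app l'').functor.obj y))
        (map_comp_obj D a b x))
      h1 h2
    have h4 := (LaxHom₂.nat (k.nat b)).naturality ((j.nat a).nat.app x)
    simp only [LaxAlg.comp_functor, Functor.comp_obj, Functor.comp_map] at h4
    simp only [LaxAlg.comp_functor, LaxAlg.comp_nat_app, LaxAlg.whiskerRight_nat_app,
      LaxAlg.whiskerLeft_nat_app, LaxAlg.associator_hom_app, LaxAlg.associator_inv_app,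
      Category.id_comp, Category.comp_id, Functor.comp_obj, Functor.comp_map, Functor.map_comp,
      Category.assoc] at h3 ⊢
    exact h3.trans (heq_of_eq (congrArg (fun z => _ ≫ z) (comm_assoc h4.symm _)))

end HMor

/-- A 2-cell between homotopy morphisms. -/
@[ext]
structure HMor₂ {D F : L ⥤ LaxAlg M} (j k : HMor D F) where
  app : ∀ l : L, j.app l ⟶ k.app l
  comm : ∀ {l l' : L} (a : l ⟶ l'), app l ▷ F.map a ≫ k.nat a = j.nat a ≫ D.map a ◁ app l'

instance hMorCategory (D F : L ⥤ LaxAlg M) : Category (HMor D F) where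
  Hom j k := HMor₂ j k
  id j := { app := fun l => 𝟙 (j.app l)
            comm := fun a => by simp }
  comp s t :=
    { app := fun l => s.app l ≫ t.app l
      comm := fun a => by
        rw [comp_whiskerRight, Category.assoc, t.comm, ← Category.assoc, s.comm, Category.assoc,
          ← whiskerLeft_comp] }
  id_comp s := HMor₂.ext (funext fun l => Category.id_comp _)
  comp_id s := HMor₂.ext (funext fun l => Category.comp_id _)
  assoc s t r := HMor₂.ext (funext fun l => Category.assoc _ _ _)

namespace HMor

variable {D F G H : L ⥤ LaxAlg M}

theorem hom_ext {j k : HMor D F} {s t : j ⟶ k}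
    (h : ∀ (l : L) (x : (D.obj l).alg.carrier), (s.app l).nat.app x = (t.app l).nat.app x) :
    s = t :=
  HMor₂.ext (funext fun l => LaxHom.hom_ext (h l))

@[simp]
theorem id_app' (j : HMor D F) (l : L) : HMor₂.app (𝟙 j) l = 𝟙 (j.app l) := rfl

@[simp]
theorem comp_app' {j k i : HMor D F} (s : j ⟶ k) (t : k ⟶ i) (l : L) :
    HMor₂.app (s ≫ t) l = s.app l ≫ t.app l := rfl

@[simp]
theorem comp_app (j : HMor D F) (k : HMor F G) (l : L) : (j.comp k).app l = j.app l ≫ k.app l :=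
  rfl

@[simp]
theorem id_app (l : L) : (HMor.id D).app l = 𝟙 (D.obj l) := rfl

theorem comp_nat_nat_app (j : HMor D F) (k : HMor F G) {l l' : L} (a : l ⟶ l')
    (x : (D.obj l).alg.carrier) :
    (LaxHom₂.nat ((j.comp k).nat a)).app x =
      (k.nat a).nat.app ((j.app l).functor.obj x) ≫ (k.app l').functor.map ((j.nat a).nat.app x) := by
  simp [comp]

theorem eqToHom_app_app {j k : HMor D F} (h : j = k) (l : L) (x : (D.obj l).alg.carrier) :
    (HMor₂.app (eqToHom h) l).nat.app x = eqToHom (by rw [h]) := by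
  subst h; rfl

/-- The 2-cell `k ∘ s`. -/
def whiskerR {j j' : HMor D F} (s : j ⟶ j') (k : HMor F G) : j.comp k ⟶ j'.comp k where
  app l := s.app l ▷ k.app l
  comm {l l'} a := LaxHom.hom_ext fun x => by
    have h := congrArg (fun c => (LaxHom.functor (k.app l')).map ((LaxHom₂.nat c).app x)) (s.comm a)
    have h4 := (LaxHom₂.nat (k.nat a)).naturality ((s.app l).nat.app x)
    simp at h h4
    simp [comp]
    rw [← Category.assoc, h4]
    simp [h]

/-- The 2-cell `s ∘ j`. -/
def whiskerL (j : HMor D F) {k k' : HMor F G} (s : k ⟶ k') : j.comp k ⟶ j.comp k' where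
  app l := j.app l ◁ s.app l
  comm {l l'} a := LaxHom.hom_ext fun x => by
    have h := congrArg (fun c => (LaxHom₂.nat c).app ((j.app l).functor.obj x)) (s.comm a)
    have h4 := (LaxHom₂.nat (s.app l')).naturality ((j.nat a).nat.app x)
    simp at h h4
    simp [comp]
    rw [← Category.assoc, h]
    simp [h4]

@[simp]
theorem whiskerR_app {j j' : HMor D F} (s : j ⟶ j') (k : HMor F G) (l : L) :
    (whiskerR s k).app l = s.app l ▷ k.app l := rfl

@[simp]
theorem whiskerL_app (j : HMor D F) {k k' : HMor F G} (s : k ⟶ k') (l : L) :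
    (whiskerL j s).app l = j.app l ◁ s.app l := rfl

theorem id_comp' (j : HMor D F) : (HMor.id D).comp j = j :=
  ext_of (fun l => Bicategory.Strict.id_comp _) fun l l' a x => heq_of_eq (by simp [comp, HMor.id])

theorem comp_id' (j : HMor D F) : j.comp (HMor.id F) = j :=
  ext_of (fun l => Bicategory.Strict.comp_id _) fun l l' a x => heq_of_eq (by simp [comp, HMor.id])

theorem assoc' (j : HMor D F) (k : HMor F G) (i : HMor G H) :
    (j.comp k).comp i = j.comp (k.comp i) :=
  ext_of (fun l => Bicategory.Strict.assoc _ _ _) fun l l' a x => heq_of_eq (by simp [comp])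

def associator (j : HMor D F) (k : HMor F G) (i : HMor G H) :
    (j.comp k).comp i ≅ j.comp (k.comp i) :=
  eqToIso (assoc' j k i)

def leftUnitor (j : HMor D F) : (HMor.id D).comp j ≅ j :=
  eqToIso (id_comp' j)

def rightUnitor (j : HMor D F) : j.comp (HMor.id F) ≅ j :=
  eqToIso (comp_id' j)

theorem eqToHom_app' {j k : HMor D F} (h : j = k) (l : L) :
    HMor₂.app (eqToHom h) l = eqToHom (by rw [h]) := by
  subst h; rfl

@[simp]
theorem associator_hom_app (j : HMor D F) (k : HMor F G) (i : HMor G H) (l : L) :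
    (associator j k i).hom.app l = (α_ (j.app l) (k.app l) (i.app l)).hom :=
  (eqToHom_app' (assoc' j k i) l).trans
    (by rw [Bicategory.Strict.associator_eqToIso]; rfl)

@[simp]
theorem associator_inv_app (j : HMor D F) (k : HMor F G) (i : HMor G H) (l : L) :
    (associator j k i).inv.app l = (α_ (j.app l) (k.app l) (i.app l)).inv :=
  (eqToHom_app' (assoc' j k i).symm l).trans
    (by rw [Bicategory.Strict.associator_eqToIso]; rfl)

@[simp]
theorem leftUnitor_hom_app (j : HMor D F) (l : L) :
    (leftUnitor j).hom.app l = (λ_ (j.app l)).hom :=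
  (eqToHom_app' (id_comp' j) l).trans
    (by rw [Bicategory.Strict.leftUnitor_eqToIso]; rfl)

@[simp]
theorem leftUnitor_inv_app (j : HMor D F) (l : L) :
    (leftUnitor j).inv.app l = (λ_ (j.app l)).inv :=
  (eqToHom_app' (id_comp' j).symm l).trans
    (by rw [Bicategory.Strict.leftUnitor_eqToIso]; rfl)

@[simp]
theorem rightUnitor_hom_app (j : HMor D F) (l : L) :
    (rightUnitor j).hom.app l = (ρ_ (j.app l)).hom :=
  (eqToHom_app' (comp_id' j) l).trans
    (by rw [Bicategory.Strict.rightUnitor_eqToIso]; rfl)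

@[simp]
theorem rightUnitor_inv_app (j : HMor D F) (l : L) :
    (rightUnitor j).inv.app l = (ρ_ (j.app l)).inv :=
  (eqToHom_app' (comp_id' j).symm l).trans
    (by rw [Bicategory.Strict.rightUnitor_eqToIso]; rfl)

end HMor

variable (L M) in
/-- The 2-category of `L`-diagrams of `M`-algebras and lax morphisms, with homotopy morphisms as
1-cells. -/
structure Diag : Type (u + 1) where
  diagram : L ⥤ LaxAlg M

instance : Bicategory (Diag M L) where
  Hom D F := HMor D.diagram F.diagram
  id D := HMor.id D.diagram
  comp f g := f.comp g
  homCategory D F := hMorCategory D.diagram F.diagram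
  whiskerLeft f _ _ s := HMor.whiskerL f s
  whiskerRight s g := HMor.whiskerR s g
  associator f g h := HMor.associator f g h
  leftUnitor f := HMor.leftUnitor f
  rightUnitor f := HMor.rightUnitor f
  whiskerLeft_id f g := HMor₂.ext (funext fun l => by simp)
  whiskerLeft_comp f _ _ _ s t := HMor₂.ext (funext fun l => by simp)
  id_whiskerLeft s := HMor₂.ext (funext fun l => by simp)
  comp_whiskerLeft f g _ _ s := HMor₂.ext (funext fun l => by simp)
  id_whiskerRight f g := HMor₂.ext (funext fun l => by simp)
  comp_whiskerRight s t g := HMor₂.ext (funext fun l => by simp)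
  whiskerRight_id s := HMor₂.ext (funext fun l => by simp)
  whiskerRight_comp s g h := HMor₂.ext (funext fun l => by simp)
  whisker_assoc f _ _ s h := HMor₂.ext (funext fun l => by simp)
  whisker_exchange s t := HMor₂.ext (funext fun l => by simpa using whisker_exchange _ _)
  pentagon f g h i := HMor₂.ext (funext fun l => by simp)
  triangle f g := HMor₂.ext (funext fun l => by simp)

instance : Bicategory.Strict (Diag M L) where
  id_comp := HMor.id_comp'
  comp_id := HMor.comp_id'
  assoc := HMor.assoc'

/-! ### The constant diagram functor -/

/-- The constant diagram on an algebra. -/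
def constObj (L : Type u) [SmallCategory L] (S : Alg M) : L ⥤ LaxAlg M :=
  (Functor.const L).obj ⟨S⟩

/-- The identity 2-cell of `g`, placed in a naturality square with identities. -/
def idSquare {S T : LaxAlg M} (g : S ⟶ T) : g ≫ 𝟙 T ⟶ 𝟙 S ≫ g :=
  (ρ_ g).hom ≫ (λ_ g).inv

theorem idSquare_app {S T : LaxAlg M} (g : S ⟶ T) (x : S.alg.carrier) :
    (LaxHom₂.nat (idSquare g)).app x = 𝟙 ((LaxHom.functor g).obj x) := by
  rw [idSquare, LaxAlg.comp_nat_app, LaxAlg.rightUnitor_hom_app, LaxAlg.leftUnitor_inv_app]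
  exact Category.comp_id _

/-- A strict morphism, regarded as a homotopy morphism between constant diagrams. -/
def constMap (L : Type u) [SmallCategory L] {S T : Alg M} (f : StrictHom S T) :
    HMor (constObj L S) (constObj L T) where
  app _ := f.toLax
  nat _ := idSquare (S := ⟨S⟩) (T := ⟨T⟩) f.toLax
  nat_id l x := heq_of_eq (idSquare_app (S := ⟨S⟩) (T := ⟨T⟩) f.toLax x)
  nat_comp a b x := by
    have h := idSquare_app (S := ⟨S⟩) (T := ⟨T⟩) f.toLax x
    refine heq_of_eq (h.trans ?_)
    refine Eq.trans ?_ (congrArg₂ (· ≫ ·) h.symm h.symm)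
    exact (Category.comp_id _).symm

end CatOp

namespace CatOp

variable {M : CatOperad.{u}} {L : Type u} [SmallCategory L]

open Bicategory

theorem constMap_comp {S T U : Alg M} (f : StrictHom S T) (g : StrictHom T U) :
    constMap L (f.comp g) = (constMap L f).comp (constMap L g) := by
  refine HMor.ext_of (fun l => LaxHom.ext_of rfl fun n A x => heq_of_eq ?_)
    fun l l' a x => heq_of_eq ?_
  · refine Eq.symm ((congrArg (fun z => _ ≫ z) (eqToHom_map g.functor (f.map_act A x).symm)).trans ?_)
    exact eqToHom_trans (g.map_act A fun i => f.functor.obj (x i)).symm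
      (congrArg g.functor.obj (f.map_act A x).symm)
  · refine Eq.trans ?_ (HMor.comp_nat_nat_app (constMap L f) (constMap L g) a x).symm
    refine Eq.trans (idSquare_app (S := ⟨S⟩) (T := ⟨U⟩) (f.comp g).toLax x) ?_
    have h1 := idSquare_app (S := ⟨S⟩) (T := ⟨T⟩) f.toLax x
    have h2 := idSquare_app (S := ⟨T⟩) (T := ⟨U⟩) g.toLax (f.functor.obj x)
    refine Eq.trans ?_ (congrArg₂ (· ≫ ·) h2.symm (congrArg g.functor.map h1).symm)
    refine Eq.trans ?_ (congrArg (fun z => _ ≫ z) (g.functor.map_id _).symm)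
    exact (Category.comp_id _).symm

theorem constMap_id (S : Alg M) : constMap L (StrictHom.id S) = HMor.id (constObj L S) := by
  refine HMor.ext_of (fun l => LaxHom.ext_of rfl fun n A x => heq_of_eq rfl)
    fun l l' a x => heq_of_eq ?_
  refine (idSquare_app (S := ⟨S⟩) (T := ⟨S⟩) (StrictHom.id S).toLax x).trans ?_
  refine Eq.symm ((LaxAlg.comp_nat_app _ _ _).trans ?_)
  rw [LaxAlg.leftUnitor_hom_app, LaxAlg.rightUnitor_inv_app]
  exact Category.comp_id _

def constMap₂ (L : Type u) [SmallCategory L] {S T : Alg M} {f g : StrictHom S T} (s : f ⟶ g) :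
    constMap L f ⟶ constMap L g where
  app _ := StrictHom₂.toLax s
  comm a := LaxHom.hom_ext fun x => by
    have h1 := idSquare_app (S := ⟨S⟩) (T := ⟨T⟩) f.toLax x
    have h2 := idSquare_app (S := ⟨S⟩) (T := ⟨T⟩) g.toLax x
    refine ((congrArg (fun z => s.nat.app x ≫ z) h2).trans ?_).trans
      (congrArg (fun z => z ≫ s.nat.app x) h1).symm
    exact (Category.comp_id _).trans (Category.id_comp _).symm

variable (L M) in
/-- The constant diagram functor. -/
def constDiagram : StrictPseudofunctor (Alg M) (Diag M L) :=
  StrictPseudofunctor.mk''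
    { obj := fun S => ⟨constObj L S⟩
      map := fun f => constMap L f
      map₂ := fun s => constMap₂ L s
      map₂_id := fun f => rfl
      map₂_comp := fun s t => rfl
      map_id := fun S => constMap_id S
      map_comp := fun f g => constMap_comp f g
      map₂_whisker_left := fun f _ _ s => HMor.hom_ext fun l x => by
        refine Eq.symm ((congrArg₂ (· ≫ ·) (HMor.eqToHom_app_app (constMap_comp f _) l x)
          (congrArg (fun z => s.nat.app (f.functor.obj x) ≫ z)
            (HMor.eqToHom_app_app (constMap_comp f _).symm l x))).trans ?_)
        exact (Category.id_comp _).trans (Category.comp_id _)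
      map₂_whisker_right := fun {_ _ _ f f'} s g => HMor.hom_ext fun l x => by
        refine Eq.symm ((congrArg₂ (· ≫ ·) (HMor.eqToHom_app_app (constMap_comp f g) l x)
          (congrArg (fun z => g.functor.map (s.nat.app x) ≫ z)
            (HMor.eqToHom_app_app (constMap_comp f' g).symm l x))).trans ?_)
        exact (Category.id_comp _).trans (Category.comp_id _) }

/-! ### Adjunctions between 2-functors -/

/-- The data of a 2-functor `F` being left adjoint to a 2-functor `G` between (strict)
2-categories: a strictly 2-natural unit such that `r ↦ G r ∘ unit` is an isomorphism
of the category of 1-cells `F X ⟶ S` with the category of 1-cells `X ⟶ G S`. -/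
structure TwoAdjunction {B C : Type*} [Bicategory B] [Bicategory C] (F : StrictPseudofunctor B C)
    (G : StrictPseudofunctor C B) where
  unit : ∀ X : B, X ⟶ G.obj (F.obj X)
  unit_naturality : ∀ {X Y : B} (f : X ⟶ Y), f ≫ unit Y = unit X ≫ G.map (F.map f)
  unit_naturality₂ : ∀ {X Y : B} {f g : X ⟶ Y} (s : f ⟶ g),
    s ▷ unit Y ≫ eqToHom (unit_naturality g) =
      eqToHom (unit_naturality f) ≫ unit X ◁ G.map₂ (F.map₂ s)
  bijective : ∀ (X : B) (S : C),
    Function.Bijective fun r : F.obj X ⟶ S => unit X ≫ G.map r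
  bijective₂ : ∀ (X : B) (S : C) (r r' : F.obj X ⟶ S),
    Function.Bijective fun t : r ⟶ r' => unit X ◁ G.map₂ t

/-! ### The category of representatives -/

variable (X : L ⥤ LaxAlg M)

/-- The pairs `(K, l)` with `l` in `L` and `K` in `X l`, written as `⟨l, K⟩`. -/
abbrev Lab : Type u := Σ l : L, (X.obj l).alg.carrier

/-- The objects `(A; (K 1, l 1), …, (K n, l n))`. -/
structure Rep : Type u where
  n : ℕ
  op : M.Op n
  lab : Fin n → Lab X

/-- A node `C` with inputs labelled by `src` and with output `tgt = (K', l')`: morphisms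
`lam j : l j ⟶ l'` and a morphism `C (lam 1 K 1, …, lam r K r) ⟶ K'` in `X l'`. -/
structure Node {r : ℕ} (C : M.Op r) (src : Fin r → Lab X) (tgt : Lab X) : Type u where
  lam : ∀ j, (src j).1 ⟶ tgt.1
  map : (X.obj tgt.1).alg.act C (fun j => (X.map (lam j)).functor.obj (src j).2) ⟶ tgt.2

variable {X}

namespace Node

/-- Transport along an equality of source labels. -/
def cast {r : ℕ} {C : M.Op r} {src src' : Fin r → Lab X} {tgt : Lab X} (h : src = src')
    (a : Node X C src tgt) : Node X C src' tgt :=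
  h ▸ a

/-- The identity node. -/
def id (x : Lab X) : Node X M.one (fun _ => x) x where
  lam _ := 𝟙 x.1
  map := eqToHom (((X.obj x.1).alg.one_act _).trans (HMor.map_id_obj X x.1 x.2))

theorem comp_aux {s : ℕ} {r : Fin s → ℕ} {D : M.Op s} {C : ∀ j, M.Op (r j)}
    {src : ∀ j, Fin (r j) → Lab X} {mid : Fin s → Lab X} {tgt : Lab X}
    (lam : ∀ j i, (src j i).1 ⟶ (mid j).1) (rho : ∀ j, (mid j).1 ⟶ tgt.1) :
    (X.obj tgt.1).alg.act (M.comp r rfl D C) (fun l =>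
        (X.map (lam ((lex r rfl).symm l).1 ((lex r rfl).symm l).2 ≫
          rho ((lex r rfl).symm l).1)).functor.obj
          (src ((lex r rfl).symm l).1 ((lex r rfl).symm l).2).2) =
      (X.obj tgt.1).alg.act D (fun j => (X.obj tgt.1).alg.act (C j) (fun i =>
        (X.map (rho j)).functor.obj ((X.map (lam j i)).functor.obj (src j i).2))) := by
  rw [Alg.comp_act]
  congr 1
  funext j
  congr 1
  funext i
  have : ∀ p : (Σ j, Fin (r j)), p = ⟨j, i⟩ →
      (X.map (lam p.1 p.2 ≫ rho p.1)).functor.obj (src p.1 p.2).2 =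
        (X.map (rho j)).functor.obj ((X.map (lam j i)).functor.obj (src j i).2) := by
    rintro _ rfl
    exact HMor.map_comp_obj X _ _ _
  exact this _ (Equiv.symm_apply_apply _ _)

/-- The composite of the nodes `b j` with a node `a`, with `D ∗ (C 1 ⊕ … ⊕ C s)` as operation. It
is given by `D (C j (rho j (lam j i K j i))) ⟶ D (rho j (C j (lam j i K j i))) ⟶ D (rho j K' j)
⟶ K''`. -/
def comp {s : ℕ} {r : Fin s → ℕ} {D : M.Op s} {C : ∀ j, M.Op (r j)}
    {src : ∀ j, Fin (r j) → Lab X} {mid : Fin s → Lab X} {tgt : Lab X}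
    (b : ∀ j, Node X (C j) (src j) (mid j)) (a : Node X D mid tgt) :
    Node X (M.comp r rfl D C)
      (fun l => src ((lex r rfl).symm l).1 ((lex r rfl).symm l).2) tgt where
  lam l := (b ((lex r rfl).symm l).1).lam ((lex r rfl).symm l).2 ≫ a.lam ((lex r rfl).symm l).1
  map := eqToHom (comp_aux (fun j => (b j).lam) a.lam) ≫
    (X.obj tgt.1).alg.actMap (𝟙 D) (fun j =>
      (X.map (a.lam j)).lax (C j) (fun i => (X.map ((b j).lam i)).functor.obj (src j i).2)) ≫
    (X.obj tgt.1).alg.actMap (𝟙 D) (fun j => (X.map (a.lam j)).functor.map (b j).map) ≫ a.map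

theorem perm_aux {r : ℕ} (C : M.Op r) (src : Fin r → Lab X) (tgt : Lab X)
    (lam : ∀ j, (src j).1 ⟶ tgt.1) (ρ : Equiv.Perm (Fin r)) :
    (X.obj tgt.1).alg.act ((M.perm ρ).obj C)
        (fun j => (X.map (lam (ρ j))).functor.obj (src (ρ j)).2) =
      (X.obj tgt.1).alg.act C (fun j => (X.map (lam j)).functor.obj (src j).2) := by
  rw [Alg.perm_act]
  congr 1
  funext j
  have : ∀ p, p = j → (X.map (lam p)).functor.obj (src p).2 =
      (X.map (lam j)).functor.obj (src j).2 := by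
    rintro _ rfl
    rfl
  exact this _ (Equiv.apply_symm_apply _ _)

/-- The same node, with its inputs listed in the order `ρ 1, …, ρ r`. -/
def perm {r : ℕ} {C : M.Op r} {src : Fin r → Lab X} {tgt : Lab X} (a : Node X C src tgt)
    (ρ : Equiv.Perm (Fin r)) : Node X ((M.perm ρ).obj C) (fun j => src (ρ j)) tgt where
  lam j := a.lam (ρ j)
  map := eqToHom (perm_aux C src tgt a.lam ρ) ≫ a.map

/-- Precomposition of a node with a morphism `α : D ⟶ C`. -/
def precomp {r : ℕ} {D C : M.Op r} {src : Fin r → Lab X} {tgt : Lab X} (α : D ⟶ C)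
    (a : Node X C src tgt) : Node X D src tgt where
  lam := a.lam
  map := (X.obj tgt.1).alg.actMap α
    (fun j => 𝟙 ((X.map (a.lam j)).functor.obj (src j).2)) ≫ a.map

end Node

/-- The morphisms from `P = (A; (K i, l i))` to `Q = (A'; (K' k, l' k))`. The number of elements
of the fibre of `φ` over `k` is `r k`, its elements are, in the chosen order,
`e ⟨k, 0⟩, e ⟨k, 1⟩, …`; so `φ (e ⟨k, j⟩) = k`. -/
structure RepHom (P Q : Rep X) : Type u where
  r : Fin Q.n → ℕ
  e : (Σ k, Fin (r k)) ≃ Fin P.n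
  C : ∀ k, M.Op (r k)
  γ : P.op ⟶ M.compE e Q.op C
  node : ∀ k, Node X (C k) (fun j => P.lab (e ⟨k, j⟩)) (Q.lab k)

namespace RepHom

def id (P : Rep X) : RepHom P P where
  r _ := 1
  e := Equiv.sigmaUnique (Fin P.n) fun _ => Fin 1
  C _ := M.one
  γ := eqToHom (M.compE_one P.op).symm
  node k := Node.id (P.lab k)

/-- The composite of two morphisms, in diagrammatic order. -/
def comp {P Q R : Rep X} (f : RepHom P Q) (g : RepHom Q R) : RepHom P R where
  r k := ∑ j, f.r (g.e ⟨k, j⟩)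
  e := nest g.e f.e
  C k := M.comp (fun j => f.r (g.e ⟨k, j⟩)) rfl (g.C k) (fun j => f.C (g.e ⟨k, j⟩))
  γ := f.γ ≫ M.compEMap f.e g.γ (fun l => 𝟙 (f.C l)) ≫
    eqToHom (M.compE_compE g.e f.e R.op g.C f.C)
  node k := Node.comp (fun j => f.node (g.e ⟨k, j⟩)) (g.node k)

end RepHom

namespace Rep

/-- `B (Y 1, …, Y n)`. -/
def act {n : ℕ} (B : M.Op n) (Y : Fin n → Rep X) : Rep X where
  n := ∑ i, (Y i).n
  op := M.comp (fun i => (Y i).n) rfl B (fun i => (Y i).op)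
  lab l := (Y ((lex (fun i => (Y i).n) rfl).symm l).1).lab
    ((lex (fun i => (Y i).n) rfl).symm l).2

theorem act_lab {n : ℕ} (B : M.Op n) (Y : Fin n → Rep X) (i : Fin n) (j : Fin (Y i).n) :
    (act B Y).lab (lex (fun i => (Y i).n) rfl ⟨i, j⟩) = (Y i).lab j := by
  have : ∀ p : (Σ i, Fin (Y i).n), p = ⟨i, j⟩ → (Y p.1).lab p.2 = (Y i).lab j := by
    rintro _ rfl
    rfl
  exact this _ (Equiv.symm_apply_apply _ _)

/-- The object `(A · σ; (K (σ 1), l (σ 1)), …, (K (σ n), l (σ n)))`. -/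
def permute (P : Rep X) (σ : Equiv.Perm (Fin P.n)) : Rep X where
  n := P.n
  op := (M.perm σ).obj P.op
  lab i := P.lab (σ i)

end Rep

namespace RepHom

/-- `β (f 1, …, f n) : B (Y 1, …, Y n) ⟶ B' (Y' 1, …, Y' n)`. -/
def act {n : ℕ} {B B' : M.Op n} {Y Y' : Fin n → Rep X} (β : B ⟶ B')
    (f : ∀ i, RepHom (Y i) (Y' i)) : RepHom (Rep.act B Y) (Rep.act B' Y') where
  r l := (f ((lex (fun i => (Y' i).n) rfl).symm l).1).r ((lex (fun i => (Y' i).n) rfl).symm l).2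
  e := graft (fun i => (Y' i).n) rfl (fun i => (f i).r) (fun i => (Y i).n) (fun i => (f i).e) rfl
  C l := (f ((lex (fun i => (Y' i).n) rfl).symm l).1).C ((lex (fun i => (Y' i).n) rfl).symm l).2
  γ := M.compMap (fun i => (Y i).n) rfl β (fun i => (f i).γ) ≫
    eqToHom (M.comp_compE (fun i => (Y' i).n) rfl (fun i => (f i).r) (fun i => (Y i).n)
      (fun i => (f i).e) rfl B' (fun i => (Y' i).op) (fun i => (f i).C))
  node l := ((f ((lex (fun i => (Y' i).n) rfl).symm l).1).node
    ((lex (fun i => (Y' i).n) rfl).symm l).2).cast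
      (funext fun _ => (Rep.act_lab B Y _ _).symm)

variable {P Q : Rep X} (f : RepHom P Q)

/-- The change of the target by a permutation of its inputs. -/
def permTarget (τ : Equiv.Perm (Fin Q.n)) : RepHom P (Q.permute τ) where
  r k := f.r (τ k)
  e := (Equiv.sigmaCongrLeft (β := fun k => Fin (f.r k)) τ).trans f.e
  C k := f.C (τ k)
  γ := f.γ ≫ eqToHom (M.compE_perm_root f.e Q.op f.C τ).symm
  node k := f.node (τ k)

/-- The change of the orders of the fibres. -/
def permNodes (ρ : ∀ k, Equiv.Perm (Fin (f.r k))) : RepHom P Q where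
  r := f.r
  e := (Equiv.sigmaCongrRight ρ).trans f.e
  C k := (M.perm (ρ k)).obj (f.C k)
  γ := f.γ ≫ eqToHom (M.compE_perm_nodes f.e Q.op f.C ρ).symm
  node k := (f.node k).perm (ρ k)

/-- The change of the source by a permutation of its inputs. -/
def permSource (τ : Equiv.Perm (Fin P.n)) : RepHom (P.permute τ) Q where
  r := f.r
  e := f.e.trans τ.symm
  C := f.C
  γ := (M.perm τ).map f.γ ≫ eqToHom (M.compE_perm f.e Q.op f.C τ)
  node k := (f.node k).cast
    (funext fun j => congrArg P.lab (Equiv.apply_symm_apply τ (f.e ⟨k, j⟩)).symm)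

end RepHom

end CatOp

namespace CatOp

variable {M : CatOperad.{u}} {L : Type u} [SmallCategory L]

open Bicategory

/-! ### The homotopy colimit -/

section Quotient

variable (X : L ⥤ LaxAlg M)

/-- The generating relations on objects. -/
inductive ObjRel : Rep X → Rep X → Prop
  | permute (P : Rep X) (σ : Equiv.Perm (Fin P.n)) : ObjRel (P.permute σ) P

/-- The objects of the homotopy colimit. -/
def HocolimObj : Type u := Quot (ObjRel X)

/-- The morphisms of the category of representatives, with arbitrary source and target. -/
structure Arrow : Type u where
  src : Rep X
  tgt : Rep X
  hom : RepHom src tgt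

/-- The generating relations on morphisms. -/
inductive MorRel : Arrow X → Arrow X → Prop
  /-- the nodes of the upper level may be permuted -/
  | target {P Q : Rep X} (f : RepHom P Q) (τ : Equiv.Perm (Fin Q.n)) :
      MorRel ⟨P, Q, f⟩ ⟨P, Q.permute τ, f.permTarget τ⟩
  /-- the inputs of the nodes of the upper level may be permuted -/
  | nodes {P Q : Rep X} (f : RepHom P Q) (ρ : ∀ k, Equiv.Perm (Fin (f.r k))) :
      MorRel ⟨P, Q, f⟩ ⟨P, Q, f.permNodes ρ⟩
  /-- morphisms of operations may be moved from `γ` to the nodes of the upper level -/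
  | decompose {P Q : Rep X} (r : Fin Q.n → ℕ) (e : (Σ k, Fin (r k)) ≃ Fin P.n)
      {D C : ∀ k, M.Op (r k)} (δ : P.op ⟶ M.compE e Q.op D) (α : ∀ k, D k ⟶ C k)
      (f : ∀ k, Node X (C k) (fun j => P.lab (e ⟨k, j⟩)) (Q.lab k)) :
      MorRel ⟨P, Q, ⟨r, e, C, δ ≫ M.compEMap e (𝟙 Q.op) α, f⟩⟩
        ⟨P, Q, ⟨r, e, D, δ, fun k => (f k).precomp (α k)⟩⟩
  /-- the inputs of the source may be permuted -/
  | source {P Q : Rep X} (f : RepHom P Q) (τ : Equiv.Perm (Fin P.n)) :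
      MorRel ⟨P, Q, f⟩ ⟨P.permute τ, Q, f.permSource τ⟩

/-- The morphisms of the homotopy colimit, with arbitrary source and target. -/
def HocolimMor : Type u := Quot (MorRel X)

variable {X}

/-- The class of an object of the category of representatives. -/
def Rep.cls (P : Rep X) : HocolimObj X := Quot.mk _ P

def HocolimMor.src : HocolimMor X → HocolimObj X :=
  Quot.lift (fun a => a.src.cls) (by
    rintro _ _ (_ | _ | _ | ⟨f, τ⟩)
    · rfl
    · rfl
    · rfl
    · exact (Quot.sound (ObjRel.permute _ τ)).symm)

def HocolimMor.tgt : HocolimMor X → HocolimObj X :=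
  Quot.lift (fun a => a.tgt.cls) (by
    rintro _ _ (⟨f, τ⟩ | _ | _ | _)
    · exact (Quot.sound (ObjRel.permute _ τ)).symm
    · rfl
    · rfl
    · rfl)

/-- The morphisms `U ⟶ V` of the homotopy colimit. -/
def HocolimHom (U V : HocolimObj X) : Type u :=
  { u : HocolimMor X // u.src = U ∧ u.tgt = V }

/-- The class of a morphism of the category of representatives. -/
def RepHom.cls {P Q : Rep X} (f : RepHom P Q) : HocolimHom P.cls Q.cls :=
  ⟨Quot.mk _ ⟨P, Q, f⟩, rfl, rfl⟩

end Quotient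

/-- The operations which the category of representatives, with its functors
`M n × R × … × R ⥤ R`, induces on the quotient, when they are well defined and make
it an `M`-algebra. -/
structure HocolimOps (X : L ⥤ LaxAlg M) where
  id : ∀ U : HocolimObj X, HocolimHom U U
  comp : ∀ {U V W : HocolimObj X}, HocolimHom U V → HocolimHom V W → HocolimHom U W
  act : ∀ {n : ℕ}, M.Op n → (Fin n → HocolimObj X) → HocolimObj X
  actMap : ∀ {n : ℕ} {B B' : M.Op n} {U V : Fin n → HocolimObj X}, (B ⟶ B') →
    (∀ i, HocolimHom (U i) (V i)) → HocolimHom (act B U) (act B' V)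
  id_cls : ∀ P : Rep X, id P.cls = (RepHom.id P).cls
  comp_cls : ∀ {P Q R : Rep X} (f : RepHom P Q) (g : RepHom Q R),
    comp f.cls g.cls = (f.comp g).cls
  act_cls : ∀ {n : ℕ} (B : M.Op n) (Y : Fin n → Rep X),
    act B (fun i => (Y i).cls) = (Rep.act B Y).cls
  actMap_cls : ∀ {n : ℕ} {B B' : M.Op n} {Y Y' : Fin n → Rep X} (β : B ⟶ B')
    (f : ∀ i, RepHom (Y i) (Y' i)),
    (actMap β fun i => (f i).cls).val = (RepHom.act β f).cls.val
  id_comp : ∀ {U V : HocolimObj X} (u : HocolimHom U V), comp (id U) u = u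
  comp_id : ∀ {U V : HocolimObj X} (u : HocolimHom U V), comp u (id V) = u
  assoc : ∀ {U V W Z : HocolimObj X} (u : HocolimHom U V) (v : HocolimHom V W)
    (w : HocolimHom W Z), comp (comp u v) w = comp u (comp v w)
  actMap_id : ∀ {n : ℕ} (B : M.Op n) (U : Fin n → HocolimObj X),
    actMap (𝟙 B) (fun i => id (U i)) = id (act B U)
  actMap_comp : ∀ {n : ℕ} {B B' B'' : M.Op n} {U V W : Fin n → HocolimObj X} (β : B ⟶ B')
    (β' : B' ⟶ B'') (u : ∀ i, HocolimHom (U i) (V i)) (v : ∀ i, HocolimHom (V i) (W i)),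
    actMap (β ≫ β') (fun i => comp (u i) (v i)) = comp (actMap β u) (actMap β' v)
  one_act : ∀ U : Fin 1 → HocolimObj X, act M.one U = U 0
  one_actMap : ∀ {U V : Fin 1 → HocolimObj X} (u : ∀ i, HocolimHom (U i) (V i)),
    HEq (actMap (𝟙 M.one) u) (u 0)
  comp_act : ∀ {n m : ℕ} (r : Fin n → ℕ) (h : ∑ i, r i = m) (A : M.Op n) (C : ∀ i, M.Op (r i))
    (U : Fin m → HocolimObj X),
    act (M.comp r h A C) U = act A (fun i => act (C i) (fun j => U (lex r h ⟨i, j⟩)))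
  comp_actMap : ∀ {n m : ℕ} (r : Fin n → ℕ) (h : ∑ i, r i = m) {A A' : M.Op n}
    {C C' : ∀ i, M.Op (r i)} {U V : Fin m → HocolimObj X} (α : A ⟶ A') (c : ∀ i, C i ⟶ C' i)
    (u : ∀ l, HocolimHom (U l) (V l)),
    HEq (actMap (M.compMap r h α c) u)
      (actMap α (fun i => actMap (c i) (fun j => u (lex r h ⟨i, j⟩))))
  perm_act : ∀ {n : ℕ} (σ : Equiv.Perm (Fin n)) (A : M.Op n) (U : Fin n → HocolimObj X),
    act ((M.perm σ).obj A) U = act A (fun i => U (σ.symm i))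
  perm_actMap : ∀ {n : ℕ} (σ : Equiv.Perm (Fin n)) {A A' : M.Op n} {U V : Fin n → HocolimObj X}
    (α : A ⟶ A') (u : ∀ i, HocolimHom (U i) (V i)),
    HEq (actMap ((M.perm σ).map α) u) (actMap α (fun i => u (σ.symm i)))

/-- The homotopy colimit, as an `M`-algebra. -/
def HocolimOps.toAlg {X : L ⥤ LaxAlg M} (ops : HocolimOps X) : Alg M where
  carrier := HocolimObj X
  cat :=
    { Hom := HocolimHom
      id := ops.id
      comp := ops.comp
      id_comp := ops.id_comp
      comp_id := ops.comp_id
      assoc := ops.assoc }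
  act := ops.act
  actMap := ops.actMap
  actMap_id := ops.actMap_id
  actMap_comp := ops.actMap_comp
  one_act := ops.one_act
  one_actMap := ops.one_actMap
  comp_act := ops.comp_act
  comp_actMap := ops.comp_actMap
  perm_act := ops.perm_act
  perm_actMap := ops.perm_actMap

/-! ### The universal homotopy morphism -/

section Universal

variable (X : L ⥤ LaxAlg M)

/-- The object `(id; (K, l))`. -/
def Rep.ι (l : L) (K : (X.obj l).alg.carrier) : Rep X where
  n := 1
  op := M.one
  lab _ := ⟨l, K⟩

/-- The atom `f : (id; (K, l)) ⟶ (id; (K', l))`. -/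
def atomMap {l : L} {K K' : (X.obj l).alg.carrier} (f : K ⟶ K') :
    RepHom (Rep.ι X l K) (Rep.ι X l K') where
  r _ := 1
  e := Equiv.sigmaUnique (Fin 1) fun _ => Fin 1
  C _ := M.one
  γ := eqToHom (M.compE_one M.one).symm
  node _ :=
    { lam := fun _ => 𝟙 l
      map := eqToHom (((X.obj l).alg.one_act _).trans (HMor.map_id_obj X l K)) ≫ f }

/-- The atom `a : (id; (K, l)) ⟶ (id; (a K, l'))`. -/
def atomIndex {l l' : L} (a : l ⟶ l') (K : (X.obj l).alg.carrier) :
    RepHom (Rep.ι X l K) (Rep.ι X l' ((X.map a).functor.obj K)) where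
  r _ := 1
  e := Equiv.sigmaUnique (Fin 1) fun _ => Fin 1
  C _ := M.one
  γ := eqToHom (M.compE_one M.one).symm
  node _ :=
    { lam := fun _ => a
      map := eqToHom ((X.obj l').alg.one_act _) }

/-- The evaluation `ev C : (C; (K 1, l), …, (K n, l)) ⟶ (id; (C (K 1, …, K n), l))`. -/
def ev {l : L} {n : ℕ} (C : M.Op n) (K : Fin n → (X.obj l).alg.carrier) :
    RepHom (⟨n, C, fun i => ⟨l, K i⟩⟩ : Rep X) (Rep.ι X l ((X.obj l).alg.act C K)) where
  r _ := n
  e := single n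
  C _ := C
  γ := eqToHom (M.one_compE C).symm
  node _ :=
    { lam := fun _ => 𝟙 l
      map := eqToHom (congrArg ((X.obj l).alg.act C)
        (funext fun i => HMor.map_id_obj X l (K i))) }

variable {X}

/-- The explicit description of the universal homotopy morphism to the homotopy colimit. -/
structure IsUniversal (ops : HocolimOps X) (j : HMor X (constObj L ops.toAlg)) : Prop where
  obj : ∀ (l : L) (K : (X.obj l).alg.carrier),
    (j.app l).functor.obj K = (Rep.ι X l K).cls
  map : ∀ (l : L) {K K' : (X.obj l).alg.carrier} (f : K ⟶ K'),
    HEq ((j.app l).functor.map f) (atomMap X f).cls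
  lax : ∀ (l : L) {n : ℕ} (A : M.Op n) (K : Fin n → (X.obj l).alg.carrier),
    HEq ((j.app l).lax A K) (ev X A K).cls
  nat : ∀ {l l' : L} (a : l ⟶ l') (K : (X.obj l).alg.carrier),
    HEq ((j.nat a).nat.app K) (atomIndex X a K).cls

end Universal

end CatOp

open CatOp Bicategory

/-!
The argument has three parts.

*The algebra structure.* Two objects of the category of representatives have the same class if and
only if they differ by a permutation of the inputs (`Rep.Iso`), and since the operad is `Σ`-free
this permutation is unique (`Rep.Iso.unique`). Composition of representatives is compatible with
permutations of sources, targets and nodes (`RepHom.Rel.comp`) and with moving a morphism of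
operations between the two parts of a morphism (`Decomp.comp_mk`, `Decomp.mk_comp`). By the
uniqueness of the permutation at the middle object, the class of a composite therefore depends
only on the classes of its factors (`RepHom.comp_congr`); the action of the operad is similar, but
needs no freeness (`RepHom.act_congr`). The laws of an algebra hold for representatives up to
permutations. Two devices keep the bookkeeping small: `IsPerm` compares operations whose arities
are only propositionally equal, and equations between morphisms of operations are equations
between operations of the arrow operad `CatOperad.arr`, so that a lemma on operations applies to
their morphisms too.

*The universal property.* A morphism of representatives consists of a morphism of operations and a
family of nodes, the part of the morphism over one element of the target. Every object of the
homotopy colimit is the value of an operation on atoms, and every morphism is obtained from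
morphisms of operations and nodes by composition and the action of the operad
(`HocolimOps.act_atoms`, `RepHom.ofOp_comp_ofNodes_rel`). So a strict homomorphism out of the
homotopy colimit is the same as an assignment of morphisms to nodes which is compatible with the
composition of nodes, with morphisms of operations and with permutations (`NodeEval`,
`NodeEval.toStrictHom`). A node, in turn, is a composite of index morphisms, an evaluation, and a
morphism in one of the given algebras (`Node.eq_postcomp`), so that evaluations of nodes are the
same as homotopy morphisms to a constant diagram (`LaxCocone.toNodeEval`, `NodeEval.toLaxCocone`).
The same description applies to 2-cells (`NodeEval.Trans`).

*The 2-adjunction.* A choice of arrows which are universal for 1-cells and 2-cells in strict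
2-categories extends to a 2-functor and a 2-adjunction with these arrows as unit
(`UniversalArrows.functor`, `UniversalArrows.adjunction`).
-/

/-! ### Renaming the inputs of operations -/

namespace CatOp

namespace CatOperad

variable {M : CatOperad.{u}}

variable (M) in
/-- `M.IsPerm σ A' A` says that `A'` is the operation `A` with its inputs renamed: the input `i` of
`A'` is the input `σ i` of `A`. The arities need not be syntactically equal, so no transport along
an equality of natural numbers is needed to compare operations. -/
inductive IsPerm : ∀ {n m : ℕ}, (Fin n ≃ Fin m) → M.Op n → M.Op m → Prop
  | mk {n : ℕ} (σ : Equiv.Perm (Fin n)) (A : M.Op n) : IsPerm σ ((M.perm σ).obj A) A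

theorem eq_of_finEquiv {n m : ℕ} (σ : Fin n ≃ Fin m) : n = m := by
  simpa using Fintype.card_congr σ

namespace IsPerm

theorem eq {n : ℕ} {σ : Equiv.Perm (Fin n)} {A' A : M.Op n} (h : M.IsPerm σ A' A) :
    A' = (M.perm σ).obj A := by
  cases h; rfl

theorem of_eq {n : ℕ} {σ : Equiv.Perm (Fin n)} {A' A : M.Op n} (h : A' = (M.perm σ).obj A) :
    M.IsPerm σ A' A := by
  subst h; exact .mk _ _

protected theorem refl {n : ℕ} (A : M.Op n) : M.IsPerm (Equiv.refl _) A A :=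
  of_eq (M.perm_one_obj A).symm

theorem of_eq_refl {n : ℕ} {A' A : M.Op n} (h : A' = A) : M.IsPerm (Equiv.refl _) A' A := by
  subst h; exact .refl _

theorem eq_of_refl {n : ℕ} {A' A : M.Op n} (h : M.IsPerm (Equiv.refl _) A' A) : A' = A :=
  h.eq.trans (M.perm_one_obj A)

protected theorem trans {n m q : ℕ} {σ : Fin n ≃ Fin m} {τ : Fin m ≃ Fin q} {A : M.Op n}
    {B : M.Op m} {C : M.Op q} (h : M.IsPerm σ A B) (h' : M.IsPerm τ B C) :
    M.IsPerm (σ.trans τ) A C := by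
  cases h
  cases h'
  refine of_eq ?_
  rw [perm_perm_obj]
  rfl

protected theorem symm {n m : ℕ} {σ : Fin n ≃ Fin m} {A : M.Op n} {B : M.Op m}
    (h : M.IsPerm σ A B) : M.IsPerm σ.symm B A := by
  obtain ⟨σ, _⟩ := h
  refine of_eq ?_
  rw [perm_perm_obj]
  have : σ * Equiv.symm σ = 1 := mul_inv_cancel σ
  rw [this, perm_one_obj]

theorem of_heq {n m : ℕ} {A : M.Op n} {B : M.Op m} (h : n = m) (h' : HEq A B) :
    M.IsPerm (finCongr h) A B := by
  subst h
  obtain rfl := eq_of_heq h'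
  exact .refl A

/-- A relabelling is unique when the symmetric groups act freely. -/
theorem unique (hM : M.SigmaFree) {n m : ℕ} {σ τ : Fin n ≃ Fin m} {A : M.Op n} {B : M.Op m}
    (h : M.IsPerm σ A B) (h' : M.IsPerm τ A B) : σ = τ := by
  obtain rfl := eq_of_finEquiv σ
  have := (h.symm.trans h').eq
  have h1 := hM _ _ _ this.symm
  have h2 : ∀ i, τ (σ.symm i) = i := fun i => Equiv.congr_fun h1 i
  ext i
  simpa using congrArg Fin.val (h2 (σ i)).symm

/-- Two-level trees are compatible with the relabelling of the root, of the nodes of the upper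
level and of the inputs. -/
theorem compE {n n' m m' : ℕ} {r : Fin n → ℕ} {r' : Fin n' → ℕ} {e : (Σ i, Fin (r i)) ≃ Fin m}
    {e' : (Σ i, Fin (r' i)) ≃ Fin m'} {A : M.Op n} {A' : M.Op n'} {C : ∀ i, M.Op (r i)}
    {C' : ∀ i, M.Op (r' i)} {τ : Fin n' ≃ Fin n} {σ : Fin m' ≃ Fin m}
    (ρ : ∀ k, Fin (r' k) ≃ Fin (r (τ k))) (hA : M.IsPerm τ A' A)
    (hC : ∀ k, M.IsPerm (ρ k) (C' k) (C (τ k)))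
    (he : ∀ k j, σ (e' ⟨k, j⟩) = e ⟨τ k, ρ k j⟩) :
    M.IsPerm σ (M.compE e' A' C') (M.compE e A C) := by
  cases hA
  obtain rfl : r' = fun k => r (τ k) := funext fun k => eq_of_finEquiv (ρ k)
  obtain rfl := eq_of_finEquiv σ
  obtain rfl : C' = fun k => (M.perm (ρ k)).obj (C (τ k)) := funext fun k => (hC k).eq
  refine of_eq ?_
  rw [compE_perm, ← M.compE_perm_root (e.trans σ.symm) A C τ]
  refine Eq.trans ?_ (M.compE_perm_nodes _ ((M.perm τ).obj A) _ ρ)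
  congr 1
  ext ⟨k, j⟩
  have := he k j
  rw [← Equiv.eq_symm_apply] at this
  exact congrArg Fin.val this

theorem comp {n n' m m' : ℕ} {r : Fin n → ℕ} {r' : Fin n' → ℕ} {h : ∑ i, r i = m}
    {h' : ∑ i, r' i = m'} {A : M.Op n} {A' : M.Op n'} {C : ∀ i, M.Op (r i)}
    {C' : ∀ i, M.Op (r' i)} {τ : Fin n' ≃ Fin n} {σ : Fin m' ≃ Fin m}
    (ρ : ∀ k, Fin (r' k) ≃ Fin (r (τ k))) (hA : M.IsPerm τ A' A)
    (hC : ∀ k, M.IsPerm (ρ k) (C' k) (C (τ k)))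
    (he : ∀ k j, σ (lex r' h' ⟨k, j⟩) = lex r h ⟨τ k, ρ k j⟩) :
    M.IsPerm σ (M.comp r' h' A' C') (M.comp r h A C) := by
  rw [← compE_lex, ← compE_lex]
  exact compE ρ hA hC he

/-- Associativity for three-level trees with arbitrary labellings. -/
theorem assoc {p n m m' : ℕ} {s : Fin p → ℕ} {r : Fin n → ℕ} {t : Fin p → ℕ}
    {s' : ∀ k, Fin (s k) → ℕ}
    {e' : (Σ k, Fin (s k)) ≃ Fin n} {e : (Σ l, Fin (r l)) ≃ Fin m}
    {e₂ : ∀ k, (Σ j, Fin (s' k j)) ≃ Fin (t k)} {e₃ : (Σ k, Fin (t k)) ≃ Fin m'}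
    {A : M.Op p} {D : ∀ k, M.Op (s k)} {C : ∀ l, M.Op (r l)} {C' : ∀ k j, M.Op (s' k j)}
    (ρ : ∀ k j, Fin (r (e' ⟨k, j⟩)) ≃ Fin (s' k j)) {σ : Fin m ≃ Fin m'}
    (hC : ∀ k j, M.IsPerm (ρ k j) (C (e' ⟨k, j⟩)) (C' k j))
    (he : ∀ k j i, σ (e ⟨e' ⟨k, j⟩, i⟩) = e₃ ⟨k, e₂ k ⟨j, ρ k j i⟩⟩) :
    M.IsPerm σ (M.compE e (M.compE e' A D) C)
      (M.compE e₃ A (fun k => M.compE (e₂ k) (D k) (C' k))) := by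
  rw [compE_compE]
  refine compE (τ := Equiv.refl _)
    (fun k => (lex (fun j => r (e' ⟨k, j⟩)) rfl).symm.trans
      ((Equiv.sigmaCongrRight (ρ k)).trans (e₂ k))) (.refl A) (fun k => ?_) ?_
  · rw [← compE_lex]
    refine compE (τ := Equiv.refl _) (ρ k) (.refl _) (hC k) ?_
    intro j i
    simp only [Equiv.trans_apply, Equiv.symm_apply_apply]
    rfl
  · intro k j
    obtain ⟨⟨j, i⟩, rfl⟩ := (lex (fun j => r (e' ⟨k, j⟩)) rfl).surjective j
    have : nest e' e ⟨k, lex (fun j => r (e' ⟨k, j⟩)) rfl ⟨j, i⟩⟩ = e ⟨e' ⟨k, j⟩, i⟩ := by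
      simp only [nest, Equiv.trans_apply, Equiv.sigmaCongrRight_apply, Equiv.symm_apply_apply]
      rfl
    rw [this, he]
    simp only [Equiv.trans_apply, Equiv.symm_apply_apply]
    rfl

theorem one_compE_const {n m : ℕ} (e : (Σ _i : Fin 1, Fin n) ≃ Fin m) (A : M.Op n)
    {σ : Fin n ≃ Fin m} (hσ : ∀ j, σ j = e ⟨0, j⟩) :
    M.IsPerm σ A (M.compE e M.one (fun _ => A)) := by
  have h : M.IsPerm σ (M.compE (single n) M.one (fun _ => A)) (M.compE e M.one (fun _ => A)) := by
    refine compE (τ := Equiv.refl _) (fun _ => Equiv.refl _) (.refl _) (fun _ => .refl _) ?_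
    intro k j
    obtain rfl := Subsingleton.elim k 0
    exact hσ j
  rwa [M.one_compE] at h

theorem one_compE {m : ℕ} {r : Fin 1 → ℕ} (e : (Σ i, Fin (r i)) ≃ Fin m)
    (C : ∀ i, M.Op (r i)) {σ : Fin (r 0) ≃ Fin m} (hσ : ∀ j, σ j = e ⟨0, j⟩) :
    M.IsPerm σ (C 0) (M.compE e M.one C) := by
  obtain ⟨n, rfl⟩ : ∃ n, r = fun _ => n := ⟨r 0, funext fun i => by rw [Subsingleton.elim i 0]⟩
  obtain ⟨C, rfl⟩ : ∃ D, C = fun _ => D := ⟨C 0, funext fun i => by rw [Subsingleton.elim i 0]⟩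
  exact one_compE_const e C hσ

theorem compE_one {n m : ℕ} (e : (Σ _i : Fin n, Fin 1) ≃ Fin m) (A : M.Op n)
    {σ : Fin n ≃ Fin m} (hσ : ∀ j, σ j = e ⟨j, 0⟩) :
    M.IsPerm σ A (M.compE e A (fun _ => M.one)) := by
  have h : M.IsPerm σ (M.compE (Equiv.sigmaUnique (Fin n) fun _ => Fin 1) A (fun _ => M.one))
      (M.compE e A (fun _ => M.one)) := by
    refine compE (τ := Equiv.refl _) (fun _ => Equiv.refl _) (.refl _) (fun _ => .refl _) ?_
    intro k j
    obtain rfl := Subsingleton.elim j 0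
    exact hσ k
  rwa [M.compE_one] at h

end IsPerm

/-! ### Morphisms of operations as operations -/

variable (M) in
/-- A morphism of operations of arity `n`, with arbitrary source and target. -/
structure ArrOp (n : ℕ) : Type u where
  {src tgt : M.Op n}
  hom : src ⟶ tgt

theorem ArrOp.ext_heq {n : ℕ} {A B A' B' : M.Op n} {f : A ⟶ B} {f' : A' ⟶ B'} (hA : A = A')
    (hB : B = B') (h : HEq f f') : (⟨f⟩ : M.ArrOp n) = ⟨f'⟩ := by
  subst hA hB
  obtain rfl := eq_of_heq h
  rfl

instance (n : ℕ) : Category.{u} (M.ArrOp n) where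
  Hom _ _ := PUnit
  id _ := ⟨⟩
  comp _ _ := ⟨⟩

theorem ArrOp.functor_ext {n m : ℕ} {F G : M.ArrOp n ⥤ M.ArrOp m} (h : ∀ f, F.obj f = G.obj f) :
    F = G :=
  CategoryTheory.Functor.ext h fun _ _ _ => Subsingleton.elim (α := PUnit) _ _

variable (M) in
/-- The operad whose operations are the morphisms of operations of `M`. Its morphisms carry no
information: it serves to obtain equations between morphisms from equations between operations. -/
def arr : CatOperad.{u} where
  Op := M.ArrOp
  perm σ := { obj := fun f => ⟨(M.perm σ).map f.hom⟩, map := fun _ => ⟨⟩ }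
  perm_one n := ArrOp.functor_ext fun f => by rw [M.perm_one]; rfl
  perm_mul σ τ := ArrOp.functor_ext fun f => by rw [M.perm_mul]; rfl
  one := ⟨𝟙 M.one⟩
  comp r h f g := ⟨M.compMap r h f.hom (fun i => (g i).hom)⟩
  compMap _ _ _ _ _ _ _ _ := ⟨⟩
  compMap_id _ _ _ _ := rfl
  compMap_comp _ _ _ _ _ _ _ _ _ _ _ _ := rfl
  one_comp h f := ArrOp.ext_heq (M.one_comp h _) (M.one_comp h _) (M.one_compMap h f.hom)
  one_compMap _ _ _ _ := HEq.rfl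
  comp_one h f := ArrOp.ext_heq (M.comp_one h _) (M.comp_one h _) (M.compMap_one h f.hom)
  compMap_one _ _ _ _ := HEq.rfl
  assoc r h s t ht h' h'' α b c := ArrOp.ext_heq
    (M.assoc r h s t ht h' h'' _ (fun i => (b i).src) (fun i j => (c i j).src))
    (M.assoc r h s t ht h' h'' _ (fun i => (b i).tgt) (fun i j => (c i j).tgt))
    (M.assocMap r h s t ht h' h'' α.hom (fun i => (b i).hom) (fun i j => (c i j).hom))
  assocMap _ _ _ _ _ _ _ _ _ _ _ _ _ _ _ _ := HEq.rfl
  perm_comp r τ h h' α c := ArrOp.ext_heq (M.perm_comp r τ h h' _ (fun i => (c i).src))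
    (M.perm_comp r τ h h' _ (fun i => (c i).tgt))
    (M.perm_compMap r τ h h' α.hom (fun i => (c i).hom))
  perm_compMap _ _ _ _ _ _ _ _ _ _ := HEq.rfl
  comp_perm r ρ h α c := ArrOp.ext_heq (M.comp_perm r ρ h _ (fun i => (c i).src))
    (M.comp_perm r ρ h _ (fun i => (c i).tgt))
    (M.compMap_perm r ρ h α.hom (fun i => (c i).hom))
  compMap_perm _ _ _ _ _ _ _ _ _ := HEq.rfl

variable (M) in
/-- A morphism of operations, regarded as an operation of `M.arr`. -/
def toArr {n : ℕ} {A B : M.Op n} (f : A ⟶ B) : M.arr.Op n := (⟨f⟩ : M.ArrOp n)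

@[simp]
theorem toArr_comp_eqToHom {n : ℕ} {A B C : M.Op n} (f : A ⟶ B) (h : B = C) :
    M.toArr (f ≫ eqToHom h) = M.toArr f := by
  subst h; simp

@[simp]
theorem toArr_eqToHom_comp {n : ℕ} {A B C : M.Op n} (h : A = B) (f : B ⟶ C) :
    M.toArr (eqToHom h ≫ f) = M.toArr f := by
  subst h; simp

theorem toArr_eqToHom {n : ℕ} {A B : M.Op n} (h : A = B) :
    M.toArr (eqToHom h) = M.toArr (𝟙 A) := by
  subst h; rfl

/-- Morphisms of operations which are equal as operations of `M.arr` are heterogeneously equal. -/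
theorem heq_of_toArr {n : ℕ} {A B A' B' : M.Op n} {f : A ⟶ B} {f' : A' ⟶ B'}
    (h : M.toArr f = M.toArr f') : HEq f f' := by
  cases h; rfl

theorem toArr_congr_comp {n : ℕ} {A B C A' B' C' : M.Op n} {f : A ⟶ B} {g : B ⟶ C} {f' : A' ⟶ B'}
    {g' : B' ⟶ C'} (h : M.toArr f = M.toArr f') (h' : M.toArr g = M.toArr g') :
    M.toArr (f ≫ g) = M.toArr (f' ≫ g') := by
  cases h
  cases h'
  rfl

theorem compEMap_id {n m : ℕ} {r : Fin n → ℕ} (e : (Σ i, Fin (r i)) ≃ Fin m) (A : M.Op n)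
    (C : ∀ i, M.Op (r i)) : M.compEMap e (𝟙 A) (fun i => 𝟙 (C i)) = 𝟙 (M.compE e A C) := by
  rw [compEMap, M.compMap_id]; exact (M.perm _).map_id _

theorem compEMap_comp {n m : ℕ} {r : Fin n → ℕ} (e : (Σ i, Fin (r i)) ≃ Fin m)
    {A A' A'' : M.Op n} {C C' C'' : ∀ i, M.Op (r i)} (α : A ⟶ A') (α' : A' ⟶ A'')
    (c : ∀ i, C i ⟶ C' i) (c' : ∀ i, C' i ⟶ C'' i) :
    M.compEMap e (α ≫ α') (fun i => c i ≫ c' i) = M.compEMap e α c ≫ M.compEMap e α' c' := by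
  rw [compEMap, M.compMap_comp]; exact (M.perm _).map_comp _ _

theorem toArr_compEMap {n m : ℕ} {r : Fin n → ℕ} (e : (Σ i, Fin (r i)) ≃ Fin m)
    {A A' : M.Op n} {C C' : ∀ i, M.Op (r i)} (α : A ⟶ A') (c : ∀ i, C i ⟶ C' i) :
    M.toArr (M.compEMap e α c) = M.arr.compE e (M.toArr α) (fun i => M.toArr (c i)) := rfl

theorem toArr_compMap {n m : ℕ} {r : Fin n → ℕ} (h : ∑ i, r i = m)
    {A A' : M.Op n} {C C' : ∀ i, M.Op (r i)} (α : A ⟶ A') (c : ∀ i, C i ⟶ C' i) :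
    M.toArr (M.compMap r h α c) = M.arr.comp r h (M.toArr α) (fun i => M.toArr (c i)) := rfl

namespace IsPerm

theorem arr_src {n m : ℕ} {σ : Fin n ≃ Fin m} {A' B' : M.Op n} {A B : M.Op m} {f' : A' ⟶ B'}
    {f : A ⟶ B} (h : M.arr.IsPerm σ (M.toArr f') (M.toArr f)) : M.IsPerm σ A' A := by
  obtain rfl := eq_of_finEquiv σ
  exact of_eq (congrArg ArrOp.src h.eq)

theorem arr_tgt {n m : ℕ} {σ : Fin n ≃ Fin m} {A' B' : M.Op n} {A B : M.Op m} {f' : A' ⟶ B'}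
    {f : A ⟶ B} (h : M.arr.IsPerm σ (M.toArr f') (M.toArr f)) : M.IsPerm σ B' B := by
  obtain rfl := eq_of_finEquiv σ
  exact of_eq (congrArg ArrOp.tgt h.eq)

theorem arr_id {n m : ℕ} {σ : Fin n ≃ Fin m} {A' : M.Op n} {A : M.Op m} (h : M.IsPerm σ A' A) :
    M.arr.IsPerm σ (M.toArr (𝟙 A')) (M.toArr (𝟙 A)) := by
  cases h
  exact of_eq (congrArg (fun f => M.toArr f) ((M.perm _).map_id _).symm)

theorem arr_comp {n m : ℕ} {σ : Fin n ≃ Fin m} {A' B' C' : M.Op n} {A B C : M.Op m} {f' : A' ⟶ B'}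
    {f : A ⟶ B} {g' : B' ⟶ C'} {g : B ⟶ C} (h : M.arr.IsPerm σ (M.toArr f') (M.toArr f))
    (h' : M.arr.IsPerm σ (M.toArr g') (M.toArr g)) :
    M.arr.IsPerm σ (M.toArr (f' ≫ g')) (M.toArr (f ≫ g)) := by
  obtain rfl := eq_of_finEquiv σ
  refine of_eq ?_
  refine Eq.trans ?_ (congrArg (fun f => M.toArr f) ((M.perm σ).map_comp f g).symm)
  exact toArr_congr_comp h.eq h'.eq

theorem arr_map {n : ℕ} (σ : Equiv.Perm (Fin n)) {A B : M.Op n} (f : A ⟶ B) :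
    M.arr.IsPerm σ (M.toArr ((M.perm σ).map f)) (M.toArr f) := of_eq rfl

end IsPerm

end CatOperad

/-! ### Actions on algebras up to renaming -/

namespace Alg

variable {M : CatOperad.{u}} (S : Alg M)

/-- An operation with renamed inputs has the same value on correspondingly renamed arguments. -/
theorem act_isPerm {n m : ℕ} {σ : Fin n ≃ Fin m} {A' : M.Op n} {A : M.Op m}
    (h : M.IsPerm σ A' A) {x' : Fin n → S.carrier} {x : Fin m → S.carrier}
    (hx : ∀ i, x' i = x (σ i)) : S.act A' x' = S.act A x := by
  obtain rfl := funext hx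
  obtain ⟨σ, _⟩ := h
  rw [S.perm_act]
  simp

theorem actMap_isPerm {n m : ℕ} {σ : Fin n ≃ Fin m} {A' B' : M.Op n} {A B : M.Op m}
    {α' : A' ⟶ B'} {α : A ⟶ B} (h : M.arr.IsPerm σ (M.toArr α') (M.toArr α))
    {x' y' : Fin n → S.carrier} {x y : Fin m → S.carrier} {k' : ∀ i, x' i ⟶ y' i}
    {k : ∀ i, x i ⟶ y i} (hx : ∀ i, x' i = x (σ i)) (hy : ∀ i, y' i = y (σ i))
    (hk : ∀ i, HEq (k' i) (k (σ i))) : HEq (S.actMap α' k') (S.actMap α k) := by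
  obtain rfl := CatOperad.eq_of_finEquiv σ
  have h1 := h.arr_src.eq
  have h2 := h.arr_tgt.eq
  subst h1 h2
  obtain rfl := eq_of_heq (CatOperad.heq_of_toArr h.eq)
  obtain rfl := funext hx
  obtain rfl := funext hy
  obtain rfl : k' = fun i => k (σ i) := funext fun i => eq_of_heq (hk i)
  refine (S.perm_actMap σ α _).trans ?_
  refine S.actMap_heq rfl rfl ?_ ?_ HEq.rfl ?_
  · intro i; simp
  · intro i; simp
  · intro i
    have : ∀ j, j = i → HEq (k j) (k i) := by rintro _ rfl; rfl
    exact this _ (σ.apply_symm_apply i)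

theorem actMap_id_isPerm {n m : ℕ} {σ : Fin n ≃ Fin m} {A' : M.Op n} {A : M.Op m}
    (h : M.IsPerm σ A' A)
    {x' y' : Fin n → S.carrier} {x y : Fin m → S.carrier} {k' : ∀ i, x' i ⟶ y' i}
    {k : ∀ i, x i ⟶ y i} (hx : ∀ i, x' i = x (σ i)) (hy : ∀ i, y' i = y (σ i))
    (hk : ∀ i, HEq (k' i) (k (σ i))) : HEq (S.actMap (𝟙 A') k') (S.actMap (𝟙 A) k) :=
  S.actMap_isPerm h.arr_id hx hy hk

theorem act_compE {n m : ℕ} {r : Fin n → ℕ} (e : (Σ i, Fin (r i)) ≃ Fin m) (A : M.Op n)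
    (C : ∀ i, M.Op (r i)) (x : Fin m → S.carrier) :
    S.act (M.compE e A C) x = S.act A (fun i => S.act (C i) (fun j => x (e ⟨i, j⟩))) := by
  rw [CatOperad.compE, S.perm_act, S.comp_act]
  simp [CatOperad.shuffle]

theorem actMap_compEMap {n m : ℕ} {r : Fin n → ℕ} (e : (Σ i, Fin (r i)) ≃ Fin m) {A A' : M.Op n}
    {C C' : ∀ i, M.Op (r i)} (α : A ⟶ A') (c : ∀ i, C i ⟶ C' i) {x x' : Fin m → S.carrier}
    (k : ∀ i, x i ⟶ x' i) : HEq (S.actMap (M.compEMap e α c) k)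
      (S.actMap α (fun i => S.actMap (c i) (fun j => k (e ⟨i, j⟩)))) := by
  refine (S.perm_actMap _ _ _).trans ((S.comp_actMap _ _ _ _ _).trans ?_)
  have : ∀ i j, (CatOperad.shuffle e).symm (lex r (CatOperad.sum_eq_of_equiv e) ⟨i, j⟩) =
      e ⟨i, j⟩ := by
    intro i j; simp [CatOperad.shuffle]
  have h : ∀ i j l, l = e ⟨i, j⟩ → HEq (k l) (k (e ⟨i, j⟩)) := by rintro i j _ rfl; rfl
  refine S.actMap_heq rfl rfl (fun i => by simp only [this]) (fun i => by simp only [this])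
    HEq.rfl fun i => ?_
  exact S.actMap_heq rfl rfl (fun j => by simp only [this]) (fun j => by simp only [this])
    HEq.rfl fun j => h i j _ (this i j)

theorem actMap_id_comp {n : ℕ} (A : M.Op n) {x y z : Fin n → S.carrier} (k : ∀ i, x i ⟶ y i)
    (l : ∀ i, y i ⟶ z i) : S.actMap (𝟙 A) (fun i => k i ≫ l i) =
      S.actMap (𝟙 A) k ≫ S.actMap (𝟙 A) l := by
  rw [← S.actMap_comp, Category.comp_id]

theorem actMap_split {n : ℕ} {A A' : M.Op n} (α : A ⟶ A') {x y : Fin n → S.carrier}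
    (k : ∀ i, x i ⟶ y i) : S.actMap α k = S.actMap α (fun i => 𝟙 (x i)) ≫ S.actMap (𝟙 A') k := by
  rw [← S.actMap_comp, Category.comp_id]
  simp

theorem actMap_split' {n : ℕ} {A A' : M.Op n} (α : A ⟶ A') {x y : Fin n → S.carrier}
    (k : ∀ i, x i ⟶ y i) : S.actMap α k = S.actMap (𝟙 A) k ≫ S.actMap α (fun i => 𝟙 (y i)) := by
  rw [← S.actMap_comp, Category.id_comp]
  simp

end Alg

end CatOp

/-! ### Nodes up to renaming of inputs -/

namespace CatOp

variable {M : CatOperad.{u}} {L : Type u} [SmallCategory L]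

open Bicategory

theorem LaxHom.lax_heq {S T : Alg M} (f : LaxHom S T) {n : ℕ} (A : M.Op n)
    {x x' : Fin n → S.carrier} (h : ∀ i, x i = x' i) : HEq (f.lax A x) (f.lax A x') := by
  obtain rfl := funext h
  rfl

theorem LaxHom.lax_isPerm {S T : Alg M} (f : LaxHom S T) {n m : ℕ} {σ : Fin n ≃ Fin m}
    {A' : M.Op n} {A : M.Op m} (h : M.IsPerm σ A' A) {x' : Fin n → S.carrier}
    {x : Fin m → S.carrier} (hx : ∀ i, x' i = x (σ i)) : HEq (f.lax A' x') (f.lax A x) := by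
  obtain rfl := funext hx
  obtain ⟨σ, _⟩ := h
  exact (f.lax_perm _ _ _).trans (f.lax_heq _ fun i => by simp)

theorem lax_map_id (X : L ⥤ LaxAlg M) (l : L) {n : ℕ} (A : M.Op n)
    (x : Fin n → (X.obj l).alg.carrier) :
    HEq ((X.map (𝟙 l)).lax A x) (𝟙 ((X.obj l).alg.act A x)) := by
  rw [X.map_id]; rfl

theorem lax_map_comp (X : L ⥤ LaxAlg M) {l l' l'' : L} (a : l ⟶ l') (b : l' ⟶ l'') {n : ℕ}
    (A : M.Op n) (x : Fin n → (X.obj l).alg.carrier) :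
    HEq ((X.map (a ≫ b)).lax A x) ((X.map b).lax A (fun i => (X.map a).functor.obj (x i)) ≫
      (X.map b).functor.map ((X.map a).lax A x)) := by
  rw [X.map_comp]; rfl

variable {X : L ⥤ LaxAlg M}

namespace Node

theorem ext_heq {r : ℕ} {C : M.Op r} {src : Fin r → Lab X} {tgt : Lab X} {a b : Node X C src tgt}
    (h : ∀ j, a.lam j = b.lam j) (h' : HEq a.map b.map) : a = b := by
  obtain ⟨l, f⟩ := a
  obtain ⟨l', f'⟩ := b
  obtain rfl : l = l' := funext h
  obtain rfl := eq_of_heq h'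
  rfl

/-- The morphism `C (ρ (lam 1 K 1), …, ρ (lam r K r)) ⟶ ρ (C (lam 1 K 1, …, lam r K r)) ⟶ ρ K'`
obtained from a node by applying `X ρ`. -/
def push {r : ℕ} {C : M.Op r} {src : Fin r → Lab X} {tgt : Lab X} (a : Node X C src tgt) {l : L}
    (ρ : tgt.1 ⟶ l) :
    (X.obj l).alg.act C (fun j => (X.map ρ).functor.obj ((X.map (a.lam j)).functor.obj (src j).2)) ⟶
      (X.map ρ).functor.obj tgt.2 :=
  (X.map ρ).lax C _ ≫ (X.map ρ).functor.map a.map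

theorem comp_map_heq {s : ℕ} {r : Fin s → ℕ} {D : M.Op s} {C : ∀ j, M.Op (r j)}
    {src : ∀ j, Fin (r j) → Lab X} {mid : Fin s → Lab X} {tgt : Lab X}
    (b : ∀ j, Node X (C j) (src j) (mid j)) (a : Node X D mid tgt) :
    HEq (comp b a).map
      ((X.obj tgt.1).alg.actMap (𝟙 D) (fun j => (b j).push (a.lam j)) ≫ a.map) := by
  refine (eqToHom_comp_heq _ _).trans (heq_of_eq ?_)
  rw [← Category.assoc, ← Alg.actMap_id_comp]
  rfl

/-- `Node.Rel ρ a' a` says that the node `a'` is the node `a` with its inputs renamed along `ρ`. -/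
structure Rel {r r' : ℕ} {C' : M.Op r'} {C : M.Op r} {src' : Fin r' → Lab X} {src : Fin r → Lab X}
    {tgt' tgt : Lab X} (ρ : Fin r' ≃ Fin r) (a' : Node X C' src' tgt') (a : Node X C src tgt) :
    Prop where
  op : M.IsPerm ρ C' C
  src : ∀ j, src' j = src (ρ j)
  tgt : tgt' = tgt
  lam : ∀ j, HEq (a'.lam j) (a.lam (ρ j))
  map : HEq a'.map a.map

section

variable {r r' r'' : ℕ} {C'' : M.Op r''} {C' : M.Op r'} {C : M.Op r} {src'' : Fin r'' → Lab X}
  {src' : Fin r' → Lab X} {src : Fin r → Lab X} {tgt'' tgt' tgt : Lab X}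
  {a'' : Node X C'' src'' tgt''} {a' : Node X C' src' tgt'} {a : Node X C src tgt}

theorem Rel.refl (a : Node X C src tgt) : Rel (Equiv.refl _) a a :=
  ⟨.refl _, fun _ => rfl, rfl, fun _ => HEq.rfl, HEq.rfl⟩

theorem Rel.trans {ρ : Fin r'' ≃ Fin r'} {ρ' : Fin r' ≃ Fin r} (h : Rel ρ a'' a')
    (h' : Rel ρ' a' a) : Rel (ρ.trans ρ') a'' a :=
  ⟨h.op.trans h'.op, fun j => (h.src j).trans (h'.src _), h.tgt.trans h'.tgt,
    fun j => (h.lam j).trans (h'.lam _), h.map.trans h'.map⟩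

theorem Rel.symm {ρ : Fin r' ≃ Fin r} (h : Rel ρ a' a) : Rel ρ.symm a a' := by
  refine ⟨h.op.symm, fun j => ?_, h.tgt.symm, fun j => ?_, h.map.symm⟩
  · rw [h.src, ρ.apply_symm_apply]
  · have := h.lam (ρ.symm j)
    rw [ρ.apply_symm_apply] at this
    exact this.symm

theorem perm_rel (a : Node X C src tgt) (ρ : Equiv.Perm (Fin r)) : Rel ρ (a.perm ρ) a :=
  ⟨.mk _ _, fun _ => rfl, rfl, fun _ => HEq.rfl, eqToHom_comp_heq _ _⟩

theorem cast_rel {s : Fin r → Lab X} (a : Node X C src tgt) (h : src = s) :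
    Rel (Equiv.refl _) (a.cast h) a := by
  subst h
  exact .refl a

/-- A relation between nodes is an identity up to transport. -/
theorem Rel.elim {ρ : Fin r' ≃ Fin r} (h : Rel ρ a' a)
    {motive : ∀ {s : ℕ} {D : M.Op s} {src' : Fin s → Lab X} {tgt' : Lab X},
      (Fin s ≃ Fin r) → Node X D src' tgt' → Prop}
    (H : ∀ ρ : Equiv.Perm (Fin r), motive ρ (a.perm ρ)) : motive ρ a' := by
  obtain rfl := CatOperad.eq_of_finEquiv ρ
  obtain ⟨h1, h2, h3, h4, h5⟩ := h
  obtain rfl := h1.eq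
  obtain rfl := funext h2
  subst h3
  have : a' = a.perm ρ :=
    ext_heq (fun j => eq_of_heq (h4 j)) (h5.trans (eqToHom_comp_heq _ _).symm)
  rw [this]
  exact H ρ

theorem Rel.obj {ρ : Fin r' ≃ Fin r} (h : Rel ρ a' a) {l l' : L} {π' : tgt'.1 ⟶ l'} {π : tgt.1 ⟶ l}
    (hl : l' = l) (hπ : HEq π' π) :
    HEq ((X.map π').functor.obj tgt'.2) ((X.map π).functor.obj tgt.2) := by
  obtain rfl := h.tgt
  subst hl
  obtain rfl := eq_of_heq hπ
  rfl

theorem Rel.act {ρ : Fin r' ≃ Fin r} (h : Rel ρ a' a) {l l' : L} {π' : tgt'.1 ⟶ l'} {π : tgt.1 ⟶ l}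
    (hl : l' = l) (hπ : HEq π' π) :
    HEq ((X.obj l').alg.act C' (fun j =>
        (X.map π').functor.obj ((X.map (a'.lam j)).functor.obj (src' j).2)))
      ((X.obj l).alg.act C (fun j =>
        (X.map π).functor.obj ((X.map (a.lam j)).functor.obj (src j).2))) := by
  subst hl
  obtain rfl := h.tgt
  obtain rfl := eq_of_heq hπ
  have := h.src
  refine heq_of_eq ((X.obj l').alg.act_isPerm h.op fun j => congrArg _ ?_)
  have aux : ∀ (x y : Lab X) (f : x.1 ⟶ tgt'.1) (g : y.1 ⟶ tgt'.1), x = y → HEq f g →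
      (X.map f).functor.obj x.2 = (X.map g).functor.obj y.2 := by
    rintro x _ f g rfl hf
    obtain rfl := eq_of_heq hf
    rfl
  exact aux _ _ _ _ (h.src j) (h.lam j)

theorem Rel.push {ρ : Fin r' ≃ Fin r} (h : Rel ρ a' a) {l l' : L} {π' : tgt'.1 ⟶ l'} {π : tgt.1 ⟶ l}
    (hl : l' = l) (hπ : HEq π' π) : HEq (a'.push π') (a.push π) := by
  obtain rfl := CatOperad.eq_of_finEquiv ρ
  obtain ⟨h1, h2, h3, h4, h5⟩ := h
  obtain rfl := h1.eq
  obtain rfl := funext h2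
  subst h3 hl
  obtain rfl := eq_of_heq hπ
  have : a' = a.perm ρ :=
    ext_heq (fun j => eq_of_heq (h4 j)) (h5.trans (eqToHom_comp_heq _ _).symm)
  subst this
  have e := perm_aux C src tgt' a.lam ρ
  have e1 := (X.map π').lax_isPerm h1
      (x' := fun j => (X.map (a.lam (ρ j))).functor.obj (src (ρ j)).2)
    (x := fun j => (X.map (a.lam j)).functor.obj (src j).2) fun _ => rfl
  have e2 := map_heq (X.map π').functor e rfl (eqToHom_comp_heq a.map e)
  exact heq_comp ((X.obj l').alg.act_isPerm h1 fun _ => rfl)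
    (congrArg (X.map π').functor.obj e) rfl e1 e2

end

theorem push_id {r : ℕ} {C : M.Op r} {src : Fin r → Lab X} {tgt : Lab X} (a : Node X C src tgt) :
    HEq (a.push (𝟙 tgt.1)) a.map := by
  have e1 := lax_map_id X tgt.1 C (fun j => (X.map (a.lam j)).functor.obj (src j).2)
  have e2 := HMor.map_id_map X tgt.1 a.map
  refine (heq_comp ?_ ?_ ?_ e1 e2).trans (heq_of_eq (Category.id_comp _))
  · congr 1; funext j; exact HMor.map_id_obj X _ _
  · exact HMor.map_id_obj X _ _
  · exact HMor.map_id_obj X _ _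

theorem push_push {r : ℕ} {C : M.Op r} {src : Fin r → Lab X} {tgt : Lab X} (a : Node X C src tgt)
    {l l' : L} (ρ : tgt.1 ⟶ l) (π : l ⟶ l') :
    HEq (a.push (ρ ≫ π)) ((X.map π).lax C _ ≫ (X.map π).functor.map (a.push ρ)) := by
  have e1 := lax_map_comp X ρ π C (fun j => (X.map (a.lam j)).functor.obj (src j).2)
  have e2 := HMor.map_comp_map X ρ π a.map
  refine (heq_comp ?_ ?_ ?_ e1 e2).trans (heq_of_eq ?_)
  · congr 1; funext j; exact HMor.map_comp_obj X _ _ _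
  · exact HMor.map_comp_obj X _ _ _
  · exact HMor.map_comp_obj X _ _ _
  · rw [push, Functor.map_comp, Category.assoc]

theorem push_precomp {r : ℕ} {D C : M.Op r} {src : Fin r → Lab X} {tgt : Lab X} (α : D ⟶ C)
    (a : Node X C src tgt) {l : L} (ρ : tgt.1 ⟶ l) :
    (a.precomp α).push ρ = (X.obj l).alg.actMap α (fun j =>
      𝟙 ((X.map ρ).functor.obj ((X.map (a.lam j)).functor.obj (src j).2))) ≫ a.push ρ := by
  have := (X.map ρ).lax_natural α
    (fun j => 𝟙 ((X.map (a.lam j)).functor.obj (src j).2))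
  simp only [CategoryTheory.Functor.map_id] at this
  have h := (X.map ρ).functor.map_comp ((X.obj tgt.1).alg.actMap α
    (fun j => 𝟙 ((X.map (a.lam j)).functor.obj (src j).2))) a.map
  refine (congrArg (fun z => (X.map ρ).lax D _ ≫ z) h).trans ?_
  rw [← Category.assoc, this, Category.assoc]
  rfl

theorem push_id_node (x : Lab X) {l : L} (ρ : x.1 ⟶ l) :
    HEq ((Node.id x).push ρ) (𝟙 ((X.map ρ).functor.obj x.2)) := by
  have h := ((X.obj x.1).alg.one_act (fun _ => (X.map (𝟙 x.1)).functor.obj x.2)).trans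
    (HMor.map_id_obj X x.1 x.2)
  have e1 := (X.map ρ).lax_one (fun _ => (X.map (𝟙 x.1)).functor.obj x.2)
  have e2 : HEq ((X.map ρ).functor.map (Node.id x).map) (𝟙 ((X.map ρ).functor.obj x.2)) := by
    rw [← CategoryTheory.Functor.map_id]
    exact map_heq (X.map ρ).functor h rfl (eqToHom_heq_id h)
  have h1 := HMor.map_id_obj X x.1 x.2
  refine (heq_comp ?_ ?_ rfl (e1.trans (id_heq (congrArg _ h1))) e2).trans
    (heq_of_eq (Category.id_comp _))
  · exact ((X.obj l).alg.one_act _).trans (congrArg _ h1)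
  · exact congrArg _ h

/-- Applying `X ρ` to a composite of nodes. -/
theorem push_comp {s : ℕ} {r : Fin s → ℕ} {D : M.Op s} {C : ∀ j, M.Op (r j)}
    {src : ∀ j, Fin (r j) → Lab X} {mid : Fin s → Lab X} {tgt : Lab X}
    (b : ∀ j, Node X (C j) (src j) (mid j)) (a : Node X D mid tgt) {l : L} (ρ : tgt.1 ⟶ l) :
    HEq ((comp b a).push ρ)
      ((X.obj l).alg.actMap (𝟙 D) (fun j => (X.map ρ).lax (C j) _ ≫
        (X.map ρ).functor.map ((b j).push (a.lam j))) ≫ a.push ρ) := by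
  set T := (X.obj l).alg
  set F := X.map ρ
  have hx : ∀ j i, (X.map ((comp b a).lam (lex r rfl ⟨j, i⟩))).functor.obj
      (src ((lex r rfl).symm (lex r rfl ⟨j, i⟩)).1 ((lex r rfl).symm (lex r rfl ⟨j, i⟩)).2).2 =
      (X.map (a.lam j)).functor.obj ((X.map ((b j).lam i)).functor.obj (src j i).2) := by
    intro j i
    have : ∀ p : (Σ j, Fin (r j)), p = ⟨j, i⟩ →
        (X.map ((b p.1).lam p.2 ≫ a.lam p.1)).functor.obj (src p.1 p.2).2 =
        (X.map (a.lam j)).functor.obj ((X.map ((b j).lam i)).functor.obj (src j i).2) := by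
      rintro _ rfl
      exact HMor.map_comp_obj X _ _ _
    exact this _ (Equiv.symm_apply_apply _ _)
  have e1 : HEq (F.lax (M.comp r rfl D C) (fun p => (X.map ((comp b a).lam p)).functor.obj
      (src ((lex r rfl).symm p).1 ((lex r rfl).symm p).2).2))
      (T.actMap (𝟙 D) (fun j => F.lax (C j) (fun i =>
          (X.map (a.lam j)).functor.obj ((X.map ((b j).lam i)).functor.obj (src j i).2))) ≫
        F.lax D (fun j => (X.obj tgt.1).alg.act (C j) (fun i =>
          (X.map (a.lam j)).functor.obj ((X.map ((b j).lam i)).functor.obj (src j i).2)))) := by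
    refine (F.lax_comp r rfl D C _).trans (heq_comp ?_ ?_ ?_ ?_ ?_)
    · congr 1; funext j; congr 1; funext i; exact congrArg _ (hx j i)
    · congr 1; funext j; exact congrArg _ (congrArg _ (funext (hx j)))
    · refine congrArg _ (congrArg _ ?_); funext j; exact congrArg _ (funext (hx j))
    · exact T.actMap_heq rfl rfl (fun j => congrArg _ (funext fun i => congrArg _ (hx j i)))
        (fun j => congrArg _ (congrArg _ (funext (hx j)))) HEq.rfl fun j => F.lax_heq _ (hx j)
    · exact F.lax_heq _ fun j => congrArg _ (funext (hx j))
  have e2 := map_heq F.functor (comp_aux (fun j => (b j).lam) a.lam) rfl (comp_map_heq b a)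
  refine (heq_comp ?_ ?_ rfl e1 e2).trans ?_
  · rw [T.comp_act]
    congr 1; funext j; congr 1; funext i; exact congrArg _ (hx j i)
  · exact congrArg F.functor.obj (comp_aux (fun j => (b j).lam) a.lam)
  · rw [Functor.map_comp, ← Category.assoc, Category.assoc (T.actMap _ _),
      F.lax_natural (𝟙 D) (fun j => (b j).push (a.lam j)), ← Category.assoc, Category.assoc,
      ← Alg.actMap_id_comp]
    rfl

end Node

end CatOp

/-! ### Composition of nodes -/

namespace CatOp

variable {M : CatOperad.{u}} {L : Type u} [SmallCategory L]

open Bicategory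

/-- The bijection of lexicographically ordered sums induced by a bijection `π` of the index sets and
bijections `ρ j` of the summands. -/
def lexCongr {s s' : ℕ} {r : Fin s → ℕ} {r' : Fin s' → ℕ} (π : Fin s' ≃ Fin s)
    (ρ : ∀ j, Fin (r' j) ≃ Fin (r (π j))) : Fin (∑ j, r' j) ≃ Fin (∑ j, r j) :=
  (lex r' rfl).symm.trans ((Equiv.sigmaCongrRight ρ).trans
    ((Equiv.sigmaCongrLeft (β := fun j => Fin (r j)) π).trans (lex r rfl)))

theorem lexCongr_lex {s s' : ℕ} {r : Fin s → ℕ} {r' : Fin s' → ℕ} (π : Fin s' ≃ Fin s)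
    (ρ : ∀ j, Fin (r' j) ≃ Fin (r (π j))) (j : Fin s') (i : Fin (r' j)) :
    lexCongr π ρ (lex r' rfl ⟨j, i⟩) = lex r rfl ⟨π j, ρ j i⟩ := by
  simp only [lexCongr, Equiv.trans_apply, Equiv.symm_apply_apply]
  rfl

/-- To prove a statement about `(lex r h).symm (lex r h x)`, it suffices to prove it for `x`. -/
theorem lex_symm_lex {n m : ℕ} (r : Fin n → ℕ) (h : ∑ i, r i = m)
    {motive : (Σ i, Fin (r i)) → Prop} {x : Σ i, Fin (r i)} (H : motive x) :
    motive ((lex r h).symm (lex r h x)) := by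
  rw [Equiv.symm_apply_apply]; exact H

/-- A property of the elements of a lexicographically ordered sum may be checked on each summand. -/
theorem lex_ind {n m : ℕ} (r : Fin n → ℕ) (h : ∑ i, r i = m) {motive : Fin m → Prop}
    (H : ∀ i j, motive (lex r h ⟨i, j⟩)) (l : Fin m) : motive l := by
  obtain ⟨⟨i, j⟩, rfl⟩ := (lex r h).surjective l
  exact H i j

theorem lex_lex {n m q : ℕ} (r : Fin n → ℕ) (h : ∑ i, r i = m) (s : ∀ i, Fin (r i) → ℕ)
    (t : Fin n → ℕ) (ht : ∀ i, ∑ j, s i j = t i) (h' : ∑ i, t i = q)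
    (h'' : ∑ l : Fin m, s ((lex r h).symm l).1 ((lex r h).symm l).2 = q) (l : Fin m)
    (x : Fin (s ((lex r h).symm l).1 ((lex r h).symm l).2)) :
    lex (fun l : Fin m => s ((lex r h).symm l).1 ((lex r h).symm l).2) h'' ⟨l, x⟩ =
      lex t h' ⟨((lex r h).symm l).1, lex (s _) (ht _) ⟨((lex r h).symm l).2, x⟩⟩ :=
  (Equiv.congr_fun (graft_lex r h s t ht h' h'') ⟨l, x⟩).symm

variable {X : L ⥤ LaxAlg M}

namespace Node

theorem comp_src {s : ℕ} {r : Fin s → ℕ} (src : ∀ j, Fin (r j) → Lab X) (j : Fin s)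
    (i : Fin (r j)) : src ((lex r rfl).symm (lex r rfl ⟨j, i⟩)).1
      ((lex r rfl).symm (lex r rfl ⟨j, i⟩)).2 = src j i :=
  lex_symm_lex r rfl (motive := fun p => src p.1 p.2 = src j i) rfl

theorem comp_lam {s : ℕ} {r : Fin s → ℕ} {D : M.Op s} {C : ∀ j, M.Op (r j)}
    {src : ∀ j, Fin (r j) → Lab X} {mid : Fin s → Lab X} {tgt : Lab X}
    (b : ∀ j, Node X (C j) (src j) (mid j)) (a : Node X D mid tgt) (j : Fin s) (i : Fin (r j)) :
    HEq ((comp b a).lam (lex r rfl ⟨j, i⟩)) ((b j).lam i ≫ a.lam j) :=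
  lex_symm_lex r rfl
    (motive := fun p => HEq ((b p.1).lam p.2 ≫ a.lam p.1) ((b j).lam i ≫ a.lam j)) HEq.rfl

/-- The composition of nodes is compatible with the renaming of inputs. -/
theorem comp_rel {s s' : ℕ} {r : Fin s → ℕ} {r' : Fin s' → ℕ} {D : M.Op s} {D' : M.Op s'}
    {C : ∀ j, M.Op (r j)} {C' : ∀ j, M.Op (r' j)} {src : ∀ j, Fin (r j) → Lab X}
    {src' : ∀ j, Fin (r' j) → Lab X} {mid : Fin s → Lab X} {mid' : Fin s' → Lab X}
    {tgt tgt' : Lab X} {b : ∀ j, Node X (C j) (src j) (mid j)} {a : Node X D mid tgt}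
    {b' : ∀ j, Node X (C' j) (src' j) (mid' j)} {a' : Node X D' mid' tgt'} {π : Fin s' ≃ Fin s}
    (ρ : ∀ j, Fin (r' j) ≃ Fin (r (π j))) (ha : Rel π a' a)
    (hb : ∀ j, Rel (ρ j) (b' j) (b (π j))) : Rel (lexCongr π ρ) (comp b' a') (comp b a) := by
  refine ⟨.comp ρ ha.op (fun j => (hb j).op) (lexCongr_lex π ρ), ?_, ha.tgt, ?_, ?_⟩
  · refine lex_ind r' rfl fun j i => ?_
    rw [lexCongr_lex]
    exact (comp_src src' j i).trans (((hb j).src i).trans (comp_src src _ _).symm)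
  · refine lex_ind r' rfl fun j i => ?_
    rw [lexCongr_lex]
    refine (comp_lam _ _ _ _).trans (HEq.trans ?_ (comp_lam _ _ _ _).symm)
    exact heq_comp (congrArg Sigma.fst ((hb j).src i)) (congrArg Sigma.fst (hb j).tgt)
      (congrArg Sigma.fst ha.tgt) ((hb j).lam i) (ha.lam j)
  · obtain rfl := ha.tgt
    refine (comp_map_heq b' a').trans (HEq.trans ?_ (comp_map_heq b a).symm)
    have hx := fun j => eq_of_heq ((hb j).act rfl (ha.lam j))
    have hy := fun j => eq_of_heq ((hb j).obj rfl (ha.lam j))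
    exact heq_comp ((X.obj tgt'.1).alg.act_isPerm ha.op hx)
      ((X.obj tgt'.1).alg.act_isPerm ha.op hy) rfl
      ((X.obj tgt'.1).alg.actMap_id_isPerm ha.op hx hy fun j => (hb j).push rfl (ha.lam j)) ha.map

/-- The right unit law for nodes, up to a renaming of the inputs. -/
theorem comp_id_rel {r : ℕ} {C : M.Op r} {src : Fin r → Lab X} {tgt : Lab X}
    (a : Node X C src tgt) {θ : Fin r ≃ Fin (∑ _i : Fin 1, r)} (hθ : ∀ j, θ j = lex _ rfl ⟨0, j⟩) :
    Rel θ a (comp (fun _ : Fin 1 => a) (Node.id tgt)) := by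
  refine ⟨?_, fun j => ?_, rfl, fun j => ?_, ?_⟩
  · rw [← CatOperad.compE_lex]
    exact CatOperad.IsPerm.one_compE (lex _ rfl) (fun _ => C) hθ
  · rw [hθ]
    exact (comp_src (fun _ : Fin 1 => src) 0 j).symm
  · rw [hθ]
    refine HEq.trans ?_ (comp_lam _ _ _ _).symm
    exact heq_of_eq (Category.comp_id _).symm
  · refine HEq.trans ?_ (comp_map_heq _ _).symm
    have h := fun j => (HMor.map_id_obj X tgt.1 ((X.map (a.lam j)).functor.obj (src j).2))
    have e := (X.obj tgt.1).alg.one_actMap (fun _ => a.push (𝟙 tgt.1))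
    have e1 : HEq (Node.id tgt).map (𝟙 tgt.2) :=
      eqToHom_heq_id (((X.obj tgt.1).alg.one_act _).trans (HMor.map_id_obj X tgt.1 tgt.2))
    refine HEq.trans (heq_of_eq (Category.comp_id _).symm) ?_
    refine heq_comp ?_ ?_ rfl (push_id a |>.symm.trans e.symm) e1.symm
    · rw [(X.obj tgt.1).alg.one_act]
      exact congrArg _ (funext fun j => (h j).symm)
    · rw [(X.obj tgt.1).alg.one_act]
      exact (HMor.map_id_obj X tgt.1 tgt.2).symm

/-- The left unit law for nodes, up to a renaming of the inputs. -/
theorem id_comp_rel {s : ℕ} {D : M.Op s} {mid : Fin s → Lab X} {tgt : Lab X}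
    (a : Node X D mid tgt) {θ : Fin s ≃ Fin (∑ _i : Fin s, 1)} (hθ : ∀ j, θ j = lex _ rfl ⟨j, 0⟩) :
    Rel θ a (comp (fun j => Node.id (mid j)) a) := by
  refine ⟨?_, fun j => ?_, rfl, fun j => ?_, ?_⟩
  · rw [← CatOperad.compE_lex]
    exact CatOperad.IsPerm.compE_one (lex _ rfl) D hθ
  · rw [hθ]
    exact (comp_src (fun (j : Fin s) (_ : Fin 1) => mid j) j 0).symm
  · rw [hθ]
    refine HEq.trans ?_ (comp_lam _ _ _ _).symm
    exact heq_of_eq (Category.id_comp _).symm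
  · refine HEq.trans ?_ (comp_map_heq _ _).symm
    have e : HEq ((X.obj tgt.1).alg.actMap (𝟙 D) (fun j => (Node.id (mid j)).push (a.lam j)))
        (𝟙 ((X.obj tgt.1).alg.act D (fun j => (X.map (a.lam j)).functor.obj (mid j).2))) := by
      rw [← Alg.actMap_id]
      refine (X.obj tgt.1).alg.actMap_heq rfl rfl (fun j => ?_) (fun _ => rfl) HEq.rfl
        fun j => push_id_node _ _
      exact ((X.obj tgt.1).alg.one_act _).trans (congrArg (X.map (a.lam j)).functor.obj
        (HMor.map_id_obj X (mid j).1 (mid j).2))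
    refine HEq.trans (heq_of_eq (Category.id_comp _).symm) (heq_comp ?_ rfl rfl e.symm HEq.rfl)
    refine congrArg _ (funext fun j => ?_)
    exact (((X.obj tgt.1).alg.one_act _).trans (congrArg (X.map (a.lam j)).functor.obj
      (HMor.map_id_obj X (mid j).1 (mid j).2))).symm

/-- The composition of nodes is associative, up to the identification of the two iterated sums of
arities. -/
theorem comp_assoc_rel {s : ℕ} {r : Fin s → ℕ} {q : ∀ j, Fin (r j) → ℕ} {D : M.Op s}
    {C : ∀ j, M.Op (r j)} {E : ∀ j i, M.Op (q j i)} {low : ∀ j i, Fin (q j i) → Lab X}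
    {src : ∀ j, Fin (r j) → Lab X} {mid : Fin s → Lab X} {tgt : Lab X}
    (c : ∀ j i, Node X (E j i) (low j i) (src j i)) (b : ∀ j, Node X (C j) (src j) (mid j))
    (a : Node X D mid tgt)
    (h : ∑ l, q ((lex r rfl).symm l).1 ((lex r rfl).symm l).2 = ∑ j, ∑ i, q j i) :
    Rel (finCongr h) (comp (fun l => c ((lex r rfl).symm l).1 ((lex r rfl).symm l).2) (comp b a))
      (comp (fun j => comp (c j) (b j)) a) := by
  have hl : ∀ l x, finCongr h (lex (fun l => q ((lex r rfl).symm l).1 ((lex r rfl).symm l).2) rfl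
      ⟨l, x⟩) = lex (fun j => ∑ i, q j i) rfl ⟨((lex r rfl).symm l).1, lex (q _) rfl
        ⟨((lex r rfl).symm l).2, x⟩⟩ := fun l x =>
    lex_lex r rfl q (fun j => ∑ i, q j i) (fun _ => rfl) rfl h l x
  refine ⟨?_, ?_, rfl, ?_, ?_⟩
  · refine .of_heq h ?_
    have h1 := M.assoc r rfl q (fun j => ∑ i, q j i) (fun _ => rfl) rfl h D C E
    refine HEq.trans ?_ (heq_of_eq h1)
    have : ∀ (N : ℕ) (h' : ∑ l, q ((lex r rfl).symm l).1 ((lex r rfl).symm l).2 = N),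
      HEq (M.comp _ rfl (M.comp r rfl D C)
        (fun l => E ((lex r rfl).symm l).1 ((lex r rfl).symm l).2))
        (M.comp _ h' (M.comp r rfl D C)
        (fun l => E ((lex r rfl).symm l).1 ((lex r rfl).symm l).2)) := by
      rintro _ rfl; rfl
    exact this _ h
  · refine lex_ind (fun l => q ((lex r rfl).symm l).1 ((lex r rfl).symm l).2) rfl fun l x => ?_
    rw [hl]
    refine (comp_src (fun l => low ((lex r rfl).symm l).1 ((lex r rfl).symm l).2) l x).trans ?_
    refine Eq.trans ?_ (comp_src (fun j l => low j ((lex (q j) rfl).symm l).1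
      ((lex (q j) rfl).symm l).2) _ _).symm
    exact (comp_src (low _) _ _).symm
  · refine lex_ind (fun l => q ((lex r rfl).symm l).1 ((lex r rfl).symm l).2) rfl fun l x => ?_
    rw [hl]
    refine (comp_lam _ _ _ _).trans (HEq.trans ?_ (comp_lam _ _ _ _).symm)
    refine HEq.trans (heq_of_eq (Category.assoc _ _ _).symm) ?_
    exact heq_comp (congrArg Sigma.fst (comp_src (low _) _ _).symm) rfl rfl
      (comp_lam _ _ _ _).symm HEq.rfl
  · refine (comp_map_heq _ _).trans (HEq.trans ?_ (comp_map_heq _ _).symm)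
    set T := (X.obj tgt.1).alg
    have hact : ∀ j i, T.act (E j i) (fun x => (X.map ((b j).lam i ≫ a.lam j)).functor.obj
          ((X.map ((c j i).lam x)).functor.obj (low j i x).2)) =
        T.act (E j i) (fun x => (X.map (a.lam j)).functor.obj ((X.map ((b j).lam i)).functor.obj
          ((X.map ((c j i).lam x)).functor.obj (low j i x).2))) := fun j i =>
      congrArg _ (funext fun x => HMor.map_comp_obj X _ _ _)
    have hobj : ∀ j i, (X.map ((b j).lam i ≫ a.lam j)).functor.obj (src j i).2 =
        (X.map (a.lam j)).functor.obj ((X.map ((b j).lam i)).functor.obj (src j i).2) := fun j i =>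
      HMor.map_comp_obj X _ _ _
    -- Pushing along `X (b.lam ≫ a.lam)` is pushing along `X b.lam`, then along `X a.lam`.
    have e1 : HEq (T.actMap (𝟙 (M.comp r rfl D C)) (fun l =>
          (c ((lex r rfl).symm l).1 ((lex r rfl).symm l).2).push ((comp b a).lam l)))
        (T.actMap (𝟙 D) (fun j => T.actMap (𝟙 (C j)) (fun i => (X.map (a.lam j)).lax (E j i) _ ≫
          (X.map (a.lam j)).functor.map ((c j i).push ((b j).lam i))))) := by
      have h1 := T.comp_actMap r rfl (𝟙 D) (fun j => 𝟙 (C j)) (fun l =>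
          (c ((lex r rfl).symm l).1 ((lex r rfl).symm l).2).push ((comp b a).lam l))
      rw [M.compMap_id] at h1
      have haux : ∀ j i (p : Σ j, Fin (r j)), p = ⟨j, i⟩ →
          T.act (E p.1 p.2) (fun x => (X.map ((b p.1).lam p.2 ≫ a.lam p.1)).functor.obj
            ((X.map ((c p.1 p.2).lam x)).functor.obj (low p.1 p.2 x).2)) =
          T.act (E j i) (fun x => (X.map (a.lam j)).functor.obj ((X.map ((b j).lam i)).functor.obj
            ((X.map ((c j i).lam x)).functor.obj (low j i x).2))) := by
        rintro j i _ rfl; exact hact j i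
      have hauy : ∀ j i (p : Σ j, Fin (r j)), p = ⟨j, i⟩ →
          (X.map ((b p.1).lam p.2 ≫ a.lam p.1)).functor.obj (src p.1 p.2).2 =
          (X.map (a.lam j)).functor.obj ((X.map ((b j).lam i)).functor.obj (src j i).2) := by
        rintro j i _ rfl; exact hobj j i
      have hauz : ∀ j i (p : Σ j, Fin (r j)), p = ⟨j, i⟩ →
          HEq ((c p.1 p.2).push ((b p.1).lam p.2 ≫ a.lam p.1)) ((X.map (a.lam j)).lax (E j i) _ ≫
          (X.map (a.lam j)).functor.map ((c j i).push ((b j).lam i))) := by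
        rintro j i _ rfl; exact push_push _ _ _
      have hs := fun j i => Equiv.symm_apply_apply (lex r rfl) (⟨j, i⟩ : Σ j, Fin (r j))
      refine h1.trans (T.actMap_heq rfl rfl
        (fun j => congrArg _ (funext fun i => haux j i _ (hs j i)))
        (fun j => congrArg _ (funext fun i => hauy j i _ (hs j i))) HEq.rfl fun j =>
          T.actMap_heq rfl rfl (fun i => haux j i _ (hs j i))
            (fun i => hauy j i _ (hs j i)) HEq.rfl fun i => hauz j i _ (hs j i))
    have e2 := comp_map_heq b a
    -- The structure morphism of `X a.lam` moves the inner composite through `X a.lam`.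
    have e3 : ∀ j, HEq ((comp (c j) (b j)).push (a.lam j)) _ := fun j =>
      push_comp (c j) (b j) (a.lam j)
    have hdom : T.act (M.comp r rfl D C) (fun l => T.act (E ((lex r rfl).symm l).1
        ((lex r rfl).symm l).2) (fun x => (X.map ((comp b a).lam l)).functor.obj
          ((X.map ((c ((lex r rfl).symm l).1 ((lex r rfl).symm l).2).lam x)).functor.obj
            (low ((lex r rfl).symm l).1 ((lex r rfl).symm l).2 x).2))) =
        T.act D (fun j => T.act (C j) fun i => T.act (E j i) (fun x =>
          (X.map (a.lam j)).functor.obj ((X.map ((b j).lam i)).functor.obj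
          ((X.map ((c j i).lam x)).functor.obj (low j i x).2)))) := by
      rw [T.comp_act]
      congr 1; funext j; congr 1; funext i
      exact lex_symm_lex r rfl (motive := fun p => T.act (E p.1 p.2) (fun x =>
        (X.map ((b p.1).lam p.2 ≫ a.lam p.1)).functor.obj
          ((X.map ((c p.1 p.2).lam x)).functor.obj (low p.1 p.2 x).2)) = _) (hact j i)
    have hpush : ∀ j, T.act (M.comp (q j) rfl (C j) (E j)) (fun l =>
        (X.map (a.lam j)).functor.obj ((X.map ((comp (c j) (b j)).lam l)).functor.obj
          (low j ((lex (q j) rfl).symm l).1 ((lex (q j) rfl).symm l).2).2)) =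
        T.act (C j) fun i => T.act (E j i) (fun x =>
          (X.map (a.lam j)).functor.obj ((X.map ((b j).lam i)).functor.obj
          ((X.map ((c j i).lam x)).functor.obj (low j i x).2))) := fun j => by
      rw [T.comp_act]
      congr 1; funext i; congr 1; funext x
      refine congrArg _ ?_
      exact lex_symm_lex (q j) rfl (motive := fun p =>
        (X.map ((c j p.1).lam p.2 ≫ (b j).lam p.1)).functor.obj (low j p.1 p.2).2 = _)
        (HMor.map_comp_obj X _ _ _)
    have e4 : HEq (T.actMap (𝟙 D) fun j => (comp (c j) (b j)).push (a.lam j)) _ :=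
      T.actMap_heq rfl rfl hpush (fun _ => rfl) HEq.rfl e3
    have hmid : T.act (M.comp r rfl D C) (fun l => (X.map ((comp b a).lam l)).functor.obj
        (src ((lex r rfl).symm l).1 ((lex r rfl).symm l).2).2) = _ :=
      comp_aux (fun j => (b j).lam) a.lam
    refine (heq_comp hdom hmid rfl e1 e2).trans ?_
    refine HEq.trans (heq_of_eq ?_) (heq_comp (congrArg _ (funext hpush)) rfl rfl e4 HEq.rfl).symm
    rw [← Category.assoc, ← T.actMap_id_comp]

/-- The composition of nodes is natural in the operations. -/
theorem precomp_comp {s : ℕ} {r : Fin s → ℕ} {D' D : M.Op s} {C' C : ∀ j, M.Op (r j)}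
    {src : ∀ j, Fin (r j) → Lab X} {mid : Fin s → Lab X} {tgt : Lab X}
    (β : ∀ j, C' j ⟶ C j) (α : D' ⟶ D)
    (b : ∀ j, Node X (C j) (src j) (mid j)) (a : Node X D mid tgt) :
    comp (fun j => (b j).precomp (β j)) (a.precomp α) =
      (comp b a).precomp (M.compMap r rfl α β) := by
  refine ext_heq (fun _ => rfl) ?_
  set T := (X.obj tgt.1).alg
  refine (comp_map_heq _ _).trans ?_
  have e1 := T.comp_actMap r rfl α β (fun l =>
    𝟙 ((X.map ((comp b a).lam l)).functor.obj
      (src ((lex r rfl).symm l).1 ((lex r rfl).symm l).2).2))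
  have haux : ∀ j i (p : Σ j, Fin (r j)), p = ⟨j, i⟩ →
      (X.map ((b p.1).lam p.2 ≫ a.lam p.1)).functor.obj (src p.1 p.2).2 =
      (X.map (a.lam j)).functor.obj ((X.map ((b j).lam i)).functor.obj (src j i).2) := by
    rintro j i _ rfl; exact HMor.map_comp_obj X _ _ _
  have hs := fun j i => Equiv.symm_apply_apply (lex r rfl) (⟨j, i⟩ : Σ j, Fin (r j))
  have h1 : ∀ E : ∀ j, M.Op (r j), ∀ j, _ = T.act (E j) (fun i => (X.map (a.lam j)).functor.obj
      ((X.map ((b j).lam i)).functor.obj (src j i).2)) := fun E j =>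
    congrArg (T.act (E j)) (funext fun i => haux j i _ (hs j i))
  have e2 := e1.trans (T.actMap_heq (β := α)
      (l := fun j => T.actMap (β j) fun i => 𝟙 ((X.map (a.lam j)).functor.obj
        ((X.map ((b j).lam i)).functor.obj (src j i).2))) rfl rfl (h1 C') (h1 C) HEq.rfl fun j =>
    T.actMap_heq rfl rfl (fun i => haux j i _ (hs j i)) (fun i => haux j i _ (hs j i)) HEq.rfl
      fun i => id_heq (haux j i _ (hs j i)))
  refine HEq.trans ?_ (heq_comp (comp_aux (D := D') (C := C') (fun j => (b j).lam) a.lam).symm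
    (comp_aux (fun j => (b j).lam) a.lam).symm rfl e2.symm (comp_map_heq b a).symm)
  refine heq_of_eq ?_
  rw [← Category.assoc, ← T.actMap_comp, Category.comp_id]
  refine (congrArg (fun z => z ≫ (a.precomp α).map) (congrArg (T.actMap (𝟙 D'))
    (funext fun j => push_precomp (β j) (b j) (a.lam j)))).trans ?_
  refine (Category.assoc _ _ _).symm.trans (congrArg (fun z => z ≫ a.map) ?_)
  refine (T.actMap_comp _ _ _ _).symm.trans ?_
  rw [Category.id_comp]
  congr 1
  funext j
  exact Category.comp_id _

theorem precomp_id {r : ℕ} {C : M.Op r} {src : Fin r → Lab X} {tgt : Lab X}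
    (a : Node X C src tgt) : a.precomp (𝟙 C) = a := by
  refine ext_heq (fun _ => rfl) (heq_of_eq ?_)
  exact (congrArg (fun z => z ≫ a.map) (Alg.actMap_id _ _ _)).trans (Category.id_comp _)

end Node

end CatOp

/-! ### Representatives and their morphisms up to permutations -/

namespace CatOp

variable {M : CatOperad.{u}} {L : Type u} [SmallCategory L]

open Bicategory

theorem nest_lex {p n m : ℕ} {s : Fin p → ℕ} {r : Fin n → ℕ} (e' : (Σ k, Fin (s k)) ≃ Fin n)
    (e : (Σ l, Fin (r l)) ≃ Fin m) (k : Fin p) (j : Fin (s k)) (i : Fin (r (e' ⟨k, j⟩))) :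
    nest e' e ⟨k, lex (fun j => r (e' ⟨k, j⟩)) rfl ⟨j, i⟩⟩ = e ⟨e' ⟨k, j⟩, i⟩ := by
  simp only [nest, Equiv.trans_apply, Equiv.sigmaCongrRight_apply,
    Equiv.symm_apply_apply]
  rfl

variable {X : L ⥤ LaxAlg M}

namespace Rep

/-- An isomorphism which only permutes the inputs. Two objects of the category of representatives
have the same class if and only if they are related in this way. -/
structure Iso (P' P : Rep X) where
  σ : Fin P'.n ≃ Fin P.n
  op : M.IsPerm σ P'.op P.op
  lab : ∀ i, P'.lab i = P.lab (σ i)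

namespace Iso

variable {P'' P' P : Rep X}

/-- This is the only use of the freeness of the symmetric group actions: without it, representatives
of composable classes could be composed along different permutations. -/
theorem unique (hM : M.SigmaFree) (s t : Iso P' P) : s = t := by
  obtain ⟨σ, h, _⟩ := s
  obtain ⟨τ, h', _⟩ := t
  obtain rfl := h.unique hM h'
  rfl

def refl (P : Rep X) : Iso P P := ⟨Equiv.refl _, .refl _, fun _ => rfl⟩

def symm (s : Iso P' P) : Iso P P' :=
  ⟨s.σ.symm, s.op.symm, fun i => by rw [s.lab, Equiv.apply_symm_apply]⟩

def trans (s : Iso P'' P') (t : Iso P' P) : Iso P'' P :=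
  ⟨s.σ.trans t.σ, s.op.trans t.op, fun i => (s.lab i).trans (t.lab _)⟩

def permute (P : Rep X) (σ : Equiv.Perm (Fin P.n)) : Iso (P.permute σ) P :=
  ⟨σ, .mk _ _, fun _ => rfl⟩

/-- Every isomorphism is, up to equality of its source, given by a permutation acting on its target.
-/
theorem elim (s : Iso P' P) {motive : ∀ P' : Rep X, Iso P' P → Prop}
    (H : ∀ σ : Equiv.Perm (Fin P.n), motive (P.permute σ) (permute P σ)) : motive P' s := by
  obtain ⟨n, A, lab⟩ := P
  obtain ⟨n', A', lab'⟩ := P'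
  obtain ⟨σ, h, h'⟩ := s
  dsimp only at σ h h'
  obtain rfl := CatOperad.eq_of_finEquiv σ
  obtain rfl := h.eq
  obtain rfl : lab' = fun i => lab (σ i) := funext h'
  exact H σ

theorem cls_eq (s : Iso P' P) : P'.cls = P.cls :=
  s.elim (motive := fun P' _ => P'.cls = P.cls) fun σ => Quot.sound (.permute P σ)

/-- The isomorphism of values of operations induced by isomorphisms of the arguments and by a
permutation of the inputs. -/
def act {n n' : ℕ} {B : M.Op n} {B' : M.Op n'} {Y : Fin n → Rep X} {Y' : Fin n' → Rep X}
    {π : Fin n' ≃ Fin n} (hB : M.IsPerm π B' B) (s : ∀ i, Iso (Y' i) (Y (π i))) :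
    Iso (Rep.act B' Y') (Rep.act B Y) where
  σ := lexCongr π fun i => (s i).σ
  op := .comp (fun i => (s i).σ) hB (fun i => (s i).op) (lexCongr_lex π _)
  lab := lex_ind _ rfl fun i j => by
    refine ((act_lab _ _ _ _).trans (((s i).lab j).trans (act_lab B _ _ _).symm)).trans ?_
    have e := lexCongr_lex (r := fun i => (Y i).n) (r' := fun i => (Y' i).n) π
      (fun i => (s i).σ) i j
    exact congrArg (Rep.act B Y).lab e.symm

end Iso

theorem exists_iso_of_cls_eq {P' P : Rep X} (h : P'.cls = P.cls) : Nonempty (Iso P' P) := by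
  have h1 : ∀ {P' P : Rep X}, Relation.EqvGen (ObjRel X) P' P → Nonempty (Iso P' P) := by
    intro P' P h
    induction h with
    | rel _ _ h => obtain ⟨_, σ⟩ := h; exact ⟨.permute _ σ⟩
    | refl P => exact ⟨.refl P⟩
    | symm _ _ _ ih => obtain ⟨s⟩ := ih; exact ⟨s.symm⟩
    | trans _ _ _ _ _ ih ih' =>
      obtain ⟨s⟩ := ih
      obtain ⟨t⟩ := ih'
      exact ⟨s.trans t⟩
  exact h1 (Quot.eqvGen_exact h)

end Rep

namespace RepHom

variable {P'' P' P Q'' Q' Q R' R : Rep X}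

/-- The node of `f'` over `k'` and the node of `f` over `k` agree up to the order of their inputs,
if the inputs of the sources are identified by `σ`. -/
def Match (σ : Fin P'.n → Fin P.n) (f' : RepHom P' Q') (k' : Fin Q'.n) (f : RepHom P Q)
    (k : Fin Q.n) : Prop :=
  ∃ ρ : Fin (f'.r k') ≃ Fin (f.r k), Node.Rel ρ (f'.node k') (f.node k) ∧
    ∀ j, σ (f'.e ⟨k', j⟩) = f.e ⟨k, ρ j⟩

/-- Two morphisms of representatives agree up to permutations of the inputs of the source, of the
target and of the nodes. -/
structure Rel (s : Rep.Iso P' P) (t : Rep.Iso Q' Q) (f' : RepHom P' Q') (f : RepHom P Q) :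
    Prop where
  γ : M.arr.IsPerm s.σ (M.toArr f'.γ) (M.toArr f.γ)
  node : ∀ k, Match s.σ f' k f (t.σ k)

namespace Rel

theorem refl (f : RepHom P Q) : Rel (.refl P) (.refl Q) f f :=
  ⟨.refl _, fun _ => ⟨Equiv.refl _, .refl _, fun _ => rfl⟩⟩

theorem trans {f'' : RepHom P'' Q''} {f' : RepHom P' Q'} {f : RepHom P Q} {s : Rep.Iso P'' P'}
    {s' : Rep.Iso P' P} {t : Rep.Iso Q'' Q'} {t' : Rep.Iso Q' Q} (h : Rel s t f'' f')
    (h' : Rel s' t' f' f) : Rel (s.trans s') (t.trans t') f'' f := by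
  refine ⟨h.γ.trans h'.γ, fun k => ?_⟩
  obtain ⟨ρ, h1, h2⟩ := h.node k
  obtain ⟨ρ', h3, h4⟩ := h'.node (t.σ k)
  refine ⟨ρ.trans ρ', h1.trans h3, fun j => ?_⟩
  exact (congrArg s'.σ (h2 j)).trans (h4 _)

theorem symm {f' : RepHom P' Q'} {f : RepHom P Q} {s : Rep.Iso P' P} {t : Rep.Iso Q' Q}
    (h : Rel s t f' f) : Rel s.symm t.symm f f' := by
  refine ⟨h.γ.symm, fun k => ?_⟩
  obtain ⟨k, rfl⟩ := t.σ.surjective k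
  have : t.symm.σ (t.σ k) = k := t.σ.symm_apply_apply k
  rw [this]
  obtain ⟨ρ, h1, h2⟩ := h.node k
  refine ⟨ρ.symm, h1.symm, fun j => ?_⟩
  have := h2 (ρ.symm j)
  rw [ρ.apply_symm_apply] at this
  rw [← this]
  exact s.σ.symm_apply_apply _

theorem permTarget (f : RepHom P Q) (τ : Equiv.Perm (Fin Q.n)) :
    Rel (.refl P) (.permute Q τ) (f.permTarget τ) f := by
  refine ⟨?_, fun k => ⟨Equiv.refl _, .refl _, fun j => rfl⟩⟩
  exact .of_eq_refl (CatOperad.toArr_comp_eqToHom f.γ (M.compE_perm_root f.e Q.op f.C τ).symm)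

theorem permNodes (f : RepHom P Q) (ρ : ∀ k, Equiv.Perm (Fin (f.r k))) :
    Rel (.refl P) (.refl Q) (f.permNodes ρ) f := by
  refine ⟨?_, fun k => ⟨ρ k, Node.perm_rel _ _, fun j => rfl⟩⟩
  exact .of_eq_refl (CatOperad.toArr_comp_eqToHom f.γ (M.compE_perm_nodes f.e Q.op f.C ρ).symm)

theorem permSource (f : RepHom P Q) (τ : Equiv.Perm (Fin P.n)) :
    Rel (.permute P τ) (.refl Q) (f.permSource τ) f := by
  refine ⟨?_, fun k => ⟨Equiv.refl _, Node.cast_rel _ _, fun j => τ.apply_symm_apply _⟩⟩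
  rw [RepHom.permSource]
  have := CatOperad.IsPerm.arr_map τ f.γ
  rwa [← CatOperad.toArr_comp_eqToHom _ (M.compE_perm f.e Q.op f.C τ)] at this

/-- Parallel morphisms which agree up to the identity permutations of source and target differ only
by permutations of the inputs of the nodes. -/
theorem eq_of_refl {f' f : RepHom P Q} (h : Rel (.refl P) (.refl Q) f' f) :
    ∃ ρ, f' = f.permNodes ρ := by
  choose ρ h1 h2 using h.node
  obtain ⟨r', e', C', γ', node'⟩ := f'
  obtain ⟨r, e, C, γ, node⟩ := f
  dsimp only at ρ h1 h2
  obtain rfl : r' = r := funext fun k => CatOperad.eq_of_finEquiv (ρ k)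
  refine ⟨ρ, ?_⟩
  obtain rfl : e' = (Equiv.sigmaCongrRight ρ).trans e := by
    ext ⟨k, j⟩
    exact congrArg Fin.val (h2 k j)
  obtain rfl : C' = fun k => (M.perm (ρ k)).obj (C k) := funext fun k => (h1 k).op.eq
  obtain rfl : node' = fun k => (node k).perm (ρ k) := by
    funext k
    exact Node.ext_heq (fun j => eq_of_heq ((h1 k).lam j))
      ((h1 k).map.trans (eqToHom_comp_heq _ _).symm)
  have h3 := CatOperad.heq_of_toArr h.γ.eq_of_refl
  have h4 : γ' = γ ≫ eqToHom (M.compE_perm_nodes e Q.op C ρ).symm :=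
    eq_of_heq (h3.trans (comp_eqToHom_heq _ _).symm)
  subst h4
  rfl

/-- A morphism may be transported along permutations of its source and target without changing its
class. -/
theorem exists_of_iso (f : RepHom P Q) (s : Rep.Iso P' P) (t : Rep.Iso Q' Q) :
    ∃ f' : RepHom P' Q', Rel s t f' f ∧
      (Quot.mk _ ⟨P', Q', f'⟩ : HocolimMor X) = Quot.mk _ ⟨P, Q, f⟩ := by
  refine s.elim (motive := fun P' s => ∃ f' : RepHom P' Q', Rel s t f' f ∧
      (Quot.mk _ ⟨P', Q', f'⟩ : HocolimMor X) = Quot.mk _ ⟨P, Q, f⟩) fun σ => ?_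
  refine t.elim (motive := fun Q' t => ∃ f' : RepHom (P.permute σ) Q',
    Rel (.permute P σ) t f' f ∧
      (Quot.mk _ ⟨_, Q', f'⟩ : HocolimMor X) = Quot.mk _ ⟨P, Q, f⟩) fun τ => ?_
  refine ⟨(f.permTarget τ).permSource σ, (permSource _ σ).trans (permTarget f τ), ?_⟩
  exact (Quot.sound (.source _ _)).symm.trans (Quot.sound (.target _ _)).symm

/-- Morphisms which agree up to permutations have the same class. -/
theorem mk_eq {f' : RepHom P' Q'} {f : RepHom P Q} {s : Rep.Iso P' P} {t : Rep.Iso Q' Q}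
    (h : Rel s t f' f) :
    (Quot.mk _ ⟨P', Q', f'⟩ : HocolimMor X) = Quot.mk _ ⟨P, Q, f⟩ := by
  obtain ⟨f₁, h1, h2⟩ := exists_of_iso f s t
  rw [← h2]
  have h3 := h.trans h1.symm
  have e1 : s.trans s.symm = .refl P' := by
    have : s.σ.trans s.σ.symm = Equiv.refl _ := Equiv.self_trans_symm _
    simp only [Rep.Iso.trans, Rep.Iso.symm, Rep.Iso.refl, this]
  have e2 : t.trans t.symm = .refl Q' := by
    have : t.σ.trans t.σ.symm = Equiv.refl _ := Equiv.self_trans_symm _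
    simp only [Rep.Iso.trans, Rep.Iso.symm, Rep.Iso.refl, this]
  rw [e1, e2] at h3
  obtain ⟨ρ, rfl⟩ := h3.eq_of_refl
  exact (Quot.sound (.nodes _ _)).symm

end Rel

theorem toArr_comp_γ (f : RepHom P Q) (g : RepHom Q R) :
    M.toArr (f.comp g).γ = M.toArr (f.γ ≫ M.compEMap f.e g.γ (fun l => 𝟙 (f.C l))) := by
  rw [comp, ← Category.assoc, CatOperad.toArr_comp_eqToHom]

theorem toArr_act_γ {n : ℕ} {B B' : M.Op n} {Y Y' : Fin n → Rep X} (β : B ⟶ B')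
    (f : ∀ i, RepHom (Y i) (Y' i)) : M.toArr (act β f).γ =
      M.arr.comp (fun i => (Y i).n) rfl (M.toArr β) (fun i => M.toArr (f i).γ) := by
  exact CatOperad.toArr_comp_eqToHom (M.compMap (fun i => (Y i).n) rfl β fun i => (f i).γ)
    (M.comp_compE (fun i => (Y' i).n) rfl (fun i => (f i).r) (fun i => (Y i).n)
      (fun i => (f i).e) rfl B' (fun i => (Y' i).op) (fun i => (f i).C))

theorem Match.comp {f' : RepHom P' Q'} {f : RepHom P Q} {g' : RepHom Q' R'} {g : RepHom Q R}
    {σ : Fin P'.n → Fin P.n} {τ : Fin Q'.n → Fin Q.n} {k' : Fin R'.n} {k : Fin R.n}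
    (hg : Match τ g' k' g k) (hf : ∀ y, Match σ f' y f (τ y)) :
    Match σ (f'.comp g') k' (f.comp g) k := by
  obtain ⟨π, hπ, hπ'⟩ := hg
  have h : ∀ j, Match σ f' (g'.e ⟨k', j⟩) f (g.e ⟨k, π j⟩) := fun j => by
    rw [← hπ']; exact hf _
  choose ρ h1 h2 using h
  have h3 := Node.comp_rel (b' := fun j => f'.node (g'.e ⟨k', j⟩))
    (b := fun j => f.node (g.e ⟨k, j⟩)) ρ hπ h1
  refine ⟨lexCongr π ρ, h3, ?_⟩
  refine lex_ind _ rfl fun j i => ?_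
  have e := lexCongr_lex (r := fun j => f.r (g.e ⟨k, j⟩)) π ρ j i
  refine Eq.trans ?_ (congrArg (fun x => nest g.e f.e ⟨k, x⟩) e).symm
  refine (congrArg σ (nest_lex _ _ _ _ _)).trans ((h2 j i).trans (nest_lex _ _ _ _ _).symm)

/-- The composition of morphisms of representatives is compatible with permutations. -/
theorem Rel.comp {f' : RepHom P' Q'} {f : RepHom P Q} {g' : RepHom Q' R'} {g : RepHom Q R}
    {s : Rep.Iso P' P} {t : Rep.Iso Q' Q} {w : Rep.Iso R' R} (hf : Rel s t f' f)
    (hg : Rel t w g' g) : Rel s w (f'.comp g') (f.comp g) := by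
  constructor
  · rw [toArr_comp_γ, toArr_comp_γ]
    choose ρ h1 h2 using hf.node
    exact hf.γ.arr_comp (.compE (M := M.arr)
      (C := fun l => M.toArr (𝟙 (f.C l))) (C' := fun l => M.toArr (𝟙 (f'.C l))) ρ hg.γ
      (fun l => (h1 l).op.arr_id) h2)
  · exact fun k => (hg.node k).comp hf.node

/-- The node of `β (f 1, …, f n)` over an input of the `i`-th block is the corresponding node of
`f i`. -/
theorem act_match {n : ℕ} {B B' : M.Op n} {Y Y' : Fin n → Rep X} (β : B ⟶ B')
    (f : ∀ i, RepHom (Y i) (Y' i)) (i : Fin n) (x : Fin (Y' i).n) :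
    Match (P' := Y i) (P := Rep.act B Y) (fun y => lex (fun i => (Y i).n) rfl ⟨i, y⟩) (f i) x
      (act β f) (lex (fun i => (Y' i).n) rfl ⟨i, x⟩) := by
  refine lex_symm_lex (fun i => (Y' i).n) rfl (x := ⟨i, x⟩)
    (motive := fun p => ∃ ρ : Fin ((f i).r x) ≃ Fin ((f p.1).r p.2),
      Node.Rel ρ ((f i).node x) (((f p.1).node p.2).cast
        (funext fun _ => (Rep.act_lab B Y _ _).symm)) ∧
      ∀ j, lex (fun i => (Y i).n) rfl ⟨i, (f i).e ⟨x, j⟩⟩ =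
        lex (fun i => (Y i).n) rfl ⟨p.1, (f p.1).e ⟨p.2, ρ j⟩⟩) ?_
  exact ⟨Equiv.refl _, (Node.cast_rel _ _).symm, fun _ => rfl⟩

theorem Match.trans {σ' : Fin P''.n → Fin P'.n} {σ : Fin P'.n → Fin P.n} {f'' : RepHom P'' Q''}
    {f' : RepHom P' Q'} {f : RepHom P Q} {k'' : Fin Q''.n} {k' : Fin Q'.n} {k : Fin Q.n}
    (h : Match σ' f'' k'' f' k') (h' : Match σ f' k' f k) :
    Match (fun x => σ (σ' x)) f'' k'' f k := by
  obtain ⟨ρ, h1, h2⟩ := h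
  obtain ⟨ρ', h3, h4⟩ := h'
  exact ⟨ρ.trans ρ', h1.trans h3, fun j => (congrArg σ (h2 j)).trans (h4 _)⟩

/-- Two nodes which match the same node match each other. -/
theorem Match.of_common {σ' : Fin P''.n → Fin P'.n} {σ : Fin P''.n → Fin P.n}
    {f'' : RepHom P'' Q''} {f' : RepHom P' Q'} {f : RepHom P Q} {k'' : Fin Q''.n} {k' : Fin Q'.n}
    {k : Fin Q.n} (h : Match σ' f'' k'' f' k') (h' : Match σ f'' k'' f k) {τ : Fin P'.n → Fin P.n}
    (hτ : ∀ x, τ (σ' x) = σ x) : Match τ f' k' f k := by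
  obtain ⟨ρ, h1, h2⟩ := h
  obtain ⟨ρ', h3, h4⟩ := h'
  refine ⟨ρ.symm.trans ρ', h1.symm.trans h3, fun j => ?_⟩
  obtain ⟨j, rfl⟩ := ρ.surjective j
  rw [← h2, hτ, h4]
  have : (ρ.symm.trans ρ') (ρ j) = ρ' j := congrArg ρ' (ρ.symm_apply_apply j)
  rw [this]

/-- The action of the operad on morphisms of representatives is compatible with permutations. -/
theorem Rel.act {n n' : ℕ} {A B : M.Op n} {A' B' : M.Op n'} {β : A ⟶ B} {β' : A' ⟶ B'}
    {Y Z : Fin n → Rep X} {Y' Z' : Fin n' → Rep X} {π : Fin n' ≃ Fin n}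
    (hβ : M.arr.IsPerm π (M.toArr β') (M.toArr β)) {s : ∀ i, Rep.Iso (Y' i) (Y (π i))}
    {t : ∀ i, Rep.Iso (Z' i) (Z (π i))} {f' : ∀ i, RepHom (Y' i) (Z' i)}
    {f : ∀ i, RepHom (Y i) (Z i)} (h : ∀ i, Rel (s i) (t i) (f' i) (f (π i))) :
    Rel (Rep.Iso.act hβ.arr_src s) (Rep.Iso.act hβ.arr_tgt t) (act β' f') (act β f) := by
  constructor
  · rw [toArr_act_γ, toArr_act_γ]
    exact .comp (M := M.arr) (fun i => (s i).σ) hβ (fun i => (h i).γ) (lexCongr_lex π _)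
  · refine lex_ind _ rfl fun i x => ?_
    have e : (Rep.Iso.act hβ.arr_tgt t).σ (lex (fun i => (Z' i).n) rfl ⟨i, x⟩) =
        lex (fun i => (Z i).n) rfl ⟨π i, (t i).σ x⟩ := lexCongr_lex _ _ _ _
    rw [e]
    exact (act_match β' f' i x).of_common
      (((h i).node x).trans (act_match β f (π i) ((t i).σ x))) fun y => lexCongr_lex _ _ _ _

end RepHom

end CatOp

/-! ### Laws of an algebra up to permutations -/

namespace CatOp

variable {M : CatOperad.{u}} {L : Type u} [SmallCategory L]

open Bicategory

variable {X : L ⥤ LaxAlg M}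

theorem Node.id_rel {x y : Lab X} (h : x = y) :
    Node.Rel (Equiv.refl _) (Node.id x) (Node.id y) := by
  subst h; exact .refl _

namespace RepHom

variable {P Q R T : Rep X}

theorem toArr_id_γ (P : Rep X) : M.toArr (id P).γ = M.toArr (𝟙 P.op) :=
  CatOperad.toArr_eqToHom (M.compE_one _).symm

theorem id_rel (s : Rep.Iso P Q) : Rel s s (id P) (id Q) := by
  refine ⟨?_, fun k => ⟨Equiv.refl _, Node.id_rel (s.lab k), fun j => rfl⟩⟩
  rw [toArr_id_γ, toArr_id_γ]
  exact s.op.arr_id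

theorem id_comp_rel (f : RepHom P Q) : Rel (.refl P) (.refl Q) f ((id P).comp f) := by
  constructor
  · rw [toArr_comp_γ]
    have h := CatOperad.IsPerm.compE_one (M := M.arr) (Equiv.sigmaUnique (Fin P.n) fun _ => Fin 1)
      (M.toArr f.γ) (σ := Equiv.refl _) fun _ => rfl
    have h' : M.toArr (M.compEMap (id P).e f.γ fun l => 𝟙 ((id P).C l)) = M.toArr f.γ :=
      h.eq_of_refl.symm
    refine .of_eq_refl ?_
    refine Eq.trans ?_ (CatOperad.toArr_eqToHom_comp (M.compE_one P.op).symm _).symm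
    exact h'.symm
  · intro k
    refine ⟨(Equiv.sigmaUnique (Fin (f.r k)) fun _ => Fin 1).symm.trans
        (lex (fun _ : Fin (f.r k) => 1) rfl), Node.id_comp_rel (f.node k) fun j => rfl, fun j => ?_⟩
    exact (nest_lex (r := fun _ : Fin P.n => 1) f.e (Equiv.sigmaUnique (Fin P.n) fun _ => Fin 1)
      k j (0 : Fin 1)).symm

theorem comp_id_rel (f : RepHom P Q) : Rel (.refl P) (.refl Q) f (f.comp (id Q)) := by
  constructor
  · rw [toArr_comp_γ]
    refine .of_eq_refl ?_
    have h := toArr_id_γ Q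
    have h' : M.toArr (M.compEMap f.e (id Q).γ fun l => 𝟙 (f.C l)) =
        M.toArr (𝟙 (M.compE f.e Q.op f.C)) := by
      rw [← CatOperad.compEMap_id, CatOperad.toArr_compEMap, CatOperad.toArr_compEMap, h]
    refine Eq.trans ?_ (CatOperad.toArr_congr_comp rfl h'.symm)
    rw [Category.comp_id]
  · intro k
    refine ⟨(single (f.r k)).symm.trans (lex (fun _ : Fin 1 => f.r k) rfl),
      Node.comp_id_rel (f.node k) fun j => rfl, fun j => ?_⟩
    exact (nest_lex (s := fun _ : Fin Q.n => 1) (Equiv.sigmaUnique (Fin Q.n) fun _ => Fin 1) f.e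
      k (0 : Fin 1) j).symm

/-- The composition of morphisms of representatives is associative up to permutations of the inputs
of the nodes. -/
theorem assoc_rel (f : RepHom P Q) (g : RepHom Q R) (h : RepHom R T) :
    Rel (.refl P) (.refl T) (f.comp (g.comp h)) ((f.comp g).comp h) := by
  constructor
  · refine .of_eq_refl ?_
    rw [toArr_comp_γ, toArr_comp_γ]
    have h1 := toArr_comp_γ f g
    have h2 := toArr_comp_γ g h
    have h3 : M.toArr (M.compEMap f.e (g.comp h).γ fun l => 𝟙 (f.C l)) =
        M.toArr (M.compEMap f.e (g.γ ≫ M.compEMap g.e h.γ fun l => 𝟙 (g.C l))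
          fun l => 𝟙 (f.C l) ≫ 𝟙 (f.C l)) := by
      rw [CatOperad.toArr_compEMap, CatOperad.toArr_compEMap, h2]
      simp only [Category.comp_id]
    rw [CatOperad.compEMap_comp] at h3
    have h4 := M.arr.compE_compE g.e f.e (M.toArr h.γ) (fun l => M.toArr (𝟙 (g.C l)))
      (fun l => M.toArr (𝟙 (f.C l)))
    have h5 : M.toArr (M.compEMap f.e (M.compEMap g.e h.γ fun l => 𝟙 (g.C l)) fun l => 𝟙 (f.C l)) =
        M.toArr (M.compEMap (f.comp g).e h.γ fun l => 𝟙 ((f.comp g).C l)) := by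
      have h6 : ∀ k, M.arr.comp (fun j => f.r (g.e ⟨k, j⟩)) rfl (M.toArr (𝟙 (g.C k)))
          (fun j => M.toArr (𝟙 (f.C (g.e ⟨k, j⟩)))) = M.toArr (𝟙 ((f.comp g).C k)) := fun k =>
        congrArg (fun a => M.toArr a) (M.compMap_id (fun j => f.r (g.e ⟨k, j⟩)) rfl (g.C k)
          fun j => f.C (g.e ⟨k, j⟩))
      exact h4.trans (congrArg (fun F => M.arr.compE (nest g.e f.e) (M.toArr h.γ) F) (funext h6))
    refine (CatOperad.toArr_congr_comp rfl h3).trans ?_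
    rw [← Category.assoc]
    exact CatOperad.toArr_congr_comp h1.symm h5
  · intro k
    have hs : ∑ l, f.r ((g.comp h).e ⟨k, l⟩) =
        ∑ j, ∑ i, f.r (g.e ⟨h.e ⟨k, j⟩, i⟩) :=
      CatOperad.eq_of_finEquiv ((lex _ rfl).symm.trans
        ((graft (fun j => g.r (h.e ⟨k, j⟩)) rfl (fun j i => f.r (g.e ⟨h.e ⟨k, j⟩, i⟩)) _
          (fun j => lex _ rfl) rfl)))
    have h1 := Node.comp_assoc_rel (fun j i => f.node (g.e ⟨h.e ⟨k, j⟩, i⟩))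
      (fun j => g.node (h.e ⟨k, j⟩)) (h.node k) hs
    refine ⟨finCongr hs, h1, ?_⟩
    refine lex_ind _ rfl fun l x => ?_
    have e := lex_lex (fun j => g.r (h.e ⟨k, j⟩)) rfl (fun j i => f.r (g.e ⟨h.e ⟨k, j⟩, i⟩))
      (fun j => ∑ i, f.r (g.e ⟨h.e ⟨k, j⟩, i⟩)) (fun _ => rfl) rfl hs l x
    refine Eq.trans (b := f.e ⟨(g.comp h).e ⟨k, l⟩, x⟩) (nest_lex (g.comp h).e f.e k l x) ?_
    refine Eq.trans ?_ (congrArg (fun x => nest h.e (nest g.e f.e) ⟨k, x⟩) e).symm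
    refine Eq.symm ((nest_lex h.e (nest g.e f.e) _ _ _).trans ?_)
    exact nest_lex g.e f.e _ _ x

theorem act_id_rel {n : ℕ} (B : M.Op n) (Y : Fin n → Rep X) :
    Rel (.refl _) (.refl _) (act (𝟙 B) fun i => id (Y i)) (id (Rep.act B Y)) := by
  constructor
  · refine .of_eq_refl ?_
    rw [toArr_act_γ]
    simp only [toArr_id_γ]
    refine Eq.trans ?_ (congrArg (fun a => M.toArr a) (M.compMap_id (fun i => (Y i).n) rfl B _))
    rfl
  · refine lex_ind _ rfl fun i x => ?_
    refine (act_match (𝟙 B) (fun i => id (Y i)) i x).of_common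
      (σ := fun y => lex (fun i => (Y i).n) rfl ⟨i, y⟩) (τ := fun x => x) ?_ fun _ => rfl
    exact ⟨Equiv.refl _, Node.id_rel (Rep.act_lab B Y i x).symm, fun j => rfl⟩

theorem act_comp_rel {n : ℕ} {B B' B'' : M.Op n} {Y Y' Y'' : Fin n → Rep X} (β : B ⟶ B')
    (β' : B' ⟶ B'') (f : ∀ i, RepHom (Y i) (Y' i)) (g : ∀ i, RepHom (Y' i) (Y'' i)) :
    Rel (.refl _) (.refl _) (act (β ≫ β') fun i => (f i).comp (g i))
      ((act β f).comp (act β' g)) := by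
  constructor
  · refine .of_eq_refl ?_
    rw [toArr_act_γ, toArr_comp_γ]
    simp only [toArr_comp_γ]
    rw [← CatOperad.toArr_compMap, M.compMap_comp]
    refine CatOperad.toArr_congr_comp (toArr_act_γ β f).symm ?_
    have h := M.arr.comp_compE (fun i => (Y' i).n) rfl (fun i => (f i).r) (fun i => (Y i).n)
      (fun i => (f i).e) rfl (M.toArr β') (fun i => M.toArr (g i).γ)
      (fun i l => M.toArr (𝟙 ((f i).C l)))
    refine h.trans ?_
    exact congrArg (fun a => M.arr.compE (act β f).e a fun l => M.toArr (𝟙 ((act β f).C l)))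
      (toArr_act_γ β' g).symm
  · refine lex_ind _ rfl fun i x => ?_
    refine (act_match (β ≫ β') (fun i => (f i).comp (g i)) i x).of_common ?_ (fun _ => rfl)
    exact (act_match β' g i x).comp fun y => act_match β f i y

end RepHom

namespace Rep

/-- The identity operation sends an object to itself, up to a renaming of the inputs. -/
def oneIso (Y : Fin 1 → Rep X) : Iso (Y 0) (act M.one Y) where
  σ := (Equiv.uniqueSigma fun i => Fin (Y i).n).symm.trans (lex (fun i => (Y i).n) rfl)
  op := by
    have := CatOperad.IsPerm.one_compE (lex (fun i => (Y i).n) rfl) (fun i => (Y i).op)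
      (σ := (Equiv.uniqueSigma fun i => Fin (Y i).n).symm.trans (lex (fun i => (Y i).n) rfl))
      fun _ => rfl
    rw [CatOperad.compE_lex] at this
    exact this
  lab i := (act_lab M.one Y 0 i).symm

/-- The reindexing of the inputs of `A (C i (Y i j))`. -/
def compEquiv {n m : ℕ} (r : Fin n → ℕ) (h : ∑ i, r i = m) (q : Fin m → ℕ) :
    Fin (∑ l, q l) ≃ Fin (∑ i, ∑ j, q (lex r h ⟨i, j⟩)) :=
  (nest (lex r h) (lex q rfl)).symm.trans (lex _ rfl)

theorem compEquiv_lex {n m : ℕ} (r : Fin n → ℕ) (h : ∑ i, r i = m) (q : Fin m → ℕ) (i : Fin n)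
    (j : Fin (r i)) (x : Fin (q (lex r h ⟨i, j⟩))) :
    compEquiv r h q (lex q rfl ⟨lex r h ⟨i, j⟩, x⟩) =
      lex (fun i => ∑ j, q (lex r h ⟨i, j⟩)) rfl ⟨i, lex _ rfl ⟨j, x⟩⟩ := by
  rw [← nest_lex, compEquiv]
  simp

/-- A composite operation takes the same value as the iterated application of its parts, up to a
reindexing of iterated sums. -/
def compIso {n m : ℕ} (r : Fin n → ℕ) (h : ∑ i, r i = m) (A : M.Op n) (C : ∀ i, M.Op (r i))
    (Y : Fin m → Rep X) : Iso (act (M.comp r h A C) Y)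
      (act A fun i => act (C i) fun j => Y (lex r h ⟨i, j⟩)) where
  σ := compEquiv r h fun l => (Y l).n
  op := by
    have := CatOperad.IsPerm.assoc (e' := lex r h) (e := lex (fun l => (Y l).n) rfl)
      (s' := fun i j => (Y (lex r h ⟨i, j⟩)).n) (e₂ := fun i => lex _ rfl) (e₃ := lex _ rfl)
      (A := A) (D := C) (C := fun l => (Y l).op) (C' := fun i j => (Y (lex r h ⟨i, j⟩)).op)
      (fun i j => Equiv.refl _) (fun i j => .refl _) (compEquiv_lex r h fun l => (Y l).n)
    simp only [CatOperad.compE_lex] at this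
    exact this
  lab := lex_ind _ rfl (lex_ind _ h fun i j x => by
    have e := compEquiv_lex r h (fun l => (Y l).n) i j x
    refine Eq.trans ?_ (congrArg (act A fun i => act (C i) fun j => Y (lex r h ⟨i, j⟩)).lab e).symm
    refine (act_lab _ _ _ _).trans (Eq.symm ?_)
    exact (act_lab A (fun i => act (C i) fun j => Y (lex r h ⟨i, j⟩)) i _).trans
      (act_lab (C i) (fun j => Y (lex r h ⟨i, j⟩)) j x))

end Rep

namespace RepHom

/-- The unit of the operad acts as the identity on morphisms, up to permutations. -/
theorem one_act_rel {Y Y' : Fin 1 → Rep X} (f : ∀ i, RepHom (Y i) (Y' i)) :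
    Rel (Rep.oneIso Y) (Rep.oneIso Y') (f 0) (act (𝟙 M.one) f) := by
  constructor
  · rw [toArr_act_γ, ← CatOperad.compE_lex]
    exact CatOperad.IsPerm.one_compE (M := M.arr) _ (fun i => M.toArr (f i).γ) fun _ => rfl
  · exact fun k => act_match (𝟙 M.one) f 0 k

/-- The action on morphisms is compatible with the composition of operations, up to permutations. -/
theorem comp_act_rel {n m : ℕ} (r : Fin n → ℕ) (h : ∑ i, r i = m) {A A' : M.Op n}
    {C C' : ∀ i, M.Op (r i)} {Y Y' : Fin m → Rep X} (α : A ⟶ A') (c : ∀ i, C i ⟶ C' i)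
    (f : ∀ l, RepHom (Y l) (Y' l)) :
    Rel (Rep.compIso r h A C Y) (Rep.compIso r h A' C' Y') (act (M.compMap r h α c) f)
      (act α fun i => act (c i) fun j => f (lex r h ⟨i, j⟩)) := by
  constructor
  · rw [toArr_act_γ, toArr_act_γ]
    simp only [toArr_act_γ]
    have := CatOperad.IsPerm.assoc (M := M.arr) (e' := lex r h) (e := lex (fun l => (Y l).n) rfl)
      (s' := fun i j => (Y (lex r h ⟨i, j⟩)).n) (e₂ := fun i => lex _ rfl) (e₃ := lex _ rfl)
      (A := M.toArr α) (D := fun i => M.toArr (c i)) (C := fun l => M.toArr (f l).γ)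
      (C' := fun i j => M.toArr (f (lex r h ⟨i, j⟩)).γ)
      (fun i j => Equiv.refl _) (fun i j => .refl _)
      (Rep.compEquiv_lex r h fun l => (Y l).n)
    simp only [CatOperad.compE_lex] at this
    exact this
  · refine lex_ind _ rfl (lex_ind _ h fun i j x => ?_)
    have e : (Rep.compIso r h A' C' Y').σ (lex (fun l => (Y' l).n) rfl ⟨lex r h ⟨i, j⟩, x⟩) = _ :=
      Rep.compEquiv_lex r h (fun l => (Y' l).n) i j x
    rw [e]
    refine (act_match (M.compMap r h α c) f (lex r h ⟨i, j⟩) x).of_common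
      ((act_match (c i) (fun j => f (lex r h ⟨i, j⟩)) j x).trans
        (act_match α (fun i => act (c i) fun j => f (lex r h ⟨i, j⟩)) i _)) fun y => ?_
    exact Rep.compEquiv_lex r h (fun l => (Y l).n) i j y

end RepHom

end CatOp

/-! ### Composition and action on classes of morphisms -/

namespace CatOp

variable {M : CatOperad.{u}} {L : Type u} [SmallCategory L]

open Bicategory

variable {X : L ⥤ LaxAlg M}

/-- The class of a morphism of the category of representatives, forgetting its source and target. -/
def RepHom.mor {P Q : Rep X} (f : RepHom P Q) : HocolimMor X := Quot.mk _ ⟨P, Q, f⟩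

/-- The two morphisms of representatives related by `MorRel.decompose`. -/
structure Decomp (X : L ⥤ LaxAlg M) : Type u where
  {P Q : Rep X}
  r : Fin Q.n → ℕ
  e : (Σ k, Fin (r k)) ≃ Fin P.n
  {D C : ∀ k, M.Op (r k)}
  δ : P.op ⟶ M.compE e Q.op D
  α : ∀ k, D k ⟶ C k
  f : ∀ k, Node X (C k) (fun j => P.lab (e ⟨k, j⟩)) (Q.lab k)

namespace Decomp

/-- The morphism in which `α` is part of the morphism of operations. -/
def left (d : Decomp X) : RepHom d.P d.Q :=
  ⟨d.r, d.e, d.C, d.δ ≫ M.compEMap d.e (𝟙 d.Q.op) d.α, d.f⟩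

/-- The morphism in which `α` is part of the nodes. -/
def right (d : Decomp X) : RepHom d.P d.Q :=
  ⟨d.r, d.e, d.D, d.δ, fun k => (d.f k).precomp (d.α k)⟩

/-- The trivial decomposition. -/
def refl {P Q : Rep X} (f : RepHom P Q) : Decomp X :=
  ⟨f.r, f.e, f.γ, fun k => 𝟙 (f.C k), f.node⟩

theorem refl_left {P Q : Rep X} (f : RepHom P Q) : (refl f).left = f := by
  obtain ⟨r, e, C, γ, node⟩ := f
  simp only [refl, left]
  congr 1
  exact (congrArg (fun g => γ ≫ g) (CatOperad.compEMap_id e Q.op C)).trans (Category.comp_id γ)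

theorem refl_right {P Q : Rep X} (f : RepHom P Q) : (refl f).right = f := by
  obtain ⟨r, e, C, γ, node⟩ := f
  simp only [refl, right]
  congr 1
  exact funext fun k => Node.precomp_id _

end Decomp

/-- Two morphisms have the same class if the nodes of the second arise from those of the first by
precomposition with morphisms `α k`, and these account for the difference of the morphisms of
operations. -/
theorem mk_eq_of_decompose {P Q : Rep X} (r : Fin Q.n → ℕ) (e : (Σ k, Fin (r k)) ≃ Fin P.n)
    {D C : ∀ k, M.Op (r k)} (γ : P.op ⟶ M.compE e Q.op C) (δ : P.op ⟶ M.compE e Q.op D)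
    (α : ∀ k, D k ⟶ C k) (f : ∀ k, Node X (C k) (fun j => P.lab (e ⟨k, j⟩)) (Q.lab k))
    (g : ∀ k, Node X (D k) (fun j => P.lab (e ⟨k, j⟩)) (Q.lab k))
    (hγ : M.toArr γ = M.toArr (δ ≫ M.compEMap e (𝟙 Q.op) α))
    (hg : ∀ k, g k = (f k).precomp (α k)) :
    RepHom.mor ⟨r, e, C, γ, f⟩ = RepHom.mor ⟨r, e, D, δ, g⟩ := by
  obtain rfl := eq_of_heq (CatOperad.heq_of_toArr hγ)
  obtain rfl := funext hg
  exact Quot.sound (.decompose r e δ α f)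

namespace Decomp

theorem comp_mk (d : Decomp X) {R : Rep X} (g : RepHom d.Q R) :
    (d.left.comp g).mor = (d.right.comp g).mor := by
  refine mk_eq_of_decompose _ _ (d.left.comp g).γ (d.right.comp g).γ
    (fun k => M.compMap (fun j => d.r (g.e ⟨k, j⟩)) rfl (𝟙 (g.C k)) fun j => d.α (g.e ⟨k, j⟩))
    (d.left.comp g).node (d.right.comp g).node ?_ fun k => ?_
  · have h1 := RepHom.toArr_comp_γ d.left g
    have h2 := RepHom.toArr_comp_γ d.right g
    have h3 : M.toArr (M.compEMap d.e (𝟙 (M.compE g.e R.op g.C)) d.α) =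
        M.toArr (M.compEMap (nest g.e d.e) (𝟙 R.op) fun k =>
          M.compMap (fun j => d.r (g.e ⟨k, j⟩)) rfl (𝟙 (g.C k)) fun j => d.α (g.e ⟨k, j⟩)) := by
      rw [← CatOperad.compEMap_id]
      exact M.arr.compE_compE g.e d.e (M.toArr (𝟙 R.op)) (fun k => M.toArr (𝟙 (g.C k)))
        fun l => M.toArr (d.α l)
    refine h1.trans (Eq.trans ?_ (CatOperad.toArr_congr_comp h2.symm h3))
    refine congrArg (fun f => M.toArr f) ?_
    refine (Category.assoc _ _ _).trans (Eq.trans ?_ (Category.assoc _ _ _).symm)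
    refine congrArg (fun f => d.δ ≫ f) ?_
    refine (CatOperad.compEMap_comp d.e (𝟙 _) g.γ d.α fun l => 𝟙 (d.C l)).symm.trans ?_
    refine Eq.trans ?_ (CatOperad.compEMap_comp d.e g.γ (𝟙 _) (fun l => 𝟙 (d.D l)) d.α)
    simp only [Category.comp_id, Category.id_comp]
  · have h := Node.precomp_comp (fun j => d.α (g.e ⟨k, j⟩)) (𝟙 (g.C k))
      (fun j => d.f (g.e ⟨k, j⟩)) (g.node k)
    rw [Node.precomp_id] at h
    exact h

theorem mk_comp (d : Decomp X) {P : Rep X} (f : RepHom P d.P) :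
    (f.comp d.left).mor = (f.comp d.right).mor := by
  refine mk_eq_of_decompose _ _ (f.comp d.left).γ (f.comp d.right).γ
    (fun k => M.compMap (fun j => f.r (d.e ⟨k, j⟩)) rfl (d.α k) fun j => 𝟙 (f.C (d.e ⟨k, j⟩)))
    (f.comp d.left).node (f.comp d.right).node ?_ fun k => ?_
  · have h1 := RepHom.toArr_comp_γ f d.left
    have h2 := RepHom.toArr_comp_γ f d.right
    have h3 : M.toArr (M.compEMap f.e (M.compEMap d.e (𝟙 d.Q.op) d.α) fun l => 𝟙 (f.C l)) =
        M.toArr (M.compEMap (nest d.e f.e) (𝟙 d.Q.op) fun k =>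
          M.compMap (fun j => f.r (d.e ⟨k, j⟩)) rfl (d.α k) fun j => 𝟙 (f.C (d.e ⟨k, j⟩))) :=
      M.arr.compE_compE d.e f.e (M.toArr (𝟙 d.Q.op)) (fun k => M.toArr (d.α k))
        fun l => M.toArr (𝟙 (f.C l))
    refine h1.trans (Eq.trans ?_ (CatOperad.toArr_congr_comp h2.symm h3))
    refine congrArg (fun f => M.toArr f) ?_
    refine Eq.trans ?_ (Category.assoc _ _ _).symm
    refine congrArg (fun g => f.γ ≫ g) ?_
    refine Eq.trans ?_ (CatOperad.compEMap_comp f.e d.δ (M.compEMap d.e (𝟙 d.Q.op) d.α)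
      (fun l => 𝟙 (f.C l)) fun l => 𝟙 (f.C l))
    simp only [Category.comp_id]
    rfl
  · have h := Node.precomp_comp (fun j => 𝟙 (f.C (d.e ⟨k, j⟩))) (d.α k)
      (fun j => f.node (d.e ⟨k, j⟩)) (d.f k)
    simp only [Node.precomp_id] at h
    exact h

theorem act_mk {n : ℕ} {B B' : M.Op n} (β : B ⟶ B') (d : Fin n → Decomp X) :
    (RepHom.act β fun i => (d i).left).mor = (RepHom.act β fun i => (d i).right).mor := by
  refine mk_eq_of_decompose _ _ (RepHom.act β fun i => (d i).left).γ
    (RepHom.act β fun i => (d i).right).γ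
    (fun l => (d ((lex (fun i => (d i).Q.n) rfl).symm l).1).α
      ((lex (fun i => (d i).Q.n) rfl).symm l).2)
    (RepHom.act β fun i => (d i).left).node (RepHom.act β fun i => (d i).right).node ?_ fun l => ?_
  · have h1 := RepHom.toArr_act_γ β fun i => (d i).left
    have h2 := RepHom.toArr_act_γ β fun i => (d i).right
    have h3 := M.arr.comp_compE (fun i => (d i).Q.n) rfl (fun i => (d i).r) (fun i => (d i).P.n)
      (fun i => (d i).e) rfl (M.toArr (𝟙 B')) (fun i => M.toArr (𝟙 (d i).Q.op))
      (fun i l => M.toArr ((d i).α l))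
    have h4 : M.arr.comp (fun i => (d i).Q.n) rfl (M.toArr (𝟙 B'))
        (fun i => M.toArr (𝟙 (d i).Q.op)) = M.toArr (𝟙 (Rep.act B' fun i => (d i).Q).op) :=
      congrArg (fun f => M.toArr f) (M.compMap_id (fun i => (d i).Q.n) rfl B'
        fun i => (d i).Q.op)
    have h5 := M.compMap_comp (fun i => (d i).P.n) rfl β (𝟙 B') (fun i => (d i).δ)
      (fun i => M.compEMap (d i).e (𝟙 (d i).Q.op) (d i).α)
    rw [Category.comp_id] at h5
    refine h1.trans ((congrArg (fun f => M.toArr f) h5).trans ?_)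
    refine CatOperad.toArr_congr_comp h2.symm (h3.trans ?_)
    exact congrArg (fun a => M.arr.compE (RepHom.act β fun i => (d i).left).e a fun l =>
      M.toArr ((d ((lex (fun i => (d i).Q.n) rfl).symm l).1).α
        ((lex (fun i => (d i).Q.n) rfl).symm l).2)) h4
  · have : ∀ {r : ℕ} {C D : M.Op r} {src src' : Fin r → Lab X} {tgt : Lab X} (h : src = src')
        (a : Node X C src tgt) (α : D ⟶ C), (a.precomp α).cast h = (a.cast h).precomp α := by
      rintro r C D src _ tgt rfl a α; rfl
    exact this _ _ _

end Decomp

/-- Two morphisms of representatives which agree up to permutations. -/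
def Arrow.Perm (a b : Arrow X) : Prop :=
  ∃ (s : Rep.Iso b.src a.src) (t : Rep.Iso b.tgt a.tgt), RepHom.Rel s t b.hom a.hom

theorem Arrow.Perm.refl (a : Arrow X) : Arrow.Perm a a := ⟨.refl _, .refl _, .refl _⟩

/-- The arrow `b` arises from `a` by moving part of the morphism of operations into the nodes. Every
arrow is related to itself in this way. -/
def Arrow.IsDecomp (a b : Arrow X) : Prop :=
  ∃ d : Decomp X, a = ⟨d.P, d.Q, d.left⟩ ∧ b = ⟨d.P, d.Q, d.right⟩

theorem Arrow.IsDecomp.refl (a : Arrow X) : Arrow.IsDecomp a a :=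
  ⟨.refl a.hom, by rw [Decomp.refl_left]; rfl, by rw [Decomp.refl_right]; rfl⟩

theorem MorRel.cases {a b : Arrow X} (h : MorRel X a b) : Arrow.Perm a b ∨ Arrow.IsDecomp a b := by
  obtain (⟨f, τ⟩ | ⟨f, ρ⟩ | ⟨r, e, δ, α, f⟩ | ⟨f, τ⟩) := h
  · exact Or.inl ⟨_, _, .permTarget f τ⟩
  · exact Or.inl ⟨_, _, .permNodes f ρ⟩
  · exact Or.inr ⟨⟨r, e, δ, α, f⟩, rfl, rfl⟩
  · exact Or.inl ⟨_, _, .permSource f τ⟩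

namespace RepHom

variable {P P' Q Q' R R' : Rep X}

/-- The class of a composite depends only on the class of the first morphism. -/
theorem comp_congr_left (hM : M.SigmaFree) {a a' : Arrow X}
    (h : (Quot.mk _ a : HocolimMor X) = Quot.mk _ a') :
    Nonempty (Rep.Iso a'.tgt a.tgt) ∧ ∀ {R R' : Rep X} {g : RepHom a.tgt R} {g' : RepHom a'.tgt R'}
      (t : Rep.Iso a'.tgt a.tgt) (w : Rep.Iso R' R), Rel t w g' g →
        (a.hom.comp g).mor = (a'.hom.comp g').mor := by
  replace h := Quot.eqvGen_exact h
  induction h with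
  | rel a a' h =>
    obtain ⟨s, t, h⟩ | ⟨d, rfl, rfl⟩ := h.cases
    · refine ⟨⟨t⟩, fun t' w hg => ?_⟩
      -- The relation between `g` and `g'` is along the isomorphism underlying the move.
      obtain rfl := t'.unique hM t
      exact (h.comp hg).mk_eq.symm
    · refine ⟨⟨.refl _⟩, fun t' w hg => ?_⟩
      obtain rfl := t'.unique hM (.refl _)
      exact (d.comp_mk _).trans ((Rel.refl _).comp hg).mk_eq.symm
  | refl a =>
    refine ⟨⟨.refl _⟩, fun t' w hg => ?_⟩
    obtain rfl := t'.unique hM (.refl _)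
    exact ((Rel.refl _).comp hg).mk_eq.symm
  | symm a a' _ ih =>
    obtain ⟨⟨t⟩, ih⟩ := ih
    exact ⟨⟨t.symm⟩, fun t' w hg => (ih t'.symm w.symm hg.symm).symm⟩
  | trans a a' a'' _ _ ih ih' =>
    obtain ⟨⟨t⟩, ih⟩ := ih
    obtain ⟨⟨t'⟩, ih'⟩ := ih'
    refine ⟨⟨t'.trans t⟩, fun {R R' g g'} u w hg => ?_⟩
    obtain ⟨g₁, h1, -⟩ := Rel.exists_of_iso g t (.refl R)
    exact (ih t _ h1).trans (ih' _ _ (hg.trans h1.symm))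

/-- The class of a composite depends only on the class of the second morphism. -/
theorem comp_congr_right (hM : M.SigmaFree) {a a' : Arrow X}
    (h : (Quot.mk _ a : HocolimMor X) = Quot.mk _ a') :
    Nonempty (Rep.Iso a'.src a.src) ∧ ∀ {R R' : Rep X} {g : RepHom R a.src} {g' : RepHom R' a'.src}
      (t : Rep.Iso a'.src a.src) (w : Rep.Iso R' R), Rel w t g' g →
        (g.comp a.hom).mor = (g'.comp a'.hom).mor := by
  replace h := Quot.eqvGen_exact h
  induction h with
  | rel a a' h =>
    obtain ⟨s, t, h⟩ | ⟨d, rfl, rfl⟩ := h.cases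
    · refine ⟨⟨s⟩, fun t' w hg => ?_⟩
      obtain rfl := t'.unique hM s
      exact (hg.comp h).mk_eq.symm
    · refine ⟨⟨.refl _⟩, fun t' w hg => ?_⟩
      obtain rfl := t'.unique hM (.refl _)
      exact (d.mk_comp _).trans (hg.comp (Rel.refl _)).mk_eq.symm
  | refl a =>
    refine ⟨⟨.refl _⟩, fun t' w hg => ?_⟩
    obtain rfl := t'.unique hM (.refl _)
    exact (hg.comp (Rel.refl _)).mk_eq.symm
  | symm a a' _ ih =>
    obtain ⟨⟨t⟩, ih⟩ := ih
    exact ⟨⟨t.symm⟩, fun t' w hg => (ih t'.symm w.symm hg.symm).symm⟩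
  | trans a a' a'' _ _ ih ih' =>
    obtain ⟨⟨t⟩, ih⟩ := ih
    obtain ⟨⟨t'⟩, ih'⟩ := ih'
    refine ⟨⟨t'.trans t⟩, fun {R R' g g'} u w hg => ?_⟩
    obtain ⟨g₁, h1, -⟩ := Rel.exists_of_iso g (.refl R) t
    exact (ih t _ h1).trans (ih' _ _ (hg.trans h1.symm))

/-- The class of a composite depends only on the classes of the two morphisms. The sources and
targets of representatives need not agree, so this needs the uniqueness of the isomorphism between
the two middle objects. -/
theorem comp_congr (hM : M.SigmaFree) {f : RepHom P Q} {g : RepHom Q R} {f' : RepHom P' Q'}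
    {g' : RepHom Q' R'} (hf : f.mor = f'.mor) (hg : g.mor = g'.mor) :
    (f.comp g).mor = (f'.comp g').mor := by
  obtain ⟨⟨t⟩, h⟩ := comp_congr_left hM hf
  obtain ⟨g₁, h1, h2⟩ := Rel.exists_of_iso g t (.refl R)
  refine (h t (.refl R) h1).trans ?_
  exact (comp_congr_right hM (h2.trans hg)).2 (.refl _) (.refl _) (.refl f')

end RepHom

/-- A function on families which is invariant under the change of one member along `r` is invariant
under the change of all members along the equivalence relation generated by `r`. -/
theorem eq_of_forall_quot_eq {A B : Type*} {r : A → A → Prop} {n : ℕ} (G : (Fin n → A) → B)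
    (hG : ∀ (F : Fin n → A) (i : Fin n) (b : A), r (F i) b → G F = G (Function.update F i b))
    {F F' : Fin n → A} (h : ∀ i, Quot.mk r (F i) = Quot.mk r (F' i)) : G F = G F' := by
  have h1 : ∀ a b, Relation.EqvGen r a b → ∀ (F : Fin n → A) (i : Fin n),
      G (Function.update F i a) = G (Function.update F i b) := by
    intro a b hab F i
    induction hab with
    | rel a b h => simpa using hG (Function.update F i a) i b (by simpa using h)
    | refl a => rfl
    | symm a b _ ih => exact ih.symm
    | trans a b c _ _ ih ih' => exact ih.trans ih'
  have h2 : ∀ s : Finset (Fin n), G (s.piecewise F' F) = G F := by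
    intro s
    induction s using Finset.induction_on with
    | empty => simp
    | insert i s hi ih =>
      rw [Finset.piecewise_insert, ← h1 _ _ (Quot.eqvGen_exact (h i)), ← ih]
      have : s.piecewise F' F i = F i := by simp [hi]
      rw [← this, Function.update_eq_self]
  simpa using (h2 Finset.univ).symm

/-- The class of the value of an operation on morphisms depends only on their classes. The moves of
the separate arguments are made one at a time. -/
theorem RepHom.act_congr {n : ℕ} {B B' : M.Op n} (β : B ⟶ B') {Y Z Y' Z' : Fin n → Rep X}
    {f : ∀ i, RepHom (Y i) (Z i)} {f' : ∀ i, RepHom (Y' i) (Z' i)}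
    (h : ∀ i, (f i).mor = (f' i).mor) : (act β f).mor = (act β f').mor := by
  refine eq_of_forall_quot_eq (r := MorRel X)
    (fun F : Fin n → Arrow X => (act β fun i => (F i).hom).mor) (fun F i b hb => ?_)
    (F := fun i => ⟨Y i, Z i, f i⟩) (F' := fun i => ⟨Y' i, Z' i, f' i⟩) h
  have hr : ∀ {p : Arrow X → Arrow X → Prop}, (∀ a, p a a) → p (F i) b →
      ∀ j, p (F j) (Function.update F i b j) := by
    intro p hp h j
    by_cases hj : j = i
    · subst hj; simpa using h
    · simpa [hj] using hp _
  obtain h | h := hb.cases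
  · choose s t h using hr Arrow.Perm.refl h
    have := Rel.act (π := Equiv.refl _) (CatOperad.IsPerm.refl (M := M.arr) (M.toArr β))
      (s := s) (t := t) (f := fun i => (F i).hom) (f' := fun j => (Function.update F i b j).hom) h
    exact this.mk_eq.symm
  · choose d h1 h2 using hr Arrow.IsDecomp.refl h
    rw [show (Function.update F i b) = _ from funext h2, show F = _ from funext h1]
    exact Decomp.act_mk β d

end CatOp

/-! ### Operations on the homotopy colimit -/

namespace CatOp

variable {M : CatOperad.{u}} {L : Type u} [SmallCategory L]

open Bicategory

variable {X : L ⥤ LaxAlg M}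

namespace HocolimHom

/-- Morphisms with the same underlying class are equal, up to the equality of their sources and
targets. -/
theorem heq_of_val {U V U' V' : HocolimObj X} {u : HocolimHom U V} {u' : HocolimHom U' V'}
    (hU : U = U') (hV : V = V') (h : u.val = u'.val) : HEq u u' := by
  subst hU hV
  exact heq_of_eq (Subtype.ext h)

theorem exists_rep {U V : HocolimObj X} (u : HocolimHom U V) :
    ∃ (P Q : Rep X) (f : RepHom P Q), P.cls = U ∧ Q.cls = V ∧ f.mor = u.val := by
  obtain ⟨⟨P, Q, f⟩, h1, h2⟩ := u
  exact ⟨P, Q, f, h1, h2, rfl⟩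

/-- The source of a representative may be prescribed. -/
theorem exists_rep_of_src {P : Rep X} {V : HocolimObj X} (u : HocolimHom P.cls V) :
    ∃ (Q : Rep X) (f : RepHom P Q), Q.cls = V ∧ f.mor = u.val := by
  obtain ⟨P', Q, f, h1, rfl, h2⟩ := u.exists_rep
  obtain ⟨s⟩ := Rep.exists_iso_of_cls_eq h1.symm
  obtain ⟨f', -, h3⟩ := RepHom.Rel.exists_of_iso f s (.refl Q)
  exact ⟨Q, f', rfl, h3.trans h2⟩

theorem exists_rep₂ {U V W : HocolimObj X} (u : HocolimHom U V) (v : HocolimHom V W) :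
    ∃ (P Q R : Rep X) (f : RepHom P Q) (g : RepHom Q R), P.cls = U ∧ Q.cls = V ∧ R.cls = W ∧
      f.mor = u.val ∧ g.mor = v.val := by
  obtain ⟨P, Q, f, rfl, rfl, h⟩ := u.exists_rep
  obtain ⟨R, g, rfl, h'⟩ := v.exists_rep_of_src
  exact ⟨P, Q, R, f, g, rfl, rfl, rfl, h, h'⟩

theorem eq_cls {P Q : Rep X} {f : RepHom P Q} {u : HocolimHom P.cls Q.cls} (h : f.mor = u.val) :
    u = f.cls :=
  Subtype.ext h.symm

theorem mor_congr {U U' V V' : HocolimObj X} {u : HocolimHom U V} {u' : HocolimHom U' V'}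
    (hU : U = U') (hV : V = V') (h : HEq u u') : u.val = u'.val := by
  subst hU hV
  obtain rfl := eq_of_heq h
  rfl

end HocolimHom

namespace HocolimObj

theorem out_cls (U : HocolimObj X) : Rep.cls (Quot.out U) = U := Quot.out_eq U

/-- The identity of a class, represented by identities. -/
noncomputable def id (U : HocolimObj X) : HocolimHom U U :=
  ⟨(RepHom.id (Quot.out U)).mor, out_cls U, out_cls U⟩

theorem exists_comp {U V W : HocolimObj X} (u : HocolimHom U V) (v : HocolimHom V W) :
    ∃ w : HocolimHom U W, ∃ (P Q R : Rep X) (f : RepHom P Q) (g : RepHom Q R),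
      f.mor = u.val ∧ g.mor = v.val ∧ w.val = (f.comp g).mor := by
  obtain ⟨P, Q, R, f, g, rfl, rfl, rfl, h, h'⟩ := HocolimHom.exists_rep₂ u v
  exact ⟨(f.comp g).cls, P, Q, R, f, g, h, h', rfl⟩

/-- The composite of two classes, represented by composites of composable representatives. -/
noncomputable def comp {U V W : HocolimObj X} (u : HocolimHom U V) (v : HocolimHom V W) :
    HocolimHom U W :=
  (exists_comp u v).choose

/-- The action of the operad on classes of objects. -/
noncomputable def act {n : ℕ} (B : M.Op n) (U : Fin n → HocolimObj X) : HocolimObj X :=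
  (Rep.act B fun i => Quot.out (U i)).cls

theorem act_cls {n : ℕ} (B : M.Op n) (Y : Fin n → Rep X) :
    act B (fun i => (Y i).cls) = (Rep.act B Y).cls := by
  have h := fun i => Rep.exists_iso_of_cls_eq (out_cls (Y i).cls)
  exact (Rep.Iso.act (π := Equiv.refl _) (.refl B) fun i => (h i).some).cls_eq

theorem exists_actMap {n : ℕ} {B B' : M.Op n} {U V : Fin n → HocolimObj X} (β : B ⟶ B')
    (u : ∀ i, HocolimHom (U i) (V i)) :
    ∃ w : HocolimHom (act B U) (act B' V), ∃ (Y Y' : Fin n → Rep X)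
      (f : ∀ i, RepHom (Y i) (Y' i)), (∀ i, (f i).mor = (u i).val) ∧
        w.val = (RepHom.act β f).mor := by
  choose Y Y' f h1 h2 h3 using fun i => (u i).exists_rep
  obtain rfl := funext h1
  obtain rfl := funext h2
  exact ⟨⟨(RepHom.act β f).mor, (act_cls B Y).symm, (act_cls B' Y').symm⟩, Y, Y', f, h3, rfl⟩

/-- The action of the operad on classes of morphisms. -/
noncomputable def actMap {n : ℕ} {B B' : M.Op n} {U V : Fin n → HocolimObj X} (β : B ⟶ B')
    (u : ∀ i, HocolimHom (U i) (V i)) : HocolimHom (act B U) (act B' V) :=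
  (exists_actMap β u).choose

theorem id_cls (P : Rep X) : id P.cls = (RepHom.id P).cls := by
  obtain ⟨s⟩ := Rep.exists_iso_of_cls_eq (out_cls P.cls)
  exact Subtype.ext (RepHom.id_rel s).mk_eq

/-- A composite is represented by the composite of any composable representatives. -/
theorem comp_val (hM : M.SigmaFree) {U V W : HocolimObj X} {u : HocolimHom U V}
    {v : HocolimHom V W} {P Q R : Rep X} {f : RepHom P Q} {g : RepHom Q R} (hf : f.mor = u.val)
    (hg : g.mor = v.val) : (comp u v).val = (f.comp g).mor := by
  obtain ⟨P', Q', R', f', g', h1, h2, h3⟩ := (exists_comp u v).choose_spec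
  exact h3.trans (RepHom.comp_congr hM (h1.trans hf.symm) (h2.trans hg.symm))

/-- The action is represented by the action on any representatives. -/
theorem actMap_val {n : ℕ} {B B' : M.Op n} {U V : Fin n → HocolimObj X} (β : B ⟶ B')
    {u : ∀ i, HocolimHom (U i) (V i)} {Y Y' : Fin n → Rep X} {f : ∀ i, RepHom (Y i) (Y' i)}
    (hf : ∀ i, (f i).mor = (u i).val) : (actMap β u).val = (RepHom.act β f).mor := by
  obtain ⟨Z, Z', f', h1, h2⟩ := (exists_actMap β u).choose_spec
  exact h2.trans (RepHom.act_congr β fun i => (h1 i).trans (hf i).symm)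

end HocolimObj

end CatOp

/-! ### The homotopy colimit as an algebra -/

namespace CatOp

variable {M : CatOperad.{u}} {L : Type u} [SmallCategory L]

open Bicategory

variable {X : L ⥤ LaxAlg M}

namespace HocolimObj

theorem comp_cls (hM : M.SigmaFree) {P Q R : Rep X} (f : RepHom P Q) (g : RepHom Q R) :
    comp f.cls g.cls = (f.comp g).cls :=
  Subtype.ext (comp_val hM rfl rfl)

theorem actMap_cls {n : ℕ} {B B' : M.Op n} {Y Y' : Fin n → Rep X} (β : B ⟶ B')
    (f : ∀ i, RepHom (Y i) (Y' i)) :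
    (actMap β fun i => (f i).cls).val = (RepHom.act β f).mor :=
  actMap_val β fun _ => rfl

theorem exists_reps {n : ℕ} (U : Fin n → HocolimObj X) : ∃ Y : Fin n → Rep X,
    U = fun i => (Y i).cls :=
  ⟨fun i => Quot.out (U i), funext fun i => (out_cls (U i)).symm⟩

theorem one_act (U : Fin 1 → HocolimObj X) : act M.one U = U 0 := by
  obtain ⟨Y, rfl⟩ := exists_reps U
  rw [act_cls]
  exact (Rep.oneIso Y).cls_eq.symm

theorem comp_act {n m : ℕ} (r : Fin n → ℕ) (h : ∑ i, r i = m) (A : M.Op n) (C : ∀ i, M.Op (r i))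
    (U : Fin m → HocolimObj X) :
    act (M.comp r h A C) U = act A (fun i => act (C i) (fun j => U (lex r h ⟨i, j⟩))) := by
  obtain ⟨Y, rfl⟩ := exists_reps U
  simp only [act_cls]
  exact (Rep.compIso r h A C Y).cls_eq

theorem perm_act {n : ℕ} (σ : Equiv.Perm (Fin n)) (A : M.Op n) (U : Fin n → HocolimObj X) :
    act ((M.perm σ).obj A) U = act A (fun i => U (σ.symm i)) := by
  obtain ⟨Y, rfl⟩ := exists_reps U
  simp only [act_cls]
  exact (Rep.Iso.act (CatOperad.IsPerm.mk σ A).symm fun i => .refl (Y (σ.symm i))).cls_eq.symm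

end HocolimObj

open HocolimObj in
/-- The structure of an `M`-algebra on the homotopy colimit. -/
noncomputable def hocolimOps (hM : M.SigmaFree) (X : L ⥤ LaxAlg M) : HocolimOps X where
  id := id
  comp := comp
  act := act
  actMap := actMap
  id_cls := id_cls
  comp_cls := comp_cls hM
  act_cls := act_cls
  actMap_cls := actMap_cls
  id_comp u := by
    obtain ⟨P, Q, f, rfl, rfl, h⟩ := u.exists_rep
    obtain rfl := HocolimHom.eq_cls h
    rw [id_cls, comp_cls hM]
    exact Subtype.ext (RepHom.id_comp_rel f).mk_eq.symm
  comp_id u := by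
    obtain ⟨P, Q, f, rfl, rfl, h⟩ := u.exists_rep
    obtain rfl := HocolimHom.eq_cls h
    rw [id_cls, comp_cls hM]
    exact Subtype.ext (RepHom.comp_id_rel f).mk_eq.symm
  assoc u v w := by
    obtain ⟨P, Q, R, f, g, rfl, rfl, rfl, hf, hg⟩ := HocolimHom.exists_rep₂ u v
    obtain ⟨T, k, rfl, hk⟩ := w.exists_rep_of_src
    obtain rfl := HocolimHom.eq_cls hf
    obtain rfl := HocolimHom.eq_cls hg
    obtain rfl := HocolimHom.eq_cls hk
    rw [comp_cls hM, comp_cls hM, comp_cls hM, comp_cls hM]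
    exact Subtype.ext (RepHom.assoc_rel f g k).mk_eq.symm
  actMap_id B U := by
    obtain ⟨Y, rfl⟩ := exists_reps U
    refine Subtype.ext ((actMap_val (f := fun i => RepHom.id (Y i)) _ fun i =>
      congrArg Subtype.val (id_cls (Y i)).symm).trans ?_)
    refine (RepHom.act_id_rel B Y).mk_eq.trans ?_
    refine (congrArg Subtype.val (id_cls (Rep.act B Y))).symm.trans ?_
    exact (congrArg (fun W : HocolimObj X => W.id.val) (act_cls B Y)).symm
  actMap_comp {n B B' B'' U V W} β β' u v := by
    choose P Q R f g hU hV hW hf hg using fun i => HocolimHom.exists_rep₂ (u i) (v i)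
    obtain rfl := funext hU
    obtain rfl := funext hV
    obtain rfl := funext hW
    refine Subtype.ext ?_
    rw [actMap_val (f := fun i => (f i).comp (g i)) _ fun i => (comp_val hM (hf i) (hg i)).symm]
    refine Eq.trans ?_ (comp_val hM (actMap_val β hf).symm (actMap_val β' hg).symm).symm
    exact (RepHom.act_comp_rel β β' f g).mk_eq
  one_act := one_act
  one_actMap {U V} u := by
    choose P Q f hU hV hf using fun i => (u i).exists_rep
    refine HocolimHom.heq_of_val (one_act U) (one_act V) ?_
    rw [actMap_val _ hf, ← hf]
    exact (RepHom.one_act_rel f).mk_eq.symm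
  comp_act := comp_act
  comp_actMap r h A A' C C' U V α c u := by
    choose P Q f hU hV hf using fun i => (u i).exists_rep
    refine HocolimHom.heq_of_val (comp_act r h A C U) (comp_act r h A' C' V) ?_
    rw [actMap_val _ hf, actMap_val α fun i => (actMap_val (c i) fun j => hf _).symm]
    exact (RepHom.comp_act_rel r h α c f).mk_eq
  perm_act := perm_act
  perm_actMap σ A A' U V α u := by
    choose P Q f hU hV hf using fun i => (u i).exists_rep
    refine HocolimHom.heq_of_val (perm_act σ A U) (perm_act σ A' V) ?_
    rw [actMap_val _ hf, actMap_val α fun i => hf (σ.symm i)]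
    exact (RepHom.Rel.act (CatOperad.IsPerm.arr_map σ α).symm fun i =>
      RepHom.Rel.refl (f (σ.symm i))).mk_eq.symm

theorem HocolimOps.val_comp (ops : HocolimOps X) {U V W : HocolimObj X} {u : HocolimHom U V}
    {v : HocolimHom V W} {P Q R : Rep X} {f : RepHom P Q} {g : RepHom Q R} (hU : P.cls = U)
    (hV : Q.cls = V) (hW : R.cls = W) (hf : f.mor = u.val) (hg : g.mor = v.val) :
    (ops.comp u v).val = (f.comp g).mor := by
  subst hU hV hW
  obtain rfl := HocolimHom.eq_cls hf
  obtain rfl := HocolimHom.eq_cls hg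
  rw [ops.comp_cls]
  rfl

/-- The operations on the homotopy colimit are determined by the representatives. -/
theorem HocolimOps.eq (ops ops' : HocolimOps X) : ops' = ops := by
  have h1 : @HocolimOps.id _ _ _ _ ops' = @HocolimOps.id _ _ _ _ ops := by
    funext U
    obtain ⟨P, rfl⟩ := Quot.exists_rep U
    exact (ops'.id_cls P).trans (ops.id_cls P).symm
  have h2 : @HocolimOps.comp _ _ _ _ ops' = @HocolimOps.comp _ _ _ _ ops := by
    funext U V W u v
    obtain ⟨P, Q, R, f, g, rfl, rfl, rfl, hf, hg⟩ := HocolimHom.exists_rep₂ u v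
    obtain rfl := HocolimHom.eq_cls hf
    obtain rfl := HocolimHom.eq_cls hg
    exact (ops'.comp_cls f g).trans (ops.comp_cls f g).symm
  have h3 : @HocolimOps.act _ _ _ _ ops' = @HocolimOps.act _ _ _ _ ops := by
    funext n B U
    obtain ⟨Y, rfl⟩ := HocolimObj.exists_reps U
    exact (ops'.act_cls B Y).trans (ops.act_cls B Y).symm
  have h4 : ∀ {n : ℕ} {B B' : M.Op n} {U V : Fin n → HocolimObj X} (β : B ⟶ B')
      (u : ∀ i, HocolimHom (U i) (V i)), (ops'.actMap β u).val = (ops.actMap β u).val := by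
    intro n B B' U V β u
    choose P Q f hU hV hf using fun i => (u i).exists_rep
    obtain rfl := funext hU
    obtain rfl := funext hV
    obtain rfl : u = fun i => (f i).cls := funext fun i => HocolimHom.eq_cls (hf i)
    exact (ops'.actMap_cls β f).trans (ops.actMap_cls β f).symm
  obtain ⟨id, comp, act, actMap⟩ := ops
  obtain ⟨id', comp', act', actMap'⟩ := ops'
  dsimp only at h1 h2 h3 h4
  obtain rfl : @id' = @id := h1
  obtain rfl : @comp' = @comp := h2
  obtain rfl : @act' = @act := h3
  obtain rfl : @actMap' = @actMap := by
    funext n B B' U V β u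
    exact Subtype.ext (h4 β u)
  rfl

end CatOp

/-! ### Evaluations of nodes and lax cocones -/

namespace CatOp

variable {M : CatOperad.{u}} {L : Type u} [SmallCategory L]

open Bicategory

/-- An evaluation of the nodes over `X` in an `M`-algebra `S`: it assigns objects of `S` to the
labels, and a morphism `C (κ (src 1), …, κ (src r)) ⟶ κ tgt` to each node, compatibly with the
composition of nodes, with morphisms of operations and with permutations of the inputs. These are
the homotopy morphisms from `X` to the constant diagram on `S` in another guise. -/
structure NodeEval (X : L ⥤ LaxAlg M) (S : Alg M) where
  κ : Lab X → S.carrier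
  ev : ∀ {r : ℕ} {C : M.Op r} {src : Fin r → Lab X} {tgt : Lab X}, Node X C src tgt →
    (S.act C (fun j => κ (src j)) ⟶ κ tgt)
  ev_id : ∀ x : Lab X, HEq (ev (Node.id x)) (𝟙 (κ x))
  ev_comp : ∀ {s : ℕ} {r : Fin s → ℕ} {D : M.Op s} {C : ∀ j, M.Op (r j)}
    {src : ∀ j, Fin (r j) → Lab X} {mid : Fin s → Lab X} {tgt : Lab X}
    (b : ∀ j, Node X (C j) (src j) (mid j)) (a : Node X D mid tgt),
    HEq (ev (Node.comp b a)) (S.actMap (𝟙 D) (fun j => ev (b j)) ≫ ev a)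
  ev_precomp : ∀ {r : ℕ} {D C : M.Op r} {src : Fin r → Lab X} {tgt : Lab X} (α : D ⟶ C)
    (a : Node X C src tgt), ev (a.precomp α) = S.actMap α (fun j => 𝟙 (κ (src j))) ≫ ev a
  ev_perm : ∀ {r : ℕ} {C : M.Op r} {src : Fin r → Lab X} {tgt : Lab X} (a : Node X C src tgt)
    (ρ : Equiv.Perm (Fin r)), HEq (ev (a.perm ρ)) (ev a)

variable {X : L ⥤ LaxAlg M} {S : Alg M}

theorem NodeEval.ev_rel (E : NodeEval X S) {r r' : ℕ} {C' : M.Op r'} {C : M.Op r}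
    {src' : Fin r' → Lab X} {src : Fin r → Lab X} {tgt' tgt : Lab X} {ρ : Fin r' ≃ Fin r}
    {a' : Node X C' src' tgt'} {a : Node X C src tgt} (h : Node.Rel ρ a' a) :
    HEq (E.ev a') (E.ev a) :=
  h.elim (motive := fun _ a' => HEq (E.ev a') (E.ev a)) fun ρ => E.ev_perm a ρ

/-- A homotopy morphism from `X` to the constant diagram on `S`, with the constant diagram removed
from the types. -/
structure LaxCocone (X : L ⥤ LaxAlg M) (S : Alg M) where
  app : ∀ l : L, LaxHom (X.obj l).alg S
  θ : ∀ {l l' : L} (a : l ⟶ l') (x : (X.obj l).alg.carrier),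
    (app l).functor.obj x ⟶ (app l').functor.obj ((X.map a).functor.obj x)
  θ_naturality : ∀ {l l' : L} (a : l ⟶ l') {x y : (X.obj l).alg.carrier} (f : x ⟶ y),
    (app l).functor.map f ≫ θ a y = θ a x ≫ (app l').functor.map ((X.map a).functor.map f)
  θ_lax : ∀ {l l' : L} (a : l ⟶ l') {n : ℕ} (A : M.Op n) (x : Fin n → (X.obj l).alg.carrier),
    S.actMap (𝟙 A) (fun i => θ a (x i)) ≫ (app l').lax A (fun i => (X.map a).functor.obj (x i)) ≫
      (app l').functor.map ((X.map a).lax A x) = (app l).lax A x ≫ θ a ((X.obj l).alg.act A x)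
  θ_id : ∀ (l : L) (x : (X.obj l).alg.carrier), HEq (θ (𝟙 l) x) (𝟙 ((app l).functor.obj x))
  θ_comp : ∀ {l l' l'' : L} (a : l ⟶ l') (b : l' ⟶ l'') (x : (X.obj l).alg.carrier),
    HEq (θ (a ≫ b) x) (θ a x ≫ θ b ((X.map a).functor.obj x))

/-- The lax cocone of a homotopy morphism to a constant diagram. -/
def HMor.toLaxCocone (k : HMor X (constObj L S)) : LaxCocone X S where
  app := k.app
  θ a x := (k.nat a).nat.app x
  θ_naturality a _ _ f := (k.nat a).nat.naturality f
  θ_lax a _ A x := ((k.nat a).nat_lax A x).trans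
    (congrArg (fun z => z ≫ (k.nat a).nat.app _) (Category.id_comp _))
  θ_id := k.nat_id
  θ_comp := k.nat_comp

/-- The homotopy morphism to a constant diagram given by a lax cocone. -/
def LaxCocone.toHMor (k : LaxCocone X S) : HMor X (constObj L S) where
  app := k.app
  nat a :=
    { nat := { app := k.θ a, naturality := fun _ _ f => k.θ_naturality a f }
      nat_lax := fun A x => (k.θ_lax a A x).trans
        (congrArg (fun z => z ≫ k.θ a _) (Category.id_comp _).symm) }
  nat_id := k.θ_id
  nat_comp := k.θ_comp

namespace LaxCocone

variable (k : LaxCocone X S)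

theorem θ_congr {l l' : L} {x y : Lab X} (hl : l = l') (h : x = y) {f : x.1 ⟶ l} {g : y.1 ⟶ l'}
    (hf : HEq f g) : HEq (k.θ f x.2) (k.θ g y.2) := by
  subst h hl
  obtain rfl := eq_of_heq hf
  rfl

theorem _root_.CatOp.Node.obj_congr {l : L} {x y : Lab X} (h : x = y) {f : x.1 ⟶ l} {g : y.1 ⟶ l}
    (hf : HEq f g) : (X.map f).functor.obj x.2 = (X.map g).functor.obj y.2 := by
  subst h
  obtain rfl := eq_of_heq hf
  rfl

/-- The value of a lax cocone on a node. -/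
def ev {r : ℕ} {C : M.Op r} {src : Fin r → Lab X} {tgt : Lab X} (a : Node X C src tgt) :
    S.act C (fun j => (k.app (src j).1).functor.obj (src j).2) ⟶ (k.app tgt.1).functor.obj tgt.2 :=
  S.actMap (𝟙 C) (fun j => k.θ (a.lam j) (src j).2) ≫ (k.app tgt.1).lax C _ ≫
    (k.app tgt.1).functor.map a.map

/-- The compatibility of the 2-cells `θ` with the lax structures moves `θ ρ` past the value on a
node, which is then pushed along `X ρ`. -/
theorem ev_θ {r : ℕ} {C : M.Op r} {src : Fin r → Lab X} {tgt : Lab X} (a : Node X C src tgt)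
    {l : L} (ρ : tgt.1 ⟶ l) : k.ev a ≫ k.θ ρ tgt.2 =
      S.actMap (𝟙 C) (fun j => k.θ (a.lam j) (src j).2 ≫ k.θ ρ _) ≫ (k.app l).lax C _ ≫
        (k.app l).functor.map (a.push ρ) := by
  have h := k.θ_lax ρ C (fun j => (X.map (a.lam j)).functor.obj (src j).2)
  rw [ev, S.actMap_id_comp, Category.assoc, Category.assoc, Category.assoc, k.θ_naturality,
    ← Category.assoc ((k.app tgt.1).lax C _), ← h, Node.push, Functor.map_comp]
  simp only [Category.assoc]

/-- The value of a lax cocone on a composite of nodes. The structure morphisms of `k` at the lower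
level are moved past those at the upper level by `ev_θ`. -/
theorem ev_comp {s : ℕ} {r : Fin s → ℕ} {D : M.Op s} {C : ∀ j, M.Op (r j)}
    {src : ∀ j, Fin (r j) → Lab X} {mid : Fin s → Lab X} {tgt : Lab X}
    (b : ∀ j, Node X (C j) (src j) (mid j)) (a : Node X D mid tgt) :
    HEq (k.ev (Node.comp b a)) (S.actMap (𝟙 D) (fun j => k.ev (b j)) ≫ k.ev a) := by
  have hx : ∀ j i, (X.map ((Node.comp b a).lam (lex r rfl ⟨j, i⟩))).functor.obj
      (src ((lex r rfl).symm (lex r rfl ⟨j, i⟩)).1 ((lex r rfl).symm (lex r rfl ⟨j, i⟩)).2).2 =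
      (X.map (a.lam j)).functor.obj ((X.map ((b j).lam i)).functor.obj (src j i).2) := fun j i =>
    (Node.obj_congr (Node.comp_src src j i) (Node.comp_lam b a j i)).trans
      (HMor.map_comp_obj X _ _ _)
  have hκ : ∀ j i, (k.app (src ((lex r rfl).symm (lex r rfl ⟨j, i⟩)).1
      ((lex r rfl).symm (lex r rfl ⟨j, i⟩)).2).1).functor.obj
      (src ((lex r rfl).symm (lex r rfl ⟨j, i⟩)).1 ((lex r rfl).symm (lex r rfl ⟨j, i⟩)).2).2 =
      (k.app (src j i).1).functor.obj (src j i).2 := fun j i =>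
    congrArg (fun x : Lab X => (k.app x.1).functor.obj x.2) (Node.comp_src src j i)
  have hy : ∀ j i, (k.app tgt.1).functor.obj _ = (k.app tgt.1).functor.obj _ := fun j i =>
    congrArg (k.app tgt.1).functor.obj (hx j i)
  -- The value on the composite node has three factors: 2-cells, lax structure, image of the
  -- morphism of the node. Each of them is split into two levels.
  have e1 : HEq (S.actMap (𝟙 (M.comp r rfl D C)) (fun l => k.θ ((Node.comp b a).lam l)
        (src ((lex r rfl).symm l).1 ((lex r rfl).symm l).2).2))
      (S.actMap (𝟙 D) fun j => S.actMap (𝟙 (C j)) fun i =>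
        k.θ ((b j).lam i) (src j i).2 ≫ k.θ (a.lam j) _) := by
    have h1 := S.comp_actMap r rfl (𝟙 D) (fun j => 𝟙 (C j))
      (fun l => k.θ ((Node.comp b a).lam l)
        (src ((lex r rfl).symm l).1 ((lex r rfl).symm l).2).2)
    rw [M.compMap_id] at h1
    refine h1.trans (S.actMap_heq rfl rfl (fun j => congrArg _ (funext (hκ j)))
      (fun j => congrArg _ (funext (hy j))) HEq.rfl fun j =>
        S.actMap_heq rfl rfl (hκ j) (hy j) HEq.rfl fun i => ?_)
    exact (k.θ_congr rfl (Node.comp_src src j i) (Node.comp_lam b a j i)).trans (k.θ_comp _ _ _)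
  have e2 : HEq ((k.app tgt.1).lax (M.comp r rfl D C) fun l =>
        (X.map ((Node.comp b a).lam l)).functor.obj
          (src ((lex r rfl).symm l).1 ((lex r rfl).symm l).2).2)
      (S.actMap (𝟙 D) (fun j => (k.app tgt.1).lax (C j) fun i => (X.map (a.lam j)).functor.obj
        ((X.map ((b j).lam i)).functor.obj (src j i).2)) ≫ (k.app tgt.1).lax D _) := by
    refine ((k.app tgt.1).lax_comp r rfl D C _).trans (heq_comp
      (congrArg _ (funext fun j => congrArg _ (funext (hy j))))
      (congrArg _ (funext fun j => congrArg _ (congrArg _ (funext (hx j)))))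
      (congrArg _ (congrArg _ (funext fun j => congrArg _ (funext (hx j)))))
      (S.actMap_heq rfl rfl (fun j => congrArg _ (funext (hy j)))
        (fun j => congrArg _ (congrArg _ (funext (hx j)))) HEq.rfl
        fun j => (k.app tgt.1).lax_heq _ (hx j)) ((k.app tgt.1).lax_heq _ fun j => ?_))
    exact congrArg _ (funext (hx j))
  have hm := Node.comp_aux (D := D) (C := C) (fun j => (b j).lam) a.lam
  have e3 := map_heq (k.app tgt.1).functor hm rfl (Node.comp_map_heq b a)
  have ho : S.act (M.comp r rfl D C) (fun l => (k.app (src ((lex r rfl).symm l).1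
      ((lex r rfl).symm l).2).1).functor.obj (src ((lex r rfl).symm l).1
        ((lex r rfl).symm l).2).2) = S.act D fun j => S.act (C j) fun i =>
      (k.app (src j i).1).functor.obj (src j i).2 := by
    rw [S.comp_act]
    exact congrArg _ (funext fun j => congrArg _ (funext (hκ j)))
  have ho' : S.act (M.comp r rfl D C) (fun l => (k.app tgt.1).functor.obj
      ((X.map ((Node.comp b a).lam l)).functor.obj
        (src ((lex r rfl).symm l).1 ((lex r rfl).symm l).2).2)) = S.act D fun j =>
        S.act (C j) fun i => (k.app tgt.1).functor.obj ((X.map (a.lam j)).functor.obj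
        ((X.map ((b j).lam i)).functor.obj (src j i).2)) := by
    rw [S.comp_act]
    exact congrArg _ (funext fun j => congrArg _ (funext (hy j)))
  refine (heq_comp ho ho' rfl e1 (heq_comp ho' (congrArg _ hm) rfl e2 e3)).trans (heq_of_eq ?_)
  have h4 := (k.app tgt.1).lax_natural (𝟙 D) fun j => (b j).push (a.lam j)
  rw [Functor.map_comp, Category.assoc, ← Category.assoc ((k.app tgt.1).lax D _), h4]
  rw [ev, ← Category.assoc (S.actMap (𝟙 D) fun j => k.ev (b j)), ← S.actMap_id_comp]
  simp only [ev_θ, S.actMap_id_comp D, Category.assoc]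

/-- The evaluation of nodes given by a lax cocone. -/
def toNodeEval : NodeEval X S where
  κ x := (k.app x.1).functor.obj x.2
  ev a := k.ev a
  ev_id x := by
    have h := HMor.map_id_obj X x.1 x.2
    have h2 : (X.obj x.1).alg.act M.one (fun _ => (X.map (𝟙 x.1)).functor.obj x.2) = x.2 :=
      ((X.obj x.1).alg.one_act _).trans h
    have h' : S.act M.one (fun _ => (k.app x.1).functor.obj x.2) = (k.app x.1).functor.obj x.2 :=
      S.one_act _
    have e1 : HEq (S.actMap (𝟙 M.one) fun _ => k.θ (𝟙 x.1) x.2)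
        (𝟙 ((k.app x.1).functor.obj x.2)) := (S.one_actMap _).trans (k.θ_id x.1 x.2)
    have e2 : HEq ((k.app x.1).lax M.one fun _ => (X.map (𝟙 x.1)).functor.obj x.2)
        (𝟙 ((k.app x.1).functor.obj x.2)) :=
      ((k.app x.1).lax_one _).trans (id_heq (congrArg _ h))
    have e3 : HEq ((k.app x.1).functor.map (Node.id x).map) (𝟙 ((k.app x.1).functor.obj x.2)) := by
      rw [← CategoryTheory.Functor.map_id]
      exact map_heq _ h2 rfl (eqToHom_heq_id h2)
    refine (heq_comp h' ((S.one_act _).trans (congrArg (k.app x.1).functor.obj h)) rfl e1 (heq_comp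
      ((S.one_act _).trans (congrArg (k.app x.1).functor.obj h))
      (congrArg (k.app x.1).functor.obj h2) rfl e2 e3)).trans (heq_of_eq ?_)
    simp
  ev_comp b a := k.ev_comp b a
  ev_precomp {r D C src tgt} α a := by
    have h1 := (k.app tgt.1).lax_natural α fun j => 𝟙 ((X.map (a.lam j)).functor.obj (src j).2)
    have h2 := S.actMap_comp (𝟙 D) α (fun j => k.θ (a.lam j) (src j).2) fun j => 𝟙 _
    have h3 := S.actMap_comp α (𝟙 C) (fun j => 𝟙 _) (fun j => k.θ (a.lam j) (src j).2)
    simp only [Category.id_comp, Category.comp_id] at h2 h3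
    simp only [CategoryTheory.Functor.map_id] at h1
    have h4 := (k.app tgt.1).functor.map_comp ((X.obj tgt.1).alg.actMap α fun j =>
      𝟙 ((X.map (a.lam j)).functor.obj (src j).2)) a.map
    refine (congrArg (fun z => S.actMap (𝟙 D) (fun j => k.θ (a.lam j) (src j).2) ≫
      (k.app tgt.1).lax D _ ≫ z) h4).trans ?_
    rw [← Category.assoc ((k.app tgt.1).lax D _), h1, Category.assoc, ← Category.assoc, ← h2, h3,
      Category.assoc]
    rfl
  ev_perm {r C src tgt} a ρ := by
    have e := Node.perm_aux C src tgt a.lam ρ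
    have h := CatOperad.IsPerm.mk ρ C
    exact heq_comp (S.act_isPerm h fun _ => rfl) (S.act_isPerm h fun _ => rfl) rfl
      (S.actMap_id_isPerm h (fun _ => rfl) (fun _ => rfl) fun _ => HEq.rfl)
      (heq_comp (S.act_isPerm h fun _ => rfl) (congrArg _ e) rfl
        ((k.app tgt.1).lax_isPerm h fun _ => rfl) (map_heq _ e rfl (eqToHom_comp_heq _ _)))

end LaxCocone

end CatOp

/-! ### From evaluations of nodes to lax cocones -/

namespace CatOp

variable {M : CatOperad.{u}} {L : Type u} [SmallCategory L]

open Bicategory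

variable {X : L ⥤ LaxAlg M} {S : Alg M}

namespace Node

/-- The unary node with the identity operation. -/
def unary {x y : Lab X} (a : x.1 ⟶ y.1) (f : (X.map a).functor.obj x.2 ⟶ y.2) :
    Node X M.one (fun _ => x) y where
  lam _ := a
  map := eqToHom ((X.obj y.1).alg.one_act _) ≫ f

/-- The node whose morphism is the identity of `C (K 1, …, K n)`. -/
def eval {l : L} {n : ℕ} (C : M.Op n) (K : Fin n → (X.obj l).alg.carrier) :
    Node X C (fun i => (⟨l, K i⟩ : Lab X)) ⟨l, (X.obj l).alg.act C K⟩ where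
  lam _ := 𝟙 l
  map := eqToHom (congrArg ((X.obj l).alg.act C) (funext fun i => HMor.map_id_obj X l (K i)))

theorem eval_map_heq {l : L} {n : ℕ} (C : M.Op n) (K : Fin n → (X.obj l).alg.carrier) :
    HEq (eval C K).map (𝟙 ((X.obj l).alg.act C K)) :=
  eqToHom_heq_id (congrArg ((X.obj l).alg.act C) (funext fun i => HMor.map_id_obj X l (K i)))

/-- A node followed by a unary node. -/
def andThen {r : ℕ} {C : M.Op r} {src : Fin r → Lab X} {tgt y : Lab X} (b : Node X C src tgt)
    (a : tgt.1 ⟶ y.1) (f : (X.map a).functor.obj tgt.2 ⟶ y.2) : Node X C src y where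
  lam j := b.lam j ≫ a
  map := eqToHom (congrArg _ (funext fun j => HMor.map_comp_obj X (b.lam j) a (src j).2)) ≫
    b.push a ≫ f

/-- A node followed by a morphism of its target. -/
def postcomp {r : ℕ} {C : M.Op r} {src : Fin r → Lab X} {l : L} {K K' : (X.obj l).alg.carrier}
    (b : Node X C src ⟨l, K⟩) (f : K ⟶ K') : Node X C src ⟨l, K'⟩ where
  lam := b.lam
  map := b.map ≫ f

theorem postcomp_eval_map_heq {l : L} {n : ℕ} (C : M.Op n) (K : Fin n → (X.obj l).alg.carrier)
    {K' : (X.obj l).alg.carrier} (f : (X.obj l).alg.act C K ⟶ K') :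
    HEq ((eval C K).postcomp f).map f :=
  eqToHom_comp_heq f (congrArg ((X.obj l).alg.act C) (funext fun i => HMor.map_id_obj X l (K i)))

/-- A node preceded by unary nodes. -/
def before {r : ℕ} {C : M.Op r} {src mid : Fin r → Lab X} {tgt : Lab X}
    (l : ∀ j, (src j).1 ⟶ (mid j).1) (f : ∀ j, (X.map (l j)).functor.obj (src j).2 ⟶ (mid j).2)
    (a : Node X C mid tgt) : Node X C src tgt where
  lam j := l j ≫ a.lam j
  map := eqToHom (congrArg _ (funext fun j => HMor.map_comp_obj X (l j) (a.lam j) (src j).2)) ≫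
    (X.obj tgt.1).alg.actMap (𝟙 C) (fun j => (X.map (a.lam j)).functor.map (f j)) ≫ a.map

theorem push_unary {x y : Lab X} (a : x.1 ⟶ y.1) (f : (X.map a).functor.obj x.2 ⟶ y.2) {l : L}
    (ρ : y.1 ⟶ l) : HEq ((unary a f).push ρ) ((X.map ρ).functor.map f) := by
  have h := (X.obj y.1).alg.one_act (fun _ => (X.map a).functor.obj x.2)
  refine (heq_comp ((X.obj l).alg.one_act _) (congrArg _ h) rfl ((X.map ρ).lax_one _)
    (map_heq (X.map ρ).functor h rfl (eqToHom_comp_heq f h))).trans ?_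
  exact heq_of_eq (Category.id_comp _)

theorem push_eval {l l' : L} {n : ℕ} (C : M.Op n) (K : Fin n → (X.obj l).alg.carrier)
    (ρ : l ⟶ l') : HEq ((eval C K).push ρ) ((X.map ρ).lax C K) := by
  have h := fun i => HMor.map_id_obj X l (K i)
  have h' := congrArg ((X.obj l).alg.act C) (funext h)
  refine (heq_comp (congrArg _ (funext fun i => congrArg _ (h i)))
    (congrArg (X.map ρ).functor.obj h') rfl ((X.map ρ).lax_heq C h)
    (map_heq (X.map ρ).functor h' rfl (eqToHom_heq_id h'))).trans ?_
  rw [CategoryTheory.Functor.map_id]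
  exact heq_of_eq (Category.comp_id _)

theorem before_eval {l : L} {n : ℕ} (A : M.Op n) {x x' : Fin n → (X.obj l).alg.carrier}
    (k : ∀ i, x i ⟶ x' i) :
    before (src := fun i => ⟨l, x i⟩) (mid := fun i => ⟨l, x' i⟩) (fun _ => 𝟙 l)
      (fun i => eqToHom (HMor.map_id_obj X l (x i)) ≫ k i) (eval A x') =
    (eval A x).postcomp ((X.obj l).alg.actMap (𝟙 A) k) := by
  have h := fun i => HMor.map_id_obj X l (x' i)
  refine ext_heq (fun _ => Category.comp_id _) ((eqToHom_comp_heq _ _).trans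
    (HEq.trans ?_ (postcomp_eval_map_heq A x _).symm))
  refine (heq_comp (congrArg _ (funext fun i => ?_)) (congrArg _ (funext h)) rfl
    ((X.obj l).alg.actMap_heq rfl rfl (fun i => ?_) h HEq.rfl fun i =>
      (HMor.map_id_map X l _).trans (eqToHom_comp_heq (k i) (HMor.map_id_obj X l (x i))))
    (eqToHom_heq_id (congrArg _ (funext h)))).trans (heq_of_eq (Category.comp_id _)) <;>
  exact (HMor.map_id_obj X l _).trans (HMor.map_id_obj X l (x i))

theorem postcomp_actMap {l : L} {n : ℕ} {A A' : M.Op n} (α : A ⟶ A')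
    {x x' : Fin n → (X.obj l).alg.carrier} (k : ∀ i, x i ⟶ x' i) :
    (eval A x).postcomp ((X.obj l).alg.actMap α k) =
      ((eval A' x).postcomp ((X.obj l).alg.actMap (𝟙 A') k)).precomp α := by
  have h := fun i => HMor.map_id_obj X l (x i)
  refine ext_heq (fun _ => rfl) ((postcomp_eval_map_heq A x _).trans ?_)
  rw [Alg.actMap_split]
  exact heq_comp (congrArg _ (funext h).symm) (congrArg _ (funext h).symm) rfl
    ((X.obj l).alg.actMap_heq rfl rfl (fun i => (h i).symm) (fun i => (h i).symm) HEq.rfl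
      fun i => id_heq (h i).symm) (postcomp_eval_map_heq A' x _).symm

theorem eval_comp_rel {l : L} {n : ℕ} (r : Fin n → ℕ) (A : M.Op n) (C : ∀ i, M.Op (r i))
    (x : Fin (∑ i, r i) → (X.obj l).alg.carrier) :
    Rel (Equiv.refl _) (eval (M.comp r rfl A C) x)
      (comp (fun i => eval (C i) fun j => x (lex r rfl ⟨i, j⟩)) (eval A fun i =>
        (X.obj l).alg.act (C i) fun j => x (lex r rfl ⟨i, j⟩))) := by
  have h := fun i => HMor.map_id_obj X l (x i)
  refine ⟨.refl _, fun j => ?_, ?_, fun j => ?_, ?_⟩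
  · exact congrArg (fun i => (⟨l, x i⟩ : Lab X)) (Equiv.apply_symm_apply (lex r rfl) j).symm
  · exact congrArg (Sigma.mk l) ((X.obj l).alg.comp_act r rfl A C x)
  · exact heq_of_eq (Category.comp_id _).symm
  · refine HEq.trans ?_ (comp_map_heq _ _).symm
    have e : ∀ i, HEq ((eval (C i) fun j => x (lex r rfl ⟨i, j⟩)).push (𝟙 l))
        (𝟙 ((X.obj l).alg.act (C i) fun j => x (lex r rfl ⟨i, j⟩))) := fun i =>
      (push_eval _ _ _).trans (lax_map_id X l _ _)
    have e1 := (X.obj l).alg.actMap_id A fun i =>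
      (X.obj l).alg.act (C i) fun j => x (lex r rfl ⟨i, j⟩)
    have h1 : ∀ i, (X.map (𝟙 l)).functor.obj ((X.obj l).alg.act (C i) fun j =>
      x (lex r rfl ⟨i, j⟩)) = _ := fun i => HMor.map_id_obj X l _
    have h2 : ∀ i, ((X.obj l).alg.act (C i) fun j => (X.map (𝟙 l)).functor.obj
        ((X.map (𝟙 l)).functor.obj (x (lex r rfl ⟨i, j⟩)))) =
        (X.obj l).alg.act (C i) fun j => x (lex r rfl ⟨i, j⟩) := fun i =>
      congrArg _ (funext fun j => (HMor.map_id_obj X l _).trans (h _))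
    refine (eval_map_heq _ _).trans (HEq.trans (id_heq ((X.obj l).alg.comp_act r rfl A C x))
      (HEq.symm ?_))
    refine (heq_comp (congrArg _ (funext h2)) (congrArg _ (funext h1)) rfl
      (((X.obj l).alg.actMap_heq rfl rfl h2 h1 HEq.rfl e).trans (heq_of_eq e1))
      (eqToHom_heq_id (congrArg _ (funext h1)))).trans (heq_of_eq (Category.comp_id _))

theorem eval_one_rel {l : L} (x : Fin 1 → (X.obj l).alg.carrier) :
    Rel (Equiv.refl _) (eval M.one x) (Node.id ⟨l, x 0⟩) := by
  refine ⟨.refl _, fun j => by rw [Subsingleton.elim j 0], congrArg (Sigma.mk l)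
    ((X.obj l).alg.one_act x), fun j => HEq.rfl, ?_⟩
  exact (eval_map_heq _ _).trans ((id_heq ((X.obj l).alg.one_act x)).trans
    (eqToHom_heq_id (((X.obj l).alg.one_act _).trans (HMor.map_id_obj X l (x 0)))).symm)

theorem eval_perm_rel {l : L} {n : ℕ} (σ : Equiv.Perm (Fin n)) (A : M.Op n)
    (x : Fin n → (X.obj l).alg.carrier) :
    Rel σ (eval ((M.perm σ).obj A) x) (eval A fun i => x (σ.symm i)) := by
  refine ⟨.mk σ A, fun j => by rw [Equiv.symm_apply_apply], congrArg (Sigma.mk l)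
    ((X.obj l).alg.perm_act σ A x), fun j => HEq.rfl, ?_⟩
  exact (eval_map_heq _ _).trans ((id_heq ((X.obj l).alg.perm_act σ A x)).trans
    (eval_map_heq _ _).symm)

theorem andThen_id {r : ℕ} {C : M.Op r} {src : Fin r → Lab X} {l : L}
    {K K' : (X.obj l).alg.carrier} (b : Node X C src ⟨l, K⟩) (f : K ⟶ K') :
    b.andThen (y := ⟨l, K'⟩) (𝟙 l) (eqToHom (HMor.map_id_obj X l K) ≫ f) = b.postcomp f := by
  refine ext_heq (fun j => Category.comp_id _) ((eqToHom_comp_heq _ _).trans ?_)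
  exact heq_comp (congrArg _ (funext fun j => HMor.map_id_obj X l _)) (HMor.map_id_obj X l K) rfl
    (push_id b) (eqToHom_comp_heq _ _)

theorem unary_andThen {x y z : Lab X} (a : x.1 ⟶ y.1) (f : (X.map a).functor.obj x.2 ⟶ y.2)
    (b : y.1 ⟶ z.1) (g : (X.map b).functor.obj y.2 ⟶ z.2) :
    (unary a f).andThen b g = unary (a ≫ b)
      (eqToHom (HMor.map_comp_obj X a b x.2) ≫ (X.map b).functor.map f ≫ g) := by
  refine ext_heq (fun j => rfl) ((eqToHom_comp_heq _ _).trans (HEq.trans ?_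
    ((eqToHom_comp_heq _ _).trans (eqToHom_comp_heq _ _)).symm))
  exact heq_comp ((X.obj z.1).alg.one_act _) rfl rfl (push_unary a f b) HEq.rfl

theorem andThen_rel {r : ℕ} {C : M.Op r} {src : Fin r → Lab X} {tgt y : Lab X}
    (b : Node X C src tgt) (a : tgt.1 ⟶ y.1) (f : (X.map a).functor.obj tgt.2 ⟶ y.2)
    {θ : Fin r ≃ Fin (∑ _i : Fin 1, r)} (hθ : ∀ j, θ j = lex _ rfl ⟨0, j⟩) :
    Rel θ (b.andThen a f) (comp (fun _ : Fin 1 => b) (unary a f)) := by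
  refine ⟨?_, fun j => ?_, rfl, fun j => ?_, ?_⟩
  · rw [← CatOperad.compE_lex]
    exact CatOperad.IsPerm.one_compE (lex _ rfl) (fun _ => C) hθ
  · rw [hθ]
    exact (comp_src (fun _ : Fin 1 => src) 0 j).symm
  · rw [hθ]
    exact (comp_lam (fun _ : Fin 1 => b) (unary a f) 0 j).symm
  · refine (eqToHom_comp_heq _ _).trans (HEq.trans ?_ (comp_map_heq _ _).symm)
    exact heq_comp ((X.obj y.1).alg.one_act fun _ => (X.obj y.1).alg.act C fun j =>
        (X.map a).functor.obj ((X.map (b.lam j)).functor.obj (src j).2)).symm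
      ((X.obj y.1).alg.one_act fun _ => (X.map a).functor.obj tgt.2).symm rfl
      ((X.obj y.1).alg.one_actMap (fun _ => b.push a)).symm (eqToHom_comp_heq _ _).symm

theorem before_rel {r : ℕ} {C : M.Op r} {src mid : Fin r → Lab X} {tgt : Lab X}
    (l : ∀ j, (src j).1 ⟶ (mid j).1) (f : ∀ j, (X.map (l j)).functor.obj (src j).2 ⟶ (mid j).2)
    (a : Node X C mid tgt) {θ : Fin r ≃ Fin (∑ _i : Fin r, 1)} (hθ : ∀ j, θ j = lex _ rfl ⟨j, 0⟩) :
    Rel θ (before l f a) (comp (fun j => unary (l j) (f j)) a) := by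
  refine ⟨?_, fun j => ?_, rfl, fun j => ?_, ?_⟩
  · rw [← CatOperad.compE_lex]
    exact CatOperad.IsPerm.compE_one (lex _ rfl) C hθ
  · rw [hθ]
    exact (comp_src (fun (j : Fin r) (_ : Fin 1) => src j) j 0).symm
  · rw [hθ]
    exact (comp_lam (fun j => unary (l j) (f j)) a j 0).symm
  · refine (eqToHom_comp_heq _ _).trans (HEq.trans ?_ (comp_map_heq _ _).symm)
    have h := fun j => ((X.obj tgt.1).alg.one_act fun _ =>
      (X.map (a.lam j)).functor.obj ((X.map (l j)).functor.obj (src j).2)).symm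
    exact heq_comp (congrArg _ (funext h)) rfl rfl
      ((X.obj tgt.1).alg.actMap_heq rfl rfl h (fun _ => rfl) HEq.rfl
        fun j => (push_unary (l j) (f j) (a.lam j)).symm) HEq.rfl

end Node

namespace NodeEval

variable (E : NodeEval X S)

/-- The value on a unary node. -/
def unary {x y : Lab X} (a : x.1 ⟶ y.1) (f : (X.map a).functor.obj x.2 ⟶ y.2) : E.κ x ⟶ E.κ y :=
  eqToHom (S.one_act fun _ => E.κ x).symm ≫ E.ev (Node.unary a f)

theorem unary_heq {x y : Lab X} (a : x.1 ⟶ y.1) (f : (X.map a).functor.obj x.2 ⟶ y.2) :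
    HEq (E.unary a f) (E.ev (Node.unary a f)) :=
  eqToHom_comp_heq _ _

theorem unary_congr {x y : Lab X} {a a' : x.1 ⟶ y.1} {f : (X.map a).functor.obj x.2 ⟶ y.2}
    {f' : (X.map a').functor.obj x.2 ⟶ y.2} (ha : a = a') (hf : HEq f f') :
    E.unary a f = E.unary a' f' := by
  subst ha
  obtain rfl := eq_of_heq hf
  rfl

theorem ev_andThen {r : ℕ} {C : M.Op r} {src : Fin r → Lab X} {tgt y : Lab X}
    (b : Node X C src tgt) (a : tgt.1 ⟶ y.1) (f : (X.map a).functor.obj tgt.2 ⟶ y.2) :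
    E.ev (b.andThen a f) = E.ev b ≫ E.unary a f := by
  have h := b.andThen_rel a f (θ := (single r).symm.trans (lex _ rfl)) fun j => rfl
  refine eq_of_heq ((E.ev_rel h).trans ((E.ev_comp _ _).trans ?_))
  exact heq_comp (S.one_act _) (S.one_act _) rfl (S.one_actMap _) (E.unary_heq a f).symm

theorem ev_before {r : ℕ} {C : M.Op r} {src mid : Fin r → Lab X} {tgt : Lab X}
    (l : ∀ j, (src j).1 ⟶ (mid j).1) (f : ∀ j, (X.map (l j)).functor.obj (src j).2 ⟶ (mid j).2)
    (a : Node X C mid tgt) :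
    E.ev (Node.before l f a) = S.actMap (𝟙 C) (fun j => E.unary (l j) (f j)) ≫ E.ev a := by
  have h := Node.before_rel l f a
    (θ := (Equiv.sigmaUnique (Fin r) fun _ => Fin 1).symm.trans (lex _ rfl)) fun j => rfl
  refine eq_of_heq ((E.ev_rel h).trans ((E.ev_comp _ _).trans ?_))
  have h1 := fun j => S.one_act fun _ => E.κ (src j)
  exact heq_comp (congrArg _ (funext h1)) rfl rfl
    (S.actMap_heq rfl rfl h1 (fun _ => rfl) HEq.rfl fun j => (E.unary_heq (l j) (f j)).symm) HEq.rfl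

theorem unary_comp_unary {x y z : Lab X} (a : x.1 ⟶ y.1) (f : (X.map a).functor.obj x.2 ⟶ y.2)
    (b : y.1 ⟶ z.1) (g : (X.map b).functor.obj y.2 ⟶ z.2) :
    E.unary a f ≫ E.unary b g = E.unary (a ≫ b)
      (eqToHom (HMor.map_comp_obj X a b x.2) ≫ (X.map b).functor.map f ≫ g) := by
  rw [unary, Category.assoc, ← ev_andThen, Node.unary_andThen]
  rfl

/-- The value on a morphism of `X l`. -/
def map (l : L) {K K' : (X.obj l).alg.carrier} (f : K ⟶ K') : E.κ ⟨l, K⟩ ⟶ E.κ ⟨l, K'⟩ :=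
  E.unary (x := ⟨l, K⟩) (y := ⟨l, K'⟩) (𝟙 l) (eqToHom (HMor.map_id_obj X l K) ≫ f)

theorem ev_postcomp {r : ℕ} {C : M.Op r} {src : Fin r → Lab X} {l : L}
    {K K' : (X.obj l).alg.carrier} (b : Node X C src ⟨l, K⟩) (f : K ⟶ K') :
    E.ev (b.postcomp f) = E.ev b ≫ E.map l f := by
  rw [map, ← ev_andThen, Node.andThen_id]

theorem map_eq (l : L) {K K' : (X.obj l).alg.carrier} (f : K ⟶ K') :
    HEq (E.map l f) (E.ev ((Node.id ⟨l, K⟩).postcomp f)) := by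
  refine (E.unary_heq _ _).trans (heq_of_eq (congrArg E.ev ?_))
  exact Node.ext_heq (fun _ => rfl) ((eqToHom_comp_heq _ _).trans
    ((eqToHom_comp_heq _ _).trans (eqToHom_comp_heq f
      (((X.obj l).alg.one_act _).trans (HMor.map_id_obj X l K))).symm))

theorem map_id (l : L) (K : (X.obj l).alg.carrier) : E.map l (𝟙 K) = 𝟙 (E.κ ⟨l, K⟩) := by
  have h : (Node.id (⟨l, K⟩ : Lab X)).postcomp (𝟙 K) = Node.id ⟨l, K⟩ :=
    Node.ext_heq (fun _ => rfl) (heq_of_eq (Category.comp_id _))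
  refine eq_of_heq ((E.map_eq l (𝟙 K)).trans ?_)
  rw [h]
  exact E.ev_id _

theorem map_comp (l : L) {K K' K'' : (X.obj l).alg.carrier} (f : K ⟶ K') (g : K' ⟶ K'') :
    E.map l (f ≫ g) = E.map l f ≫ E.map l g := by
  have h : ((Node.id (⟨l, K⟩ : Lab X)).postcomp f).postcomp g =
      (Node.id ⟨l, K⟩).postcomp (f ≫ g) :=
    Node.ext_heq (fun _ => rfl) (heq_of_eq (Category.assoc _ _ _))
  have h1 := E.ev_postcomp ((Node.id (⟨l, K⟩ : Lab X)).postcomp f) g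
  refine eq_of_heq ((E.map_eq l (f ≫ g)).trans ?_)
  rw [← h, h1]
  exact heq_comp (S.one_act _) rfl rfl (E.map_eq l f).symm HEq.rfl

/-- The lax cocone given by an evaluation of nodes. -/
def toLaxCocone : LaxCocone X S where
  app l :=
    { functor :=
        { obj := fun K => E.κ ⟨l, K⟩
          map := fun f => E.map l f
          map_id := E.map_id l
          map_comp := E.map_comp l }
      lax := fun A x => E.ev (Node.eval A x)
      lax_natural := fun {n A A' x x'} α k => by
        have h := congrArg E.ev ((Node.postcomp_actMap α k).trans
          (congrArg (Node.precomp α) (Node.before_eval A' k).symm))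
        rw [ev_postcomp, ev_precomp, ev_before, ← Category.assoc, ← S.actMap_comp] at h
        simp only [Category.id_comp, Category.comp_id] at h
        exact h
      lax_comp := fun {n m} r h A C x => by
        subst h
        exact (E.ev_rel (Node.eval_comp_rel r A C x)).trans (E.ev_comp _ _)
      lax_one := fun x => (E.ev_rel (Node.eval_one_rel x)).trans (E.ev_id _)
      lax_perm := fun {n} σ A x => E.ev_rel (Node.eval_perm_rel σ A x) }
  θ a x := E.unary a (𝟙 ((X.map a).functor.obj x))
  θ_naturality {l l'} a x y f := by
    refine (E.unary_comp_unary (x := ⟨l, x⟩) (y := ⟨l, y⟩) (z := ⟨l', (X.map a).functor.obj y⟩)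
      _ _ _ _).trans (Eq.trans ?_ (E.unary_comp_unary (x := ⟨l, x⟩)
      (y := ⟨l', (X.map a).functor.obj x⟩) (z := ⟨l', (X.map a).functor.obj y⟩) _ _ _ _).symm)
    refine E.unary_congr ((Category.id_comp a).trans (Category.comp_id a).symm) ?_
    rw [Category.comp_id, (X.map (𝟙 l')).functor.map_id]
    refine (eqToHom_comp_heq _ _).trans (HEq.trans ?_ ((eqToHom_comp_heq _ _).trans
      ((heq_of_eq (Category.id_comp _)).trans (eqToHom_comp_heq _ _))).symm)
    exact map_heq (X.map a).functor (HMor.map_id_obj X l x) rfl (eqToHom_comp_heq _ _)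
  θ_lax {l l'} a n A x := by
    refine Eq.trans (Category.assoc _ _ _).symm ?_
    refine Eq.trans (congrArg (fun z => z ≫ _) (E.ev_before (src := fun i => ⟨l, x i⟩)
      (mid := fun i => ⟨l', (X.map a).functor.obj (x i)⟩) (fun _ => a) (fun i => 𝟙 _)
      (Node.eval A fun i => (X.map a).functor.obj (x i))).symm) ?_
    refine (E.ev_postcomp _ _).symm.trans (Eq.trans ?_ (E.ev_andThen _ _ _))
    refine congrArg E.ev (Node.ext_heq (fun _ => (Category.comp_id a).trans
      (Category.id_comp a).symm) ?_)
    have h := fun i => HMor.map_id_obj X l' ((X.map a).functor.obj (x i))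
    have e : HEq (Node.before (src := fun i => (⟨l, x i⟩ : Lab X))
        (mid := fun i => ⟨l', (X.map a).functor.obj (x i)⟩) (fun _ => a)
        (fun i => 𝟙 ((X.map a).functor.obj (x i)))
        (Node.eval A fun i => (X.map a).functor.obj (x i))).map
        (𝟙 ((X.obj l').alg.act A fun i => (X.map a).functor.obj (x i))) := by
      refine (eqToHom_comp_heq _ _).trans ?_
      have e1 := (X.obj l').alg.actMap_id A fun i => (X.map (𝟙 l')).functor.obj
        ((X.map a).functor.obj (x i))
      simp only [Node.eval, CategoryTheory.Functor.map_id]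
      rw [e1, Category.id_comp]
      exact eqToHom_heq_id _
    have h' := fun i => HMor.map_comp_obj X a (𝟙 l') (x i)
    refine (heq_comp (congrArg _ (funext fun i => (h' i).trans (h i))) rfl rfl e HEq.rfl).trans ?_
    refine (heq_of_eq (Category.id_comp _)).trans (HEq.trans ?_ (eqToHom_comp_heq _ _).symm)
    refine HEq.trans ?_ (heq_of_eq (Category.comp_id _).symm)
    exact (Node.push_eval A x a).symm
  θ_id l x := by
    refine (E.unary_heq _ _).trans (HEq.trans (E.ev_rel (ρ := Equiv.refl _)
      (a := Node.id (⟨l, x⟩ : Lab X)) ?_) (E.ev_id _))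
    have h := HMor.map_id_obj X l x
    refine ⟨.refl _, fun _ => rfl, congrArg (Sigma.mk l) h, fun _ => HEq.rfl, ?_⟩
    exact (eqToHom_comp_heq _ _).trans ((id_heq h).trans
      (eqToHom_heq_id (((X.obj l).alg.one_act _).trans h)).symm)
  θ_comp {l l' l''} a b x := by
    have h := HMor.map_comp_obj X a b x
    have e := E.unary_comp_unary (x := ⟨l, x⟩) (y := ⟨l', (X.map a).functor.obj x⟩)
      (z := ⟨l'', (X.map b).functor.obj ((X.map a).functor.obj x)⟩) a (𝟙 _) b (𝟙 _)
    have aux : ∀ {K K' : (X.obj l'').alg.carrier}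
        (f : (X.map (a ≫ b)).functor.obj x ⟶ K) (f' : (X.map (a ≫ b)).functor.obj x ⟶ K'),
        K = K' → HEq f f' → HEq (E.unary (x := ⟨l, x⟩) (y := ⟨l'', K⟩) (a ≫ b) f)
          (E.unary (x := ⟨l, x⟩) (y := ⟨l'', K'⟩) (a ≫ b) f') := by
      rintro K _ f f' rfl hf
      obtain rfl := eq_of_heq hf
      rfl
    refine HEq.trans (aux _ _ h ?_) (heq_of_eq e.symm)
    rw [CategoryTheory.Functor.map_id, Category.id_comp]
    exact (id_heq h).trans (eqToHom_comp_heq _ _).symm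

/-- Every node is a composite of index morphisms, an evaluation and a morphism of some `X l`. -/
theorem _root_.CatOp.Node.eq_postcomp {r : ℕ} {C : M.Op r} {src : Fin r → Lab X} {tgt : Lab X}
    (a : Node X C src tgt) : a = Node.postcomp (l := tgt.1) (K' := tgt.2) (Node.before
      (mid := fun j => ⟨tgt.1, (X.map (a.lam j)).functor.obj (src j).2⟩) a.lam (fun _ => 𝟙 _)
      (Node.eval C fun j => (X.map (a.lam j)).functor.obj (src j).2)) a.map := by
  refine Node.ext_heq (fun j => (Category.comp_id _).symm) ?_
  have h := fun j => HMor.map_id_obj X tgt.1 ((X.map (a.lam j)).functor.obj (src j).2)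
  have h' := fun j => HMor.map_comp_obj X (a.lam j) (𝟙 tgt.1) (src j).2
  have e : HEq (Node.before
        (mid := fun j => ⟨tgt.1, (X.map (a.lam j)).functor.obj (src j).2⟩) a.lam (fun _ => 𝟙 _)
        (Node.eval C fun j => (X.map (a.lam j)).functor.obj (src j).2)).map
        (𝟙 ((X.obj tgt.1).alg.act C fun j => (X.map (a.lam j)).functor.obj (src j).2)) := by
    refine (eqToHom_comp_heq _ _).trans ?_
    have e1 := (X.obj tgt.1).alg.actMap_id C fun j => (X.map (𝟙 tgt.1)).functor.obj
      ((X.map (a.lam j)).functor.obj (src j).2)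
    simp only [Node.eval, CategoryTheory.Functor.map_id]
    rw [e1, Category.id_comp]
    exact eqToHom_heq_id _
  exact ((heq_comp (congrArg _ (funext fun j => (h' j).trans (h j))) rfl rfl e HEq.rfl).trans
    (heq_of_eq (Category.id_comp _))).symm

/-- An evaluation of nodes is determined by its lax cocone. -/
theorem toLaxCocone_ev {r : ℕ} {C : M.Op r} {src : Fin r → Lab X} {tgt : Lab X}
    (a : Node X C src tgt) : E.toLaxCocone.ev a = E.ev a := by
  have h := congrArg E.ev a.eq_postcomp
  rw [ev_postcomp, ev_before, Category.assoc] at h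
  exact h.symm

end NodeEval

end CatOp

/-! ### Strict homomorphisms given by evaluations of nodes -/

namespace CatOp

variable {M : CatOperad.{u}} {L : Type u} [SmallCategory L]

open Bicategory

variable {X : L ⥤ LaxAlg M} {S : Alg M}

theorem Alg.actMap_comp_eqToHom (S : Alg M) {n : ℕ} {A B B' : M.Op n} (α : A ⟶ B) (h : B = B')
    {x y : Fin n → S.carrier} (k : ∀ i, x i ⟶ y i) :
    HEq (S.actMap (α ≫ eqToHom h) k) (S.actMap α k) := by
  subst h
  rw [eqToHom_refl, Category.comp_id]

namespace NodeEval

variable (E : NodeEval X S) {P P' Q Q' R : Rep X}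

/-- The value of an evaluation of nodes on an object of the category of representatives. -/
def obj (P : Rep X) : S.carrier := S.act P.op fun i => E.κ (P.lab i)

/-- The value on the nodes of a morphism of representatives. -/
def nodes (f : RepHom P Q) :
    S.act (M.compE f.e Q.op f.C) (fun i => E.κ (P.lab i)) ⟶ E.obj Q :=
  eqToHom (S.act_compE f.e Q.op f.C _) ≫ S.actMap (𝟙 Q.op) fun k => E.ev (f.node k)

/-- The value of an evaluation of nodes on a morphism of representatives. -/
def hom (f : RepHom P Q) : E.obj P ⟶ E.obj Q :=
  S.actMap f.γ (fun i => 𝟙 (E.κ (P.lab i))) ≫ E.nodes f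

theorem nodes_heq (f : RepHom P Q) :
    HEq (E.nodes f) (S.actMap (𝟙 Q.op) fun k => E.ev (f.node k)) :=
  eqToHom_comp_heq _ _

theorem obj_iso (s : Rep.Iso P' P) : E.obj P' = E.obj P :=
  S.act_isPerm s.op fun i => congrArg E.κ (s.lab i)

theorem nodes_rel {s : Rep.Iso P' P} {t : Rep.Iso Q' Q} {f' : RepHom P' Q'} {f : RepHom P Q}
    (h : RepHom.Rel s t f' f) : HEq (E.nodes f') (E.nodes f) := by
  refine (E.nodes_heq f').trans (HEq.trans ?_ (E.nodes_heq f).symm)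
  choose ρ h1 h2 using h.node
  exact S.actMap_id_isPerm t.op
    (fun k => S.act_isPerm (h1 k).op fun j => congrArg E.κ ((h1 k).src j))
    (fun k => congrArg E.κ (t.lab k)) fun k => E.ev_rel (h1 k)

/-- An evaluation of nodes is invariant under permutations. -/
theorem hom_rel {s : Rep.Iso P' P} {t : Rep.Iso Q' Q} {f' : RepHom P' Q'} {f : RepHom P Q}
    (h : RepHom.Rel s t f' f) : HEq (E.hom f') (E.hom f) :=
  heq_comp (E.obj_iso s) (S.act_isPerm h.γ.arr_tgt fun i => congrArg E.κ (s.lab i)) (E.obj_iso t)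
    (S.actMap_isPerm h.γ (fun i => congrArg E.κ (s.lab i)) (fun i => congrArg E.κ (s.lab i))
      fun i => id_heq (congrArg E.κ (s.lab i))) (E.nodes_rel h)

/-- An evaluation of nodes takes the same value on the two morphisms related by
`MorRel.decompose`. -/
theorem hom_decomp (d : Decomp X) : E.hom d.left = E.hom d.right := by
  have h := S.actMap_comp d.δ (M.compEMap d.e (𝟙 d.Q.op) d.α) (fun i => 𝟙 (E.κ (d.P.lab i)))
    fun i => 𝟙 _
  simp only [Category.comp_id] at h
  refine (congrArg (fun z => z ≫ E.nodes d.left) h).trans ((Category.assoc _ _ _).trans ?_)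
  refine congrArg (fun z => S.actMap d.δ (fun i => 𝟙 (E.κ (d.P.lab i))) ≫ z) ?_
  refine eq_of_heq ((heq_comp (S.act_compE d.e d.Q.op d.D _) (S.act_compE d.e d.Q.op d.C _) rfl
    (S.actMap_compEMap d.e _ _ _) (E.nodes_heq d.left)).trans
      (HEq.trans (heq_of_eq ?_) (E.nodes_heq d.right).symm))
  refine (S.actMap_id_comp d.Q.op _ _).symm.trans (congrArg _ (funext fun k => ?_))
  exact (E.ev_precomp (d.α k) (d.f k)).symm

/-- The value on a class of morphisms of representatives. -/
def homMor : HocolimMor X → Σ a b : S.carrier, a ⟶ b :=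
  Quot.lift (fun a => ⟨E.obj a.src, E.obj a.tgt, E.hom a.hom⟩) fun a b h => by
    obtain ⟨s, t, h⟩ | ⟨d, rfl, rfl⟩ := h.cases
    · have h1 := E.obj_iso s
      have h2 := E.obj_iso t
      have h3 := E.hom_rel h
      revert h3
      generalize E.hom a.hom = p
      generalize E.hom b.hom = q
      revert p q
      rw [h1, h2]
      rintro p q h3
      rw [eq_of_heq h3]
    · simp only [E.hom_decomp d]

/-- The value on a morphism depends only on its class. -/
theorem hom_congr {f : RepHom P Q} {f' : RepHom P' Q'} (h : f.mor = f'.mor) :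
    HEq (E.hom f) (E.hom f') := by
  have h' : (⟨E.obj P, E.obj Q, E.hom f⟩ : Σ a b : S.carrier, a ⟶ b) =
    ⟨E.obj P', E.obj Q', E.hom f'⟩ := congrArg E.homMor h
  have aux : ∀ {a b a' b' : S.carrier} {p : a ⟶ b} {q : a' ⟶ b'},
      (⟨a, b, p⟩ : Σ a b : S.carrier, a ⟶ b) = ⟨a', b', q⟩ → HEq p q := by
    rintro a b a' b' p q h
    cases h
    rfl
  exact aux h'

theorem hom_id (P : Rep X) : E.hom (RepHom.id P) = 𝟙 (E.obj P) := by
  have h := fun i => S.one_act fun _ => E.κ (P.lab i)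
  have h1 : HEq (S.actMap (RepHom.id P).γ fun i => 𝟙 (E.κ (P.lab i))) (𝟙 (E.obj P)) := by
    have := S.actMap_comp_eqToHom (𝟙 P.op) (M.compE_one P.op).symm fun i => 𝟙 (E.κ (P.lab i))
    rw [Category.id_comp] at this
    exact this.trans (heq_of_eq (S.actMap_id _ _))
  have h2 : HEq (E.nodes (RepHom.id P)) (𝟙 (E.obj P)) := by
    refine (E.nodes_heq _).trans (HEq.trans ?_ (heq_of_eq (S.actMap_id _ _)))
    exact S.actMap_heq rfl rfl h (fun _ => rfl) HEq.rfl fun k => E.ev_id _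
  exact eq_of_heq ((heq_comp rfl (congrArg (fun A => S.act A _) (M.compE_one P.op)) rfl h1 h2).trans
    (heq_of_eq (Category.comp_id _)))

theorem hom_comp (f : RepHom P Q) (g : RepHom Q R) : E.hom (f.comp g) = E.hom f ≫ E.hom g := by
  have hx := fun l => S.actMap_id (f.C l) fun j => E.κ (P.lab (f.e ⟨l, j⟩))
  have ho := S.act_compE f.e (M.compE g.e R.op g.C) f.C fun i => E.κ (P.lab i)
  -- The morphism of operations of `g` is natural with respect to the values on the nodes of `f`.
  have h1 : E.nodes f ≫ S.actMap g.γ (fun i => 𝟙 (E.κ (Q.lab i))) =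
      S.actMap (M.compEMap f.e g.γ fun l => 𝟙 (f.C l)) (fun i => 𝟙 (E.κ (P.lab i))) ≫
        eqToHom ho ≫ S.actMap (𝟙 (M.compE g.e R.op g.C)) fun k => E.ev (f.node k) := by
    have e := S.actMap_compEMap f.e g.γ (fun l => 𝟙 (f.C l)) fun i => 𝟙 (E.κ (P.lab i))
    simp only [hx] at e
    refine eq_of_heq ((heq_comp (S.act_compE _ _ _ _) rfl rfl (E.nodes_heq f) HEq.rfl).trans
      (HEq.trans (heq_of_eq ?_) (heq_comp (S.act_compE _ _ _ _) ho rfl e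
        (eqToHom_comp_heq _ ho)).symm))
    exact (S.actMap_split' g.γ _).symm.trans (S.actMap_split g.γ _)
  -- The values on the nodes of `f` and `g` compose to those on the nodes of `f.comp g`.
  have h2 : HEq ((eqToHom ho ≫ S.actMap (𝟙 (M.compE g.e R.op g.C)) fun k => E.ev (f.node k)) ≫
      E.nodes g) (E.nodes (f.comp g)) := by
    have e := S.actMap_compEMap g.e (𝟙 R.op) (fun k => 𝟙 (g.C k)) fun k => E.ev (f.node k)
    rw [M.compEMap_id] at e
    have hs := fun k => S.comp_act (fun j => f.r (g.e ⟨k, j⟩)) rfl (g.C k)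
      (fun j => f.C (g.e ⟨k, j⟩)) fun y => E.κ (P.lab ((f.comp g).e ⟨k, y⟩))
    have hs' : ∀ k, S.act (M.comp (fun j => f.r (g.e ⟨k, j⟩)) rfl (g.C k)
        fun j => f.C (g.e ⟨k, j⟩)) (fun y => E.κ (P.lab ((f.comp g).e ⟨k, y⟩))) =
        S.act (g.C k) fun j => S.act (f.C (g.e ⟨k, j⟩)) fun i =>
          E.κ (P.lab (f.e ⟨g.e ⟨k, j⟩, i⟩)) := fun k => by
      refine (hs k).trans (congrArg _ (funext fun j => congrArg _ (funext fun i => ?_)))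
      exact congrArg (fun x => E.κ (P.lab x)) (nest_lex g.e f.e k j i)
    refine (heq_comp (ho.trans (S.act_compE _ _ _ _)) (S.act_compE _ _ _ _) rfl
      ((eqToHom_comp_heq _ ho).trans e) (E.nodes_heq g)).trans ?_
    refine (heq_of_eq (S.actMap_id_comp R.op _ _).symm).trans
      (HEq.trans ?_ (E.nodes_heq (f.comp g)).symm)
    exact S.actMap_heq rfl rfl (fun k => (hs' k).symm) (fun _ => rfl) HEq.rfl
      fun k => (E.ev_comp (fun j => f.node (g.e ⟨k, j⟩)) (g.node k)).symm
  have h3 : HEq (S.actMap (f.comp g).γ fun i => 𝟙 (E.κ (P.lab i)))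
      (S.actMap f.γ (fun i => 𝟙 (E.κ (P.lab i))) ≫
        S.actMap (M.compEMap f.e g.γ fun l => 𝟙 (f.C l)) fun i => 𝟙 (E.κ (P.lab i))) := by
    have e := S.actMap_comp f.γ (M.compEMap f.e g.γ fun l => 𝟙 (f.C l))
      (fun i => 𝟙 (E.κ (P.lab i))) fun i => 𝟙 (E.κ (P.lab i))
    simp only [Category.comp_id] at e
    rw [RepHom.comp, ← Category.assoc, ← e]
    exact S.actMap_comp_eqToHom _ _ _
  refine eq_of_heq ((heq_comp rfl (congrArg (fun A => S.act A _)
    (M.compE_compE g.e f.e R.op g.C f.C)).symm rfl h3 h2.symm).trans (heq_of_eq ?_))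
  refine (Category.assoc _ _ _).trans (Eq.trans ?_ (Category.assoc _ _ _).symm)
  refine congrArg (fun z => S.actMap f.γ (fun i => 𝟙 (E.κ (P.lab i))) ≫ z) ?_
  refine (Category.assoc _ _ _).symm.trans (Eq.trans ?_ (Category.assoc _ _ _))
  exact congrArg (fun z => z ≫ E.nodes g) h1.symm

theorem obj_act {n : ℕ} (B : M.Op n) (Y : Fin n → Rep X) :
    E.obj (Rep.act B Y) = S.act B fun i => E.obj (Y i) := by
  refine (S.comp_act _ rfl B _ _).trans
    (congrArg _ (funext fun i => congrArg _ (funext fun j => ?_)))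
  exact congrArg E.κ (Rep.act_lab B Y i j)

theorem hom_act {n : ℕ} {B B' : M.Op n} {Y Y' : Fin n → Rep X} (β : B ⟶ B')
    (f : ∀ i, RepHom (Y i) (Y' i)) :
    HEq (E.hom (RepHom.act β f)) (S.actMap β fun i => E.hom (f i)) := by
  have hl := fun i j => congrArg E.κ (Rep.act_lab B Y i j)
  -- The morphisms of operations and the nodes are compared separately.
  have h1 : HEq (S.actMap (RepHom.act β f).γ fun l => 𝟙 (E.κ ((Rep.act B Y).lab l)))
      (S.actMap β fun i => S.actMap (f i).γ fun j => 𝟙 (E.κ ((Y i).lab j))) := by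
    refine (S.actMap_comp_eqToHom _ _ _).trans ((S.comp_actMap _ rfl β _ _).trans ?_)
    exact S.actMap_heq rfl rfl (fun i => congrArg _ (funext fun j => hl i j))
      (fun i => congrArg _ (funext fun j => hl i j)) HEq.rfl fun i =>
      S.actMap_heq rfl rfl (hl i) (hl i) HEq.rfl fun j => id_heq (hl i j)
  have h2 : HEq (E.nodes (RepHom.act β f)) (S.actMap (𝟙 B') fun i => E.nodes (f i)) := by
    have e := S.comp_actMap (fun i => (Y' i).n) rfl (𝟙 B') (fun i => 𝟙 (Y' i).op)
      fun l => E.ev ((RepHom.act β f).node l)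
    rw [M.compMap_id] at e
    refine (E.nodes_heq _).trans (e.trans ?_)
    have hn := RepHom.act_match β f
    choose ρ h1 h2 using hn
    have hs := fun i j => (S.act_isPerm (h1 i j).op
      (x' := fun x => E.κ ((Y i).lab ((f i).e ⟨j, x⟩)))
      (x := fun x => E.κ ((Rep.act B Y).lab ((RepHom.act β f).e
        ⟨lex (fun i => (Y' i).n) rfl ⟨i, j⟩, x⟩))) fun x => congrArg E.κ ((h1 i j).src x)).symm
    have ht := fun i j => congrArg E.κ (h1 i j).tgt.symm
    refine S.actMap_heq rfl rfl (fun i => ?_) (fun i => congrArg _ (funext fun j => ht i j)) HEq.rfl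
      fun i => ?_
    · refine (congrArg _ (funext fun j => hs i j)).trans
        (S.act_compE (f i).e (Y' i).op (f i).C fun j => E.κ ((Y i).lab j)).symm
    · refine HEq.trans ?_ (E.nodes_heq (f i)).symm
      exact S.actMap_heq rfl rfl (hs i) (ht i) HEq.rfl fun j => (E.ev_rel (h1 i j)).symm
  refine (heq_comp (E.obj_act B Y) ?_ (E.obj_act B' Y') h1 h2).trans
    (heq_of_eq ?_)
  · refine (congrArg (fun A => S.act A fun l => E.κ ((Rep.act B Y).lab l))
      (M.comp_compE (fun i => (Y' i).n) rfl (fun i => (f i).r) (fun i => (Y i).n)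
        (fun i => (f i).e) rfl B' (fun i => (Y' i).op) fun i => (f i).C).symm).trans ?_
    exact (S.comp_act _ rfl B' _ _).trans (congrArg _ (funext fun i => congrArg _ (funext (hl i))))
  · exact (S.actMap_comp β (𝟙 B') _ _).symm.trans
      (congrArg (fun b => S.actMap b fun i => E.hom (f i)) (Category.comp_id β))

end NodeEval

theorem HocolimOps.exists_cls (ops : HocolimOps X) {n : ℕ} {B B' : M.Op n}
    {U V : Fin n → HocolimObj X} (β : B ⟶ B') (u : ∀ i, HocolimHom (U i) (V i)) :
    ∃ (Y Y' : Fin n → Rep X) (f : ∀ i, RepHom (Y i) (Y' i)), (∀ i, (f i).mor = (u i).val) ∧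
      (∀ i, (Y i).cls = U i) ∧ (∀ i, (Y' i).cls = V i) ∧
      (RepHom.act β f).mor = (ops.actMap β u).val := by
  choose Y Y' f hU hV hf using fun i => (u i).exists_rep
  obtain rfl := funext hU
  obtain rfl := funext hV
  obtain rfl : u = fun i => (f i).cls := funext fun i => HocolimHom.eq_cls (hf i)
  exact ⟨Y, Y', f, hf, hU, hV, (ops.actMap_cls β f).symm⟩

namespace NodeEval

variable (E : NodeEval X S)

/-- The value on an object of the homotopy colimit. -/
def objCls : HocolimObj X → S.carrier :=
  Quot.lift E.obj fun _ P h => by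
    obtain ⟨_, σ⟩ := h
    exact E.obj_iso (.permute P σ)

theorem exists_homCls {U V : HocolimObj X} (u : HocolimHom U V) :
    ∃ v : E.objCls U ⟶ E.objCls V, ∃ (P Q : Rep X) (f : RepHom P Q), f.mor = u.val ∧
      HEq v (E.hom f) := by
  obtain ⟨P, Q, f, rfl, rfl, h⟩ := u.exists_rep
  exact ⟨E.hom f, P, Q, f, h, HEq.rfl⟩

/-- The value on a morphism of the homotopy colimit. -/
noncomputable def homCls {U V : HocolimObj X} (u : HocolimHom U V) : E.objCls U ⟶ E.objCls V :=
  (E.exists_homCls u).choose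

theorem homCls_heq {U V : HocolimObj X} {u : HocolimHom U V} {P Q : Rep X} {f : RepHom P Q}
    (h : f.mor = u.val) : HEq (E.homCls u) (E.hom f) := by
  obtain ⟨P', Q', f', h1, h2⟩ := (E.exists_homCls u).choose_spec
  exact h2.trans (E.hom_congr (h1.trans h.symm))

/-- The strict homomorphism from the homotopy colimit given by an evaluation of nodes. -/
noncomputable def toStrictHom (ops : HocolimOps X) : StrictHom ops.toAlg S where
  functor :=
    { obj := E.objCls
      map := fun u => E.homCls u
      map_id := fun U => by
        obtain ⟨P, rfl⟩ := Quot.exists_rep U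
        refine eq_of_heq ((E.homCls_heq (f := RepHom.id P) ?_).trans (heq_of_eq (E.hom_id P)))
        exact (congrArg Subtype.val (ops.id_cls P)).symm
      map_comp := fun {U V W} u v => by
        obtain ⟨P, Q, R, f, g, rfl, rfl, rfl, hf, hg⟩ := HocolimHom.exists_rep₂ u v
        refine eq_of_heq ((E.homCls_heq (f := f.comp g)
          (ops.val_comp rfl rfl rfl hf hg).symm).trans ((heq_of_eq (E.hom_comp f g)).trans ?_))
        exact heq_comp rfl rfl rfl (E.homCls_heq hf).symm (E.homCls_heq hg).symm }
  map_act A U := by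
    obtain ⟨Y, rfl⟩ := HocolimObj.exists_reps U
    exact (congrArg E.objCls (ops.act_cls A Y)).trans (E.obj_act A Y)
  map_actMap {n A A' U V} α u := by
    obtain ⟨Y, Y', f, hf, hU, hV, h⟩ := ops.exists_cls α u
    refine (E.homCls_heq h).trans ((E.hom_act α f).trans ?_)
    exact S.actMap_heq rfl rfl (fun i => congrArg E.objCls (hU i))
      (fun i => congrArg E.objCls (hV i)) HEq.rfl fun i => (E.homCls_heq (hf i)).symm

end NodeEval

end CatOp

/-! ### Generating morphisms of representatives -/

namespace CatOp

variable {M : CatOperad.{u}} {L : Type u} [SmallCategory L]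

open Bicategory

variable {X : L ⥤ LaxAlg M}

namespace Rep

/-- The object `(id; x)`. -/
abbrev atom (x : Lab X) : Rep X := Rep.ι X x.1 x.2

/-- Every object is the value of its operation on the objects given by its labels. -/
def atomsIso (P : Rep X) : Iso P (act P.op fun i => atom (P.lab i)) where
  σ := (Equiv.sigmaUnique (Fin P.n) fun _ => Fin 1).symm.trans (lex (fun _ => 1) rfl)
  op := by
    have h := CatOperad.IsPerm.compE_one (lex (fun _ : Fin P.n => 1) rfl) P.op
      (σ := (Equiv.sigmaUnique (Fin P.n) fun _ => Fin 1).symm.trans (lex (fun _ => 1) rfl))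
      fun _ => rfl
    rwa [CatOperad.compE_lex] at h
  lab i := (act_lab P.op (fun i => atom (P.lab i)) i (0 : Fin 1)).symm

/-- The objects at the top of a two-level tree may be collected to the values of the operations of
its upper level. -/
def nodesIso {P Q : Rep X} {r : Fin Q.n → ℕ} (e : (Σ k, Fin (r k)) ≃ Fin P.n) {C : ∀ k, M.Op (r k)}
    (h : P.op = M.compE e Q.op C) {src : ∀ k, Fin (r k) → Lab X}
    (hs : ∀ k j, src k j = P.lab (e ⟨k, j⟩)) :
    Iso P (act Q.op fun k => ⟨r k, C k, src k⟩) where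
  σ := e.symm.trans (lex r rfl)
  op := by
    rw [h]
    have h' : M.IsPerm (e.symm.trans (lex r rfl)) (M.compE e Q.op C)
        (M.compE (lex r rfl) Q.op C) :=
      .compE (τ := Equiv.refl _) (fun _ => Equiv.refl _) (.refl _) (fun _ => .refl _)
        fun k j => congrArg (lex r rfl) (e.symm_apply_apply _)
    rwa [CatOperad.compE_lex] at h'
  lab i := by
    obtain ⟨⟨k, j⟩, rfl⟩ := e.surjective i
    refine (hs k j).symm.trans ((act_lab Q.op (fun k => ⟨r k, C k, src k⟩) k j).symm.trans ?_)
    exact congrArg (act Q.op fun k => (⟨r k, C k, src k⟩ : Rep X)).lab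
      (congrArg (lex r rfl) (e.symm_apply_apply _)).symm

end Rep

namespace RepHom

/-- The morphism given by a single node. -/
def ofNode {r : ℕ} {C : M.Op r} {src : Fin r → Lab X} {tgt : Lab X} (a : Node X C src tgt) :
    RepHom ⟨r, C, src⟩ (Rep.atom tgt) where
  r _ := r
  e := single r
  C _ := C
  γ := eqToHom (M.one_compE C).symm
  node _ := a

/-- The morphism given by a morphism of operations. -/
def ofOp {n : ℕ} {A B : M.Op n} (α : A ⟶ B) (lab : Fin n → Lab X) :
    RepHom (⟨n, A, lab⟩ : Rep X) ⟨n, B, lab⟩ where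
  r _ := 1
  e := Equiv.sigmaUnique (Fin n) fun _ => Fin 1
  C _ := M.one
  γ := α ≫ eqToHom (M.compE_one B).symm
  node k := Node.id (lab k)

/-- The morphism given by nodes, where the source is a two-level tree. -/
def ofNodes {P Q : Rep X} {r : Fin Q.n → ℕ} (e : (Σ k, Fin (r k)) ≃ Fin P.n) {C : ∀ k, M.Op (r k)}
    (h : P.op = M.compE e Q.op C) {src : ∀ k, Fin (r k) → Lab X}
    (hs : ∀ k j, src k j = P.lab (e ⟨k, j⟩)) (b : ∀ k, Node X (C k) (src k) (Q.lab k)) :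
    RepHom P Q where
  r := r
  e := e
  C := C
  γ := eqToHom h
  node k := (b k).cast (funext (hs k))

theorem toArr_ofNode_γ {r : ℕ} {C : M.Op r} {src : Fin r → Lab X} {tgt : Lab X}
    (a : Node X C src tgt) : M.toArr (ofNode a).γ = M.toArr (𝟙 C) :=
  CatOperad.toArr_eqToHom (M.one_compE C).symm

theorem toArr_ofNodes_γ {P Q : Rep X} {r : Fin Q.n → ℕ} (e : (Σ k, Fin (r k)) ≃ Fin P.n)
    {C : ∀ k, M.Op (r k)} (h : P.op = M.compE e Q.op C) {src : ∀ k, Fin (r k) → Lab X}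
    (hs : ∀ k j, src k j = P.lab (e ⟨k, j⟩)) (b : ∀ k, Node X (C k) (src k) (Q.lab k)) :
    M.toArr (ofNodes e h hs b).γ = M.toArr (𝟙 P.op) :=
  CatOperad.toArr_eqToHom h

theorem ofNode_perm_rel {r : ℕ} {C : M.Op r} {src : Fin r → Lab X} {tgt : Lab X}
    (a : Node X C src tgt) (ρ : Equiv.Perm (Fin r)) :
    Rel (Rep.Iso.permute ⟨r, C, src⟩ ρ) (.refl _) (ofNode (a.perm ρ)) (ofNode a) := by
  refine ⟨?_, fun k => ⟨ρ, Node.perm_rel a ρ, fun j => rfl⟩⟩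
  have h := (CatOperad.IsPerm.mk ρ C).arr_id
  rw [← toArr_ofNode_γ a, ← toArr_ofNode_γ (a.perm ρ)] at h
  exact h

theorem ofNode_id_rel (x : Lab X) :
    Rel (.refl (Rep.atom x)) (.refl _) (ofNode (Node.id x)) (id (Rep.atom x)) := by
  refine ⟨.of_eq_refl ?_, fun k => ⟨Equiv.refl _, .refl _,
    fun j => Subsingleton.elim (α := Fin 1) _ _⟩⟩
  exact (toArr_ofNode_γ _).trans (toArr_id_γ (Rep.atom x)).symm

theorem ofOp_rel {n : ℕ} {A B : M.Op n} (α : A ⟶ B) (lab : Fin n → Lab X) :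
    Rel (Rep.atomsIso ⟨n, A, lab⟩) (Rep.atomsIso ⟨n, B, lab⟩) (ofOp α lab)
      (act α fun i => id (Rep.atom (lab i))) := by
  constructor
  · rw [toArr_act_γ]
    simp only [toArr_id_γ]
    have h := CatOperad.IsPerm.compE_one (M := M.arr) (lex (fun _ : Fin n => 1) rfl) (M.toArr α)
      (σ := (Rep.atomsIso (⟨n, A, lab⟩ : Rep X)).σ) fun _ => rfl
    rw [CatOperad.compE_lex] at h
    have h' : M.toArr (ofOp α lab).γ = M.toArr α := CatOperad.toArr_comp_eqToHom _ _
    rw [h']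
    exact h
  · intro k
    obtain ⟨ρ, h1, h2⟩ := act_match α (fun i => id (Rep.atom (lab i))) k (0 : Fin 1)
    exact ⟨ρ, h1, fun j => h2 j⟩

theorem ofNodes_rel {P Q : Rep X} {r : Fin Q.n → ℕ} (e : (Σ k, Fin (r k)) ≃ Fin P.n)
    {C : ∀ k, M.Op (r k)} (h : P.op = M.compE e Q.op C) {src : ∀ k, Fin (r k) → Lab X}
    (hs : ∀ k j, src k j = P.lab (e ⟨k, j⟩)) (b : ∀ k, Node X (C k) (src k) (Q.lab k)) :
    Rel (Rep.nodesIso e h hs) (Rep.atomsIso Q) (ofNodes e h hs b)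
      (act (𝟙 Q.op) fun k => ofNode (b k)) := by
  constructor
  · rw [toArr_act_γ, toArr_ofNodes_γ]
    have h' := (Rep.nodesIso e h hs).op.arr_id
    simp only [toArr_ofNode_γ]
    have h2 := congrArg (fun a => M.toArr a) (M.compMap_id r rfl Q.op C)
    exact Eq.mp (congrArg (M.arr.IsPerm _ _) h2.symm) h'
  · intro k
    obtain ⟨ρ, h1, h2⟩ := act_match (𝟙 Q.op) (fun k => ofNode (b k)) k (0 : Fin 1)
    refine ⟨ρ, (Node.cast_rel _ _).trans h1, fun j => Eq.trans ?_ (h2 j)⟩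
    exact congrArg (lex r rfl) (e.symm_apply_apply _)

/-- The composition with a morphism of operations. -/
theorem ofOp_comp_rel {n : ℕ} {A B : M.Op n} (α : A ⟶ B) (lab : Fin n → Lab X) {Q : Rep X}
    (f : RepHom ⟨n, B, lab⟩ Q) :
    Rel (.refl _) (.refl _) (⟨f.r, f.e, f.C, α ≫ f.γ, f.node⟩ : RepHom ⟨n, A, lab⟩ Q)
      ((ofOp α lab).comp f) := by
  constructor
  · rw [toArr_comp_γ]
    have h := CatOperad.IsPerm.compE_one (M := M.arr) (Equiv.sigmaUnique (Fin n) fun _ => Fin 1)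
      (M.toArr f.γ) (σ := Equiv.refl _) fun _ => rfl
    refine .of_eq_refl (CatOperad.toArr_congr_comp (CatOperad.toArr_comp_eqToHom α _).symm ?_)
    exact h.eq_of_refl
  · exact (id_comp_rel f).node

/-- Every morphism is given by a morphism of operations, followed by the value of the operation of
its target on its nodes. -/
theorem ofOp_comp_ofNodes_rel {P Q : Rep X} (f : RepHom P Q) :
    Rel (.refl _) (.refl _) f
      ((ofOp f.γ P.lab).comp (ofNodes f.e rfl (fun _ _ => rfl) f.node)) := by
  have h := ofOp_comp_rel f.γ P.lab (ofNodes (P := ⟨P.n, _, P.lab⟩) f.e rfl (fun _ _ => rfl) f.node)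
  have e : (⟨f.r, f.e, f.C, f.γ ≫ 𝟙 _, f.node⟩ : RepHom P Q) = f := by
    rw [Category.comp_id]
  exact (congrArg (fun g => Rel (.refl P) (.refl Q) g ((ofOp f.γ P.lab).comp
    (ofNodes f.e rfl (fun _ _ => rfl) f.node))) e).mp h

theorem ofNode_comp_rel {s : ℕ} {r : Fin s → ℕ} {D : M.Op s} {C : ∀ j, M.Op (r j)}
    {src : ∀ j, Fin (r j) → Lab X} {mid : Fin s → Lab X} {tgt : Lab X}
    (b : ∀ j, Node X (C j) (src j) (mid j)) (a : Node X D mid tgt) :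
    Rel (.refl _) (.refl _) (ofNode (Node.comp b a))
      ((ofNodes (P := ⟨_, M.comp r rfl D C, fun l => src ((lex r rfl).symm l).1
        ((lex r rfl).symm l).2⟩) (Q := ⟨s, D, mid⟩) (lex r rfl)
        (M.compE_lex rfl D C).symm (fun k j => (Node.comp_src src k j).symm) b).comp
          (ofNode a)) := by
  constructor
  · refine .of_eq_refl ?_
    rw [toArr_ofNode_γ, toArr_comp_γ]
    set f := ofNodes (P := ⟨_, M.comp r rfl D C, fun l => src ((lex r rfl).symm l).1
        ((lex r rfl).symm l).2⟩) (Q := ⟨s, D, mid⟩) (lex r rfl)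
        (M.compE_lex rfl D C).symm (fun k j => (Node.comp_src src k j).symm) b
    have h' : M.toArr (M.compEMap f.e (ofNode a).γ fun l => 𝟙 (f.C l)) =
        M.toArr (𝟙 (M.compE f.e D f.C)) := by
      rw [← CatOperad.compEMap_id, CatOperad.toArr_compEMap, CatOperad.toArr_compEMap,
        toArr_ofNode_γ]
    refine Eq.trans ?_ (CatOperad.toArr_congr_comp rfl h'.symm)
    rw [Category.comp_id]
    exact CatOperad.toArr_eqToHom (M.compE_lex rfl D C).symm |>.symm
  · intro k
    have h := Node.comp_rel
      (b := fun j => (b j).cast (funext fun i => (Node.comp_src src j i).symm))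
      (b' := b) (π := Equiv.refl _) (fun _ => Equiv.refl _) (Node.Rel.refl a)
      fun j => (Node.cast_rel (b j) _).symm
    refine ⟨_, h, lex_ind r rfl fun j i => ?_⟩
    have e := lexCongr_lex (Equiv.refl (Fin s)) (fun j => Equiv.refl (Fin (r j))) j i
    refine Eq.trans ?_ (congrArg (fun x => nest (single s) (lex r rfl) ⟨k, x⟩) e).symm
    exact (nest_lex (single s) (lex r rfl) k j i).symm

/-- Morphisms of operations may be moved through a node. -/
theorem ofNode_precomp_mor {r : ℕ} {D C : M.Op r} {src : Fin r → Lab X} {tgt : Lab X} (α : D ⟶ C)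
    (a : Node X C src tgt) :
    (ofNode (a.precomp α)).mor = ((ofOp α src).comp (ofNode a)).mor := by
  refine Eq.trans ?_ (ofOp_comp_rel α src (ofNode a)).mk_eq
  refine (mk_eq_of_decompose (P := ⟨r, D, src⟩) (Q := Rep.atom tgt) (fun _ => r) (single r) _ _
    (fun _ => α) (fun _ => a) _ ?_ fun _ => rfl).symm
  refine (CatOperad.toArr_comp_eqToHom α (M.one_compE C).symm).trans ?_
  refine Eq.trans ?_ (CatOperad.toArr_eqToHom_comp (M.one_compE D).symm _).symm
  exact (M.arr.one_compE (M.toArr α)).symm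

end RepHom

end CatOp

/-! ### The universal evaluation of nodes -/

namespace CatOp

variable {M : CatOperad.{u}} {L : Type u} [SmallCategory L]

open Bicategory

variable {X : L ⥤ LaxAlg M} {S : Alg M}

namespace HocolimOps

variable (ops : HocolimOps X)

theorem actMap_val {n : ℕ} {B B' : M.Op n} {U V : Fin n → HocolimObj X} (β : B ⟶ B')
    {u : ∀ i, HocolimHom (U i) (V i)} {Y Y' : Fin n → Rep X} {f : ∀ i, RepHom (Y i) (Y' i)}
    (hf : ∀ i, (f i).mor = (u i).val) : (ops.actMap β u).val = (RepHom.act β f).mor := by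
  obtain ⟨Z, Z', g, hg, -, -, h⟩ := ops.exists_cls β u
  exact h.symm.trans (RepHom.act_congr β fun i => (hg i).trans (hf i).symm)

theorem id_val (P : Rep X) : (ops.id P.cls).val = (RepHom.id P).mor :=
  congrArg Subtype.val (ops.id_cls P)

/-- Every object of the homotopy colimit is the value of an operation on atoms. -/
theorem act_atoms (P : Rep X) : ops.act P.op (fun i => (Rep.atom (P.lab i)).cls) = P.cls :=
  (ops.act_cls P.op fun i => Rep.atom (P.lab i)).trans P.atomsIso.cls_eq.symm

/-- The class of the morphism given by a node, as a morphism from the value of an operation. -/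
def ofNode {r : ℕ} {C : M.Op r} {src : Fin r → Lab X} {tgt : Lab X} (a : Node X C src tgt) :
    HocolimHom (ops.act C fun j => (Rep.atom (src j)).cls) (Rep.atom tgt).cls :=
  ⟨(RepHom.ofNode a).mor, (ops.act_atoms ⟨r, C, src⟩).symm, rfl⟩

theorem actMap_id_val {n : ℕ} {A B : M.Op n} (α : A ⟶ B) (lab : Fin n → Lab X) :
    (ops.actMap α fun i => ops.id (Rep.atom (lab i)).cls).val = (RepHom.ofOp α lab).mor :=
  (ops.actMap_val α fun i => (ops.id_val (Rep.atom (lab i))).symm).trans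
    (RepHom.ofOp_rel α lab).mk_eq.symm

theorem actMap_ofNode_val {P Q : Rep X} {r : Fin Q.n → ℕ} (e : (Σ k, Fin (r k)) ≃ Fin P.n)
    {C : ∀ k, M.Op (r k)} (h : P.op = M.compE e Q.op C) {src : ∀ k, Fin (r k) → Lab X}
    (hs : ∀ k j, src k j = P.lab (e ⟨k, j⟩)) (b : ∀ k, Node X (C k) (src k) (Q.lab k)) :
    (ops.actMap (𝟙 Q.op) fun k => ops.ofNode (b k)).val = (RepHom.ofNodes e h hs b).mor :=
  (ops.actMap_val (f := fun k => RepHom.ofNode (b k)) (𝟙 Q.op) fun _ => rfl).trans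
    (RepHom.ofNodes_rel e h hs b).mk_eq.symm

/-- The universal evaluation of nodes, with values in the homotopy colimit. -/
def nodeEval : NodeEval X ops.toAlg where
  κ x := (Rep.atom x).cls
  ev a := ops.ofNode a
  ev_id x := HocolimHom.heq_of_val (ops.one_act _) rfl
    ((RepHom.ofNode_id_rel x).mk_eq.trans (ops.id_val _).symm)
  ev_comp {s r D C src mid tgt} b a := by
    have hs := fun k j => (Node.comp_src src k j).symm
    have ho : ops.act (M.comp r rfl D C) (fun l => (Rep.atom (src ((lex r rfl).symm l).1
        ((lex r rfl).symm l).2)).cls) =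
        ops.act D fun j => ops.act (C j) fun i => (Rep.atom (src j i)).cls :=
      (ops.comp_act r rfl D C _).trans (congrArg _ (funext fun k => congrArg _ (funext fun j =>
        congrArg (fun x => (Rep.atom x).cls) (Node.comp_src src k j))))
    refine HocolimHom.heq_of_val ho rfl ((RepHom.ofNode_comp_rel b a).mk_eq.trans
      (ops.val_comp (V := ops.act D fun j => (Rep.atom (mid j)).cls) ?_
        (ops.act_atoms ⟨s, D, mid⟩).symm rfl ?_ rfl).symm)
    · exact (ops.act_atoms ⟨_, M.comp r rfl D C, fun l => src ((lex r rfl).symm l).1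
        ((lex r rfl).symm l).2⟩).symm.trans ho
    · exact (ops.actMap_ofNode_val (P := ⟨_, M.comp r rfl D C, fun l => src ((lex r rfl).symm l).1
        ((lex r rfl).symm l).2⟩) (Q := ⟨s, D, mid⟩) (lex r rfl) (M.compE_lex rfl D C).symm hs
          b).symm
  ev_precomp {r D C src tgt} α a := by
    refine Subtype.ext ((RepHom.ofNode_precomp_mor α a).trans (ops.val_comp
      (V := ops.act C fun j => (Rep.atom (src j)).cls) (ops.act_atoms ⟨r, D, src⟩).symm
        (ops.act_atoms ⟨r, C, src⟩).symm rfl ?_ rfl).symm)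
    exact (ops.actMap_id_val α src).symm
  ev_perm {r C src tgt} a ρ := by
    refine HocolimHom.heq_of_val ?_ rfl (RepHom.ofNode_perm_rel a ρ).mk_eq
    exact ((ops.act_atoms (Rep.permute ⟨r, C, src⟩ ρ)).trans
      (Rep.Iso.permute ⟨r, C, src⟩ ρ).cls_eq).trans (ops.act_atoms ⟨r, C, src⟩).symm

theorem nodeEval_obj (P : Rep X) : ops.nodeEval.obj P = P.cls := ops.act_atoms P

/-- Every morphism of the homotopy colimit is the value of the universal evaluation of nodes on its
representatives. -/
theorem nodeEval_hom {P Q : Rep X} (f : RepHom P Q) : HEq (ops.nodeEval.hom f) f.cls := by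
  refine HocolimHom.heq_of_val (ops.act_atoms P) (ops.act_atoms Q) ?_
  refine Eq.trans ?_ (RepHom.ofOp_comp_ofNodes_rel f).mk_eq.symm
  refine ops.val_comp (V := ops.act (M.compE f.e Q.op f.C) fun i => (Rep.atom (P.lab i)).cls)
    (ops.act_atoms P).symm (ops.act_atoms ⟨P.n, M.compE f.e Q.op f.C, P.lab⟩).symm
    (ops.act_atoms Q).symm (ops.actMap_id_val f.γ P.lab).symm ?_
  refine (ops.actMap_ofNode_val (P := ⟨P.n, M.compE f.e Q.op f.C, P.lab⟩) f.e rfl (fun _ _ => rfl)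
    f.node).symm.trans ?_
  refine HocolimHom.mor_congr (ops.toAlg.act_compE f.e Q.op f.C
    fun i => (Rep.atom (P.lab i)).cls).symm rfl (ops.nodeEval.nodes_heq f).symm

end HocolimOps

end CatOp

/-! ### The universal property for 1-cells -/

namespace CatOp

variable {M : CatOperad.{u}} {L : Type u} [SmallCategory L]

open Bicategory

variable {X : L ⥤ LaxAlg M} {S T : Alg M}

namespace HocolimOps

variable (ops : HocolimOps X)

/-- The universal homotopy morphism. -/
def unit : HMor X (constObj L ops.toAlg) :=
  ops.nodeEval.toLaxCocone.toHMor

theorem isUniversal_unit : IsUniversal ops ops.unit where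
  obj _ _ := rfl
  map l K K' f := by
    refine (ops.nodeEval.map_eq l f).trans (HocolimHom.heq_of_val (ops.one_act _) rfl ?_)
    refine RepHom.Rel.mk_eq (s := .refl _) (t := .refl _) ⟨.of_eq_refl ?_, fun k =>
      ⟨Equiv.refl _, .refl _, fun j => Subsingleton.elim (α := Fin 1) _ _⟩⟩
    exact (CatOperad.toArr_eqToHom (M.one_compE M.one).symm).trans
      (CatOperad.toArr_eqToHom (M.compE_one M.one).symm).symm
  lax l n A K := HocolimHom.heq_of_val (ops.act_atoms ⟨n, A, fun i => ⟨l, K i⟩⟩) rfl rfl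
  nat {l l'} a K := by
    refine (ops.nodeEval.unary_heq (x := ⟨l, K⟩) (y := ⟨l', (X.map a).functor.obj K⟩) a
      (𝟙 _)).trans (HocolimHom.heq_of_val (ops.one_act _) rfl ?_)
    refine RepHom.Rel.mk_eq (s := .refl _) (t := .refl _) ⟨.of_eq_refl ?_, fun k =>
      ⟨Equiv.refl _, ⟨.refl _, fun _ => rfl, rfl, fun _ => HEq.rfl, ?_⟩,
        fun j => Subsingleton.elim (α := Fin 1) _ _⟩⟩
    · exact (CatOperad.toArr_eqToHom (M.one_compE M.one).symm).trans
        (CatOperad.toArr_eqToHom (M.compE_one M.one).symm).symm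
    · exact heq_of_eq (Category.comp_id _)

end HocolimOps

namespace NodeEval

theorem ext_of {E E' : NodeEval X S} (h : ∀ x, E.κ x = E'.κ x)
    (h' : ∀ {r : ℕ} {C : M.Op r} {src : Fin r → Lab X} {tgt : Lab X} (a : Node X C src tgt),
      HEq (E.ev a) (E'.ev a)) : E = E' := by
  obtain ⟨κ, ev, _, _, _, _⟩ := E
  obtain ⟨κ', ev', _, _, _, _⟩ := E'
  obtain rfl : κ = κ' := funext h
  obtain rfl : @ev = @ev' := by
    funext r C src tgt a
    exact eq_of_heq (h' a)
  rfl

/-- The composite of an evaluation of nodes with a strict homomorphism. -/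
def comp (E : NodeEval X S) (f : StrictHom S T) : NodeEval X T where
  κ x := f.functor.obj (E.κ x)
  ev {r C src tgt} a := eqToHom (f.map_act C _).symm ≫ f.functor.map (E.ev a)
  ev_id x := by
    refine (eqToHom_comp_heq _ _).trans ((map_heq f.functor (S.one_act _) rfl (E.ev_id x)).trans ?_)
    exact heq_of_eq (f.functor.map_id _)
  ev_comp {s r D C src mid tgt} b a := by
    have hx := fun j => f.map_act (C j) fun i => E.κ (src j i)
    refine (eqToHom_comp_heq _ _).trans ((map_heq f.functor ?_ rfl (E.ev_comp b a)).trans ?_)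
    · exact (S.comp_act r rfl D C _).trans (congrArg _ (funext fun k => congrArg _ (funext fun j =>
        congrArg E.κ (Node.comp_src src k j))))
    refine (heq_of_eq (f.functor.map_comp _ _)).trans (heq_comp ((f.map_act D _).trans
      (congrArg _ (funext hx))) (f.map_act D _) rfl ?_ (eqToHom_comp_heq _ _).symm)
    refine (f.map_actMap (𝟙 D) fun j => E.ev (b j)).trans ?_
    exact T.actMap_heq rfl rfl hx (fun _ => rfl) HEq.rfl fun j => (eqToHom_comp_heq _ _).symm
  ev_precomp {r D C src tgt} α a := by
    have h := f.map_actMap α fun j => 𝟙 (E.κ (src j))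
    simp only [CategoryTheory.Functor.map_id] at h
    rw [E.ev_precomp, f.functor.map_comp]
    exact eq_of_heq ((eqToHom_comp_heq _ _).trans (heq_comp (f.map_act D _) (f.map_act C _) rfl h
      (eqToHom_comp_heq _ _).symm))
  ev_perm a ρ := by
    refine (eqToHom_comp_heq _ _).trans ((map_heq f.functor ?_ rfl (E.ev_perm a ρ)).trans
      (eqToHom_comp_heq _ _).symm)
    exact S.act_isPerm (CatOperad.IsPerm.mk ρ _) fun _ => rfl

theorem comp_ev_heq (E : NodeEval X S) (f : StrictHom S T) {r : ℕ} {C : M.Op r}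
    {src : Fin r → Lab X} {tgt : Lab X} (a : Node X C src tgt) :
    HEq ((E.comp f).ev a) (f.functor.map (E.ev a)) :=
  eqToHom_comp_heq _ _

theorem comp_obj (E : NodeEval X S) (f : StrictHom S T) (P : Rep X) :
    (E.comp f).obj P = f.functor.obj (E.obj P) :=
  (f.map_act P.op _).symm

/-- A strict homomorphism commutes with the values on morphisms of representatives. -/
theorem comp_hom (E : NodeEval X S) (f : StrictHom S T) {P Q : Rep X} (p : RepHom P Q) :
    HEq ((E.comp f).hom p) (f.functor.map (E.hom p)) := by
  have h1 := f.map_actMap p.γ fun i => 𝟙 (E.κ (P.lab i))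
  simp only [CategoryTheory.Functor.map_id] at h1
  have hx := fun k => (f.map_act (p.C k) fun j => E.κ (P.lab (p.e ⟨k, j⟩))).symm
  have h2 : HEq ((E.comp f).nodes p) (f.functor.map (E.nodes p)) := by
    refine ((E.comp f).nodes_heq p).trans (HEq.trans ?_ (map_heq f.functor (S.act_compE _ _ _ _) rfl
      (E.nodes_heq p)).symm)
    refine HEq.trans ?_ (f.map_actMap (𝟙 Q.op) fun k => E.ev (p.node k)).symm
    exact T.actMap_heq rfl rfl hx (fun _ => rfl) HEq.rfl fun k => E.comp_ev_heq f _
  refine HEq.trans ?_ (heq_of_eq (f.functor.map_comp _ _).symm)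
  exact heq_comp (f.map_act P.op _).symm (f.map_act _ _).symm (f.map_act Q.op _).symm h1.symm h2

/-- Together with `LaxCocone.toNodeEval_toLaxCocone`, this identifies evaluations of nodes with lax
cocones. -/
theorem toLaxCocone_toNodeEval (E : NodeEval X S) : E.toLaxCocone.toNodeEval = E :=
  ext_of (fun _ => rfl) fun a => heq_of_eq (E.toLaxCocone_ev a)

end NodeEval

namespace LaxCocone

theorem ext_of {k k' : LaxCocone X S} (h : k.toHMor = k'.toHMor) : k = k' :=
  congrArg HMor.toLaxCocone h

theorem toNodeEval_unary (k : LaxCocone X S) {x y : Lab X} (a : x.1 ⟶ y.1)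
    (f : (X.map a).functor.obj x.2 ⟶ y.2) :
    k.toNodeEval.unary a f = k.θ a x.2 ≫ (k.app y.1).functor.map f := by
  have h := (X.obj y.1).alg.one_act fun _ => (X.map a).functor.obj x.2
  refine eq_of_heq ((k.toNodeEval.unary_heq a f).trans ((heq_comp (S.one_act _) (S.one_act _) rfl
    (S.one_actMap _) (heq_comp (S.one_act _) (congrArg (k.app y.1).functor.obj h) rfl
      ((k.app y.1).lax_one _) (map_heq (k.app y.1).functor h rfl
        (eqToHom_comp_heq f h)))).trans ?_))
  exact heq_of_eq (congrArg (fun z => k.θ a x.2 ≫ z) (Category.id_comp _))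

theorem toNodeEval_map (k : LaxCocone X S) (l : L) {K K' : (X.obj l).alg.carrier} (f : K ⟶ K') :
    k.toNodeEval.map l f = (k.app l).functor.map f := by
  have h := HMor.map_id_obj X l K
  refine (k.toNodeEval_unary (x := ⟨l, K⟩) (y := ⟨l, K'⟩) _ _).trans (eq_of_heq ?_)
  refine (heq_comp rfl (congrArg (k.app l).functor.obj h) rfl (k.θ_id l K)
    (map_heq (k.app l).functor h rfl (eqToHom_comp_heq f h))).trans ?_
  exact heq_of_eq (Category.id_comp _)

theorem ev_eval (k : LaxCocone X S) {l : L} {n : ℕ} (A : M.Op n)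
    (x : Fin n → (X.obj l).alg.carrier) : k.ev (Node.eval A x) = (k.app l).lax A x := by
  have h := fun i => HMor.map_id_obj X l (x i)
  have hk := fun i => congrArg (k.app l).functor.obj (h i)
  have h' := congrArg ((X.obj l).alg.act A) (funext h)
  have e1 : HEq (S.actMap (𝟙 A) fun i => k.θ (𝟙 l) (x i))
      (𝟙 (S.act A fun i => (k.app l).functor.obj (x i))) := by
    rw [← S.actMap_id]
    exact S.actMap_heq rfl rfl (fun _ => rfl) hk HEq.rfl fun i => k.θ_id l (x i)
  have e2 : HEq ((k.app l).functor.map (Node.eval A x).map)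
      (𝟙 ((k.app l).functor.obj ((X.obj l).alg.act A x))) := by
    rw [← CategoryTheory.Functor.map_id]
    exact map_heq (k.app l).functor h' rfl (Node.eval_map_heq A x)
  refine eq_of_heq ((heq_comp rfl (congrArg (S.act A) (funext hk)) rfl e1 (heq_comp
    (congrArg (S.act A) (funext hk)) (congrArg (k.app l).functor.obj h') rfl
      ((k.app l).lax_heq A h) e2)).trans ?_)
  exact heq_of_eq ((Category.id_comp _).trans (Category.comp_id _))

theorem toNodeEval_toLaxCocone (k : LaxCocone X S) : k.toNodeEval.toLaxCocone = k := by
  refine ext_of (HMor.ext_of (fun l => LaxHom.ext_of ?_ fun n A x => ?_) fun l l' a x => ?_)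
  · exact CategoryTheory.Functor.hext (fun _ => rfl) fun _ _ f => heq_of_eq (k.toNodeEval_map l f)
  · exact heq_of_eq (k.ev_eval A x)
  · refine heq_of_eq ((k.toNodeEval_unary (x := ⟨l, x⟩)
      (y := ⟨l', (X.map a).functor.obj x⟩) a
      (𝟙 ((X.map a).functor.obj x))).trans ?_)
    refine (congrArg (fun z => k.θ a x ≫ z) ((k.app l').functor.map_id _)).trans ?_
    exact Category.comp_id _

end LaxCocone

theorem NodeEval.comp_unary (E : NodeEval X S) (f : StrictHom S T) {x y : Lab X} (a : x.1 ⟶ y.1)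
    (g : (X.map a).functor.obj x.2 ⟶ y.2) :
    (E.comp f).unary a g = f.functor.map (E.unary a g) := by
  refine eq_of_heq (((E.comp f).unary_heq a g).trans ((E.comp_ev_heq f _).trans ?_))
  exact map_heq f.functor (S.one_act _) rfl (E.unary_heq a g).symm

/-- The composite with a strict homomorphism, in terms of the evaluation of nodes. -/
theorem NodeEval.toHMor_comp (E : NodeEval X S) (f : StrictHom S T) :
    E.toLaxCocone.toHMor.comp (constMap L f) = (E.comp f).toLaxCocone.toHMor := by
  refine HMor.ext_of (fun l => LaxHom.ext_of ?_ fun n A x => HEq.rfl) fun l l' a x => ?_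
  · exact CategoryTheory.Functor.hext (fun _ => rfl) fun _ _ g =>
      heq_of_eq (E.comp_unary f _ _).symm
  · refine heq_of_eq ((HMor.comp_nat_nat_app _ (constMap L f) a x).trans ?_)
    have h := idSquare_app (S := ⟨S⟩) (T := ⟨T⟩) f.toLax (E.κ ⟨l, x⟩)
    refine (congrArg (fun z => z ≫ f.functor.map (E.unary (x := ⟨l, x⟩)
      (y := ⟨l', (X.map a).functor.obj x⟩) a (𝟙 ((X.map a).functor.obj x))))
      h).trans ?_
    exact (Category.id_comp _).trans (E.comp_unary f _ _).symm

theorem NodeEval.hom_ofNode (E : NodeEval X S) {r : ℕ} {C : M.Op r} {src : Fin r → Lab X}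
    {tgt : Lab X} (a : Node X C src tgt) : HEq (E.hom (RepHom.ofNode a)) (E.ev a) := by
  have h1 : HEq (S.actMap (RepHom.ofNode a).γ fun i => 𝟙 (E.κ (src i)))
      (𝟙 (S.act C fun i => E.κ (src i))) := by
    have := S.actMap_comp_eqToHom (𝟙 C) (M.one_compE C).symm fun i => 𝟙 (E.κ (src i))
    rw [Category.id_comp] at this
    exact this.trans (heq_of_eq (S.actMap_id _ _))
  have h2 : HEq (E.nodes (RepHom.ofNode a)) (E.ev a) :=
    (E.nodes_heq _).trans (S.one_actMap _)
  exact (heq_comp rfl (congrArg (fun A => S.act A fun i => E.κ (src i)) (M.one_compE C))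
    (S.one_act _) h1 h2).trans (heq_of_eq (Category.id_comp _))

namespace HocolimOps

variable (ops : HocolimOps X)

/-- The strict homomorphism given by an evaluation of nodes restricts to this evaluation. -/
theorem nodeEval_comp_toStrictHom (E : NodeEval X S) :
    ops.nodeEval.comp (E.toStrictHom ops) = E := by
  refine NodeEval.ext_of (fun x => S.one_act _) fun a => ?_
  refine (NodeEval.comp_ev_heq _ _ a).trans (HEq.trans ?_ (E.hom_ofNode a))
  exact E.homCls_heq (u := ops.ofNode a) rfl

/-- A strict homomorphism is determined by its restriction to nodes. -/
theorem toStrictHom_nodeEval_comp (f : StrictHom ops.toAlg S) :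
    (ops.nodeEval.comp f).toStrictHom ops = f := by
  refine StrictHom.ext_of (CategoryTheory.Functor.hext (fun U => ?_) fun U V u => ?_)
  · obtain ⟨P, rfl⟩ := Quot.exists_rep U
    exact (ops.nodeEval.comp_obj f P).trans (congrArg f.functor.obj (ops.nodeEval_obj P))
  · obtain ⟨P, Q, p, rfl, rfl, h⟩ := HocolimHom.exists_rep u
    obtain rfl := HocolimHom.eq_cls h
    refine ((ops.nodeEval.comp f).homCls_heq (f := p) rfl).trans
      ((ops.nodeEval.comp_hom f p).trans ?_)
    exact map_heq f.functor (ops.nodeEval_obj P) (ops.nodeEval_obj Q) (ops.nodeEval_hom p)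

theorem unit_comp (f : StrictHom ops.toAlg S) :
    ops.unit.comp (constMap L f) = (ops.nodeEval.comp f).toLaxCocone.toHMor :=
  ops.nodeEval.toHMor_comp f

/-- The universal property of the homotopy colimit for 1-cells. -/
theorem bijective_unit_comp (S : Alg M) :
    Function.Bijective fun f : StrictHom ops.toAlg S => ops.unit.comp (constMap L f) := by
  constructor
  · intro f g h
    have h1 := (ops.unit_comp f).symm.trans (h.trans (ops.unit_comp g))
    have h2 := congrArg LaxCocone.toNodeEval (LaxCocone.ext_of h1)
    rw [NodeEval.toLaxCocone_toNodeEval, NodeEval.toLaxCocone_toNodeEval] at h2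
    rw [← ops.toStrictHom_nodeEval_comp f, h2, ops.toStrictHom_nodeEval_comp]
  · intro k
    refine ⟨k.toLaxCocone.toNodeEval.toStrictHom ops, (ops.unit_comp _).trans ?_⟩
    rw [nodeEval_comp_toStrictHom, LaxCocone.toNodeEval_toLaxCocone]
    rfl

end HocolimOps

end CatOp

/-! ### The universal property for 2-cells -/

namespace CatOp

variable {M : CatOperad.{u}} {L : Type u} [SmallCategory L]

open Bicategory

variable {X : L ⥤ LaxAlg M} {S : Alg M}

/-- A morphism between evaluations of nodes. -/
structure NodeEval.Trans (E E' : NodeEval X S) where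
  app : ∀ x : Lab X, E.κ x ⟶ E'.κ x
  ev_app : ∀ {r : ℕ} {C : M.Op r} {src : Fin r → Lab X} {tgt : Lab X} (a : Node X C src tgt),
    E.ev a ≫ app tgt = S.actMap (𝟙 C) (fun j => app (src j)) ≫ E'.ev a

/-- A 2-cell between homotopy morphisms to a constant diagram is compatible with the values on
nodes. -/
def HMor₂.toTrans {k k' : HMor X (constObj L S)} (s : k ⟶ k') :
    k.toLaxCocone.toNodeEval.Trans k'.toLaxCocone.toNodeEval where
  app x := (s.app x.1).nat.app x.2
  ev_app {r C src tgt} a := by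
    have h1 : ∀ j, k.toLaxCocone.θ (a.lam j) (src j).2 ≫
        (s.app tgt.1).nat.app ((X.map (a.lam j)).functor.obj (src j).2) =
        (s.app (src j).1).nat.app (src j).2 ≫ k'.toLaxCocone.θ (a.lam j) (src j).2 := fun j =>
      congrArg (fun z => (LaxHom₂.nat z).app (src j).2) (s.comm (a.lam j)).symm
    have h2 := (s.app tgt.1).nat_lax C fun j => (X.map (a.lam j)).functor.obj (src j).2
    have h3 := (s.app tgt.1).nat.naturality a.map
    refine (Category.assoc _ _ _).trans ((congrArg (fun z => _ ≫ z) ((Category.assoc _ _ _).trans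
      ((congrArg (fun z => _ ≫ z) h3).trans ((comm_assoc h2.symm _))))).trans ?_)
    refine (Category.assoc _ _ _).symm.trans (Eq.trans ?_ (Category.assoc _ _ _))
    refine congrArg (fun z => z ≫ _) ?_
    refine (S.actMap_id_comp C _ _).symm.trans (Eq.trans ?_ (S.actMap_id_comp C _ _))
    exact congrArg (S.actMap (𝟙 C)) (funext h1)

namespace NodeEval.Trans

variable {E E' : NodeEval X S} (s : E.Trans E') {P P' Q : Rep X}

/-- The component at an object of the category of representatives. -/
def obj (P : Rep X) : E.obj P ⟶ E'.obj P := S.actMap (𝟙 P.op) fun i => s.app (P.lab i)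

theorem app_congr {x y : Lab X} (h : x = y) : HEq (s.app x) (s.app y) := by
  rw [h]

theorem obj_iso (i : Rep.Iso P' P) : HEq (s.obj P') (s.obj P) :=
  S.actMap_id_isPerm i.op (fun j => congrArg E.κ (i.lab j)) (fun j => congrArg E'.κ (i.lab j))
    fun j => s.app_congr (i.lab j)

theorem obj_act {n : ℕ} (B : M.Op n) (Y : Fin n → Rep X) :
    HEq (s.obj (Rep.act B Y)) (S.actMap (𝟙 B) fun i => s.obj (Y i)) := by
  have hl := Rep.act_lab B Y
  have h := S.comp_actMap (fun i => (Y i).n) rfl (𝟙 B) (fun i => 𝟙 (Y i).op)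
    fun l => s.app ((Rep.act B Y).lab l)
  rw [M.compMap_id] at h
  refine h.trans (S.actMap_heq rfl rfl
    (fun i => congrArg _ (funext fun j => congrArg E.κ (hl i j)))
    (fun i => congrArg _ (funext fun j => congrArg E'.κ (hl i j))) HEq.rfl fun i => ?_)
  exact S.actMap_heq rfl rfl (fun j => congrArg E.κ (hl i j)) (fun j => congrArg E'.κ (hl i j))
    HEq.rfl fun j => s.app_congr (hl i j)

theorem nodes_obj (f : RepHom P Q) : E.nodes f ≫ s.obj Q =
    S.actMap (𝟙 (M.compE f.e Q.op f.C)) (fun i => s.app (P.lab i)) ≫ E'.nodes f := by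
  have h := S.actMap_compEMap f.e (𝟙 Q.op) (fun k => 𝟙 (f.C k)) fun i => s.app (P.lab i)
  rw [M.compEMap_id] at h
  refine eq_of_heq ((heq_comp (S.act_compE f.e Q.op f.C fun i => E.κ (P.lab i)) rfl rfl
    (E.nodes_heq f) HEq.rfl).trans (HEq.trans (heq_of_eq ?_)
      (heq_comp (S.act_compE f.e Q.op f.C fun i => E.κ (P.lab i))
        (S.act_compE f.e Q.op f.C fun i => E'.κ (P.lab i)) rfl h (E'.nodes_heq f)).symm))
  refine (S.actMap_id_comp Q.op _ _).symm.trans (Eq.trans ?_ (S.actMap_id_comp Q.op _ _))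
  exact congrArg (S.actMap (𝟙 Q.op)) (funext fun k => s.ev_app (f.node k))

/-- Naturality on nodes gives naturality on all morphisms of representatives. -/
theorem naturality (f : RepHom P Q) : E.hom f ≫ s.obj Q = s.obj P ≫ E'.hom f := by
  have h1 := S.actMap_comp f.γ (𝟙 _) (fun i => 𝟙 (E.κ (P.lab i))) fun i => s.app (P.lab i)
  have h2 := S.actMap_comp (𝟙 P.op) f.γ (fun i => s.app (P.lab i)) fun i => 𝟙 (E'.κ (P.lab i))
  simp only [Category.id_comp, Category.comp_id] at h1 h2
  refine (Category.assoc _ _ _).trans ((congrArg (fun z => _ ≫ z) (s.nodes_obj f)).trans ?_)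
  exact comm_assoc (h1.symm.trans h2) _

/-- The component at an object of the homotopy colimit. -/
def objCls (U : HocolimObj X) : E.objCls U ⟶ E'.objCls U :=
  Quot.hrecOn (motive := fun U => E.objCls U ⟶ E'.objCls U) U (fun P => s.obj P) fun _ P h => by
    obtain ⟨_, σ⟩ := h
    exact s.obj_iso (.permute P σ)

theorem objCls_congr {U V : HocolimObj X} (h : U = V) : HEq (s.objCls U) (s.objCls V) := by
  rw [h]

/-- The 2-cell between strict homomorphisms on the homotopy colimit given by a morphism of
evaluations of nodes. -/
def toStrictHom₂ (ops : HocolimOps X) : E.toStrictHom ops ⟶ E'.toStrictHom ops where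
  nat :=
    { app := s.objCls
      naturality := fun U V u => by
        obtain ⟨P, Q, f, rfl, rfl, h⟩ := HocolimHom.exists_rep u
        have h1 : E.homCls u = E.hom f := eq_of_heq (E.homCls_heq h)
        have h2 : E'.homCls u = E'.hom f := eq_of_heq (E'.homCls_heq h)
        exact (congrArg (fun z => z ≫ s.obj Q) h1).trans
          ((s.naturality f).trans (congrArg (fun z => s.obj P ≫ z) h2).symm) }
  nat_act A U := by
    obtain ⟨Y, rfl⟩ := HocolimObj.exists_reps U
    exact (s.objCls_congr (ops.act_cls A Y)).trans (s.obj_act A Y)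

theorem toStrictHom₂_app (ops : HocolimOps X) (x : Lab X) :
    HEq ((s.toStrictHom₂ ops).nat.app (Rep.atom x).cls) (s.app x) :=
  S.one_actMap _

end NodeEval.Trans

namespace HocolimOps

variable (ops : HocolimOps X)

/-- A 2-cell is determined by its components at atoms, since every object is the value of an
operation on atoms. -/
theorem hom₂_ext {f g : StrictHom ops.toAlg S} {t t' : f ⟶ g}
    (h : ∀ x : Lab X, t.nat.app (Rep.atom x).cls = t'.nat.app (Rep.atom x).cls) : t = t' := by
  refine StrictHom.hom_ext fun U => ?_
  obtain ⟨P, rfl⟩ := Quot.exists_rep U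
  have e := ops.act_atoms P
  refine eq_of_heq ((app_heq t.nat e.symm).trans (HEq.trans ?_ (app_heq t'.nat e)))
  refine (t.nat_act P.op _).trans (HEq.trans (heq_of_eq ?_) (t'.nat_act P.op _).symm)
  exact congrArg (S.actMap (𝟙 P.op)) (funext fun i => h (P.lab i))

theorem toStrictHom_unit_comp (f : StrictHom ops.toAlg S) :
    (ops.unit.comp (constMap L f)).toLaxCocone.toNodeEval.toStrictHom ops = f := by
  rw [unit_comp]
  exact (congrArg (fun E => NodeEval.toStrictHom E ops) (NodeEval.toLaxCocone_toNodeEval _)).trans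
    (ops.toStrictHom_nodeEval_comp f)

/-- The universal property of the homotopy colimit for 2-cells. -/
theorem bijective_unit_whiskerL (f g : StrictHom ops.toAlg S) :
    Function.Bijective fun t : f ⟶ g => HMor.whiskerL ops.unit (constMap₂ L t) := by
  constructor
  · intro t t' h
    exact ops.hom₂_ext fun x => congrArg (fun z => (HMor₂.app z x.1).nat.app x.2) h
  · intro s
    refine ⟨eqToHom (ops.toStrictHom_unit_comp f).symm ≫ s.toTrans.toStrictHom₂ ops ≫
      eqToHom (ops.toStrictHom_unit_comp g), HMor.hom_ext fun l x => eq_of_heq ?_⟩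
    refine HEq.trans (heq_of_eq ((StrictHom.comp_nat_app _ _ _).trans (congrArg₂ (· ≫ ·)
      (StrictHom.eqToHom_nat_app _ _) ((StrictHom.comp_nat_app _ _ _).trans
        (congrArg (fun z => _ ≫ z) (StrictHom.eqToHom_nat_app _ _)))))) ?_
    refine (eqToHom_comp_heq _ _).trans ((comp_eqToHom_heq _ _).trans ?_)
    exact s.toTrans.toStrictHom₂_app ops ⟨l, x⟩

end HocolimOps

end CatOp

/-! ### Universal arrows and 2-adjunctions -/

namespace CatOp

open Bicategory

theorem eqToHom_conj_heq {C : Type*} [Category C] {x y x' y' : C} (h : x' = x) (f : x ⟶ y)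
    (h' : y = y') :
    HEq (eqToHom h ≫ f ≫ eqToHom h') f := by
  subst h h'
  simp

section Strict

universe w₁ w₂ v₁ v₂ u₁ u₂

variable {B : Type u₁} [Bicategory.{w₁, v₁} B]
  {C : Type u₂} [Bicategory.{w₂, v₂} C]

theorem whiskerLeft_heq {a b c : B} {f f' : a ⟶ b} {g h g' h' : b ⟶ c} {η : g ⟶ h} {η' : g' ⟶ h'}
    (hf : f = f') (hg : g = g') (hh : h = h') (hη : HEq η η') : HEq (f ◁ η) (f' ◁ η') := by
  subst hf hg hh
  rw [eq_of_heq hη]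

theorem whiskerRight_heq {a b c : B} {f g f' g' : a ⟶ b} {h h' : b ⟶ c} {η : f ⟶ g} {η' : f' ⟶ g'}
    (hf : f = f') (hg : g = g') (hη : HEq η η') (hh : h = h') : HEq (η ▷ h) (η' ▷ h') := by
  subst hf hg hh
  rw [eq_of_heq hη]

theorem map₂_whiskerLeft_heq (G : StrictPseudofunctor C B) {a b c : C} (f : a ⟶ b) {g h : b ⟶ c}
    (η : g ⟶ h) :
    HEq (G.map₂ (f ◁ η)) (G.map f ◁ G.map₂ η) := by
  rw [G.map₂_whisker_left, G.mapComp_eq_eqToIso, G.mapComp_eq_eqToIso, eqToIso.hom, eqToIso.inv]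
  exact eqToHom_conj_heq _ _ _

theorem map₂_whiskerRight_heq (G : StrictPseudofunctor C B) {a b c : C} {f g : a ⟶ b} (η : f ⟶ g)
    (h : b ⟶ c) :
    HEq (G.map₂ (η ▷ h)) (G.map₂ η ▷ G.map h) := by
  rw [G.map₂_whisker_right, G.mapComp_eq_eqToIso, G.mapComp_eq_eqToIso, eqToIso.hom, eqToIso.inv]
  exact eqToHom_conj_heq _ _ _

variable [Strict B] [Strict C]

theorem comp_whiskerLeft_heq {a b c d : B} (f : a ⟶ b) (g : b ⟶ c) {h h' : c ⟶ d} (η : h ⟶ h') :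
    HEq ((f ≫ g) ◁ η) (f ◁ g ◁ η) := by
  rw [comp_whiskerLeft, Strict.associator_eqToIso, Strict.associator_eqToIso,
    eqToIso.hom, eqToIso.inv]
  exact eqToHom_conj_heq _ _ _

theorem whiskerRight_comp_heq {a b c d : B} {f f' : a ⟶ b} (η : f ⟶ f') (g : b ⟶ c) (h : c ⟶ d) :
    HEq (η ▷ (g ≫ h)) (η ▷ g ▷ h) := by
  rw [whiskerRight_comp, Strict.associator_eqToIso, Strict.associator_eqToIso,
    eqToIso.hom, eqToIso.inv]
  exact eqToHom_conj_heq _ _ _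

theorem whisker_assoc_heq {a b c d : B} (f : a ⟶ b) {g g' : b ⟶ c} (η : g ⟶ g') (h : c ⟶ d) :
    HEq ((f ◁ η) ▷ h) (f ◁ η ▷ h) := by
  rw [whisker_assoc, Strict.associator_eqToIso, Strict.associator_eqToIso,
    eqToIso.hom, eqToIso.inv]
  exact eqToHom_conj_heq _ _ _

variable (G : StrictPseudofunctor C B)

/-- A choice of universal arrows to a 2-functor `G` between strict 2-categories. -/
structure UniversalArrows where
  obj : B → C
  unit : ∀ X : B, X ⟶ G.obj (obj X)
  bijective : ∀ (X : B) (S : C), Function.Bijective fun r : obj X ⟶ S => unit X ≫ G.map r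
  bijective₂ : ∀ (X : B) (S : C) (r r' : obj X ⟶ S),
    Function.Bijective fun t : r ⟶ r' => unit X ◁ G.map₂ t

namespace UniversalArrows

variable {G} (U : UniversalArrows G)

/-- 1-cells out of `U.obj X` are equal if they agree after composition with the unit. -/
theorem ext {X : B} {S : C} {r r' : U.obj X ⟶ S} (h : U.unit X ≫ G.map r = U.unit X ≫ G.map r') :
    r = r' :=
  (U.bijective X S).1 h

theorem ext_heq {X : B} {S : C} {r₁ r₂ r₁' r₂' : U.obj X ⟶ S} {t : r₁ ⟶ r₂} {t' : r₁' ⟶ r₂'}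
    (h₁ : r₁ = r₁') (h₂ : r₂ = r₂') (h : HEq (U.unit X ◁ G.map₂ t) (U.unit X ◁ G.map₂ t')) :
    HEq t t' := by
  subst h₁ h₂
  exact heq_of_eq ((U.bijective₂ X S _ _).1 (eq_of_heq h))

theorem exists_map {X Y : B} (f : X ⟶ Y) :
    ∃ r : U.obj X ⟶ U.obj Y, U.unit X ≫ G.map r = f ≫ U.unit Y :=
  (U.bijective X (U.obj Y)).2 _

/-- The 1-cell induced by a 1-cell. -/
noncomputable def map {X Y : B} (f : X ⟶ Y) : U.obj X ⟶ U.obj Y := (U.exists_map f).choose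

theorem unit_map {X Y : B} (f : X ⟶ Y) : U.unit X ≫ G.map (U.map f) = f ≫ U.unit Y :=
  (U.exists_map f).choose_spec

theorem exists_map₂ {X Y : B} {f g : X ⟶ Y} (s : f ⟶ g) : ∃ t : U.map f ⟶ U.map g,
    U.unit X ◁ G.map₂ t =
      eqToHom (U.unit_map f) ≫ s ▷ U.unit Y ≫ eqToHom (U.unit_map g).symm :=
  (U.bijective₂ X (U.obj Y) _ _).2 _

/-- The 2-cell induced by a 2-cell. -/
noncomputable def map₂ {X Y : B} {f g : X ⟶ Y} (s : f ⟶ g) : U.map f ⟶ U.map g :=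
  (U.exists_map₂ s).choose

theorem unit_map₂ {X Y : B} {f g : X ⟶ Y} (s : f ⟶ g) : U.unit X ◁ G.map₂ (U.map₂ s) =
    eqToHom (U.unit_map f) ≫ s ▷ U.unit Y ≫ eqToHom (U.unit_map g).symm :=
  (U.exists_map₂ s).choose_spec

theorem unit_map₂_heq {X Y : B} {f g : X ⟶ Y} (s : f ⟶ g) :
    HEq (U.unit X ◁ G.map₂ (U.map₂ s)) (s ▷ U.unit Y) := by
  rw [unit_map₂]
  exact eqToHom_conj_heq _ _ _

theorem map_id (X : B) : U.map (𝟙 X) = 𝟙 (U.obj X) :=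
  U.ext (by rw [unit_map, G.map_id, Strict.id_comp, Strict.comp_id])

theorem map_comp {X Y Z : B} (f : X ⟶ Y) (g : Y ⟶ Z) : U.map (f ≫ g) = U.map f ≫ U.map g :=
  U.ext (by rw [unit_map, G.map_comp, Strict.assoc f g, ← Strict.assoc (U.unit X), unit_map,
    Strict.assoc f (U.unit Y), unit_map])

theorem map₂_whiskerLeft {X Y Z : B} (f : X ⟶ Y) {g g' : Y ⟶ Z} (η : g ⟶ g') :
    HEq (U.map₂ (f ◁ η)) (U.map f ◁ U.map₂ η) := by
  refine U.ext_heq (U.map_comp f g) (U.map_comp f g') ((U.unit_map₂_heq _).trans ?_)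
  refine (whisker_assoc_heq f η _).trans (HEq.symm ?_)
  refine (whiskerLeft_heq rfl (G.map_comp _ _) (G.map_comp _ _)
    (map₂_whiskerLeft_heq G _ _)).trans ((comp_whiskerLeft_heq _ _ _).symm.trans ?_)
  refine (whiskerLeft_heq (U.unit_map f) rfl rfl HEq.rfl).trans
    ((comp_whiskerLeft_heq _ _ _).trans ?_)
  exact whiskerLeft_heq rfl (U.unit_map g) (U.unit_map g') (U.unit_map₂_heq η)

theorem map₂_whiskerRight {X Y Z : B} {f f' : X ⟶ Y} (η : f ⟶ f') (g : Y ⟶ Z) :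
    HEq (U.map₂ (η ▷ g)) (U.map₂ η ▷ U.map g) := by
  refine U.ext_heq (U.map_comp f g) (U.map_comp f' g) ((U.unit_map₂_heq _).trans ?_)
  refine (whiskerRight_comp_heq η g _).symm.trans (HEq.symm ?_)
  refine (whiskerLeft_heq rfl (G.map_comp _ _) (G.map_comp _ _)
    (map₂_whiskerRight_heq G _ _)).trans ((whisker_assoc_heq _ _ _).symm.trans ?_)
  refine (whiskerRight_heq (U.unit_map f) (U.unit_map f') (U.unit_map₂_heq η) rfl).trans ?_
  refine (whiskerRight_comp_heq η _ _).symm.trans ?_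
  exact whiskerRight_heq rfl rfl HEq.rfl (U.unit_map g)

/-- The 2-functor given by a choice of universal arrows. -/
noncomputable def functor : StrictPseudofunctor B C :=
  StrictPseudofunctor.mk''
    { obj := U.obj
      map := fun f => U.map f
      map₂ := fun s => U.map₂ s
      map₂_id := fun f => (U.bijective₂ _ _ _ _).1 (by simp [unit_map₂])
      map₂_comp := fun s t => (U.bijective₂ _ _ _ _).1 (by simp [unit_map₂])
      map_id := U.map_id
      map_comp := U.map_comp
      map₂_whisker_left := fun f _ _ η => eq_of_heq ((U.map₂_whiskerLeft f η).trans
        (eqToHom_conj_heq _ _ _).symm)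
      map₂_whisker_right := fun η g => eq_of_heq ((U.map₂_whiskerRight η g).trans
        (eqToHom_conj_heq _ _ _).symm) }

/-- A choice of universal arrows to `G` makes `G` a right adjoint. -/
noncomputable def adjunction : TwoAdjunction U.functor G where
  unit := U.unit
  unit_naturality f := (U.unit_map f).symm
  unit_naturality₂ s := by
    refine eq_of_heq ((comp_eqToHom_heq _ _).trans (HEq.trans ?_ (eqToHom_comp_heq _ _).symm))
    exact (U.unit_map₂_heq s).symm
  bijective := U.bijective
  bijective₂ := U.bijective₂

end UniversalArrows

end Strict

end CatOp

/-! ### The 2-adjunction -/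

namespace CatOp

variable {M : CatOperad.{u}} {L : Type u} [SmallCategory L]

/-- The homotopy colimits, with their universal homotopy morphisms, as universal arrows to the
constant diagram functor. -/
def HocolimOps.universalArrows (ops : ∀ X : L ⥤ LaxAlg M, HocolimOps X) :
    UniversalArrows (constDiagram M L) where
  obj X := (ops X.diagram).toAlg
  unit X := (ops X.diagram).unit
  bijective X S := (ops X.diagram).bijective_unit_comp S
  bijective₂ X _ r r' := (ops X.diagram).bijective_unit_whiskerL r r'

end CatOp

theorem theorem4p14 (M : CatOperad.{u}) (hM : M.SigmaFree) (L : Type u) [SmallCategory L] :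
    ∃ ops : ∀ X : L ⥤ LaxAlg M, HocolimOps X,
      (∀ (X : L ⥤ LaxAlg M) (ops' : HocolimOps X), ops' = ops X) ∧
      ∃ (hocolim : StrictPseudofunctor (Diag M L) (Alg M))
        (adj : TwoAdjunction hocolim (constDiagram M L)),
        (∀ X : Diag M L, hocolim.obj X = (ops X.diagram).toAlg) ∧
        ∀ X : Diag M L,
          ∃ j : X ⟶ (constDiagram M L).obj (ops X.diagram).toAlg,
            IsUniversal (ops X.diagram) j ∧ HEq (adj.unit X) j ∧
            (∀ (S : Alg M) (k : X ⟶ (constDiagram M L).obj S),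
              ∃! r : (ops X.diagram).toAlg ⟶ S, j ≫ (constDiagram M L).map r = k) ∧
            ∀ (S : Alg M) (r r' : (ops X.diagram).toAlg ⟶ S)
              (s : j ≫ (constDiagram M L).map r ⟶ j ≫ (constDiagram M L).map r'),
              ∃! t : r ⟶ r', j ◁ (constDiagram M L).map₂ t = s := by
  let U := HocolimOps.universalArrows fun X : L ⥤ LaxAlg M => hocolimOps hM X
  refine ⟨fun X => hocolimOps hM X, fun X ops' => (hocolimOps hM X).eq ops', U.functor,
    U.adjunction, fun X => rfl, fun X => ⟨U.unit X, HocolimOps.isUniversal_unit _, HEq.rfl,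
      fun S k => ?_, fun S r r' s => ?_⟩⟩
  · exact (U.bijective X S).existsUnique k
  · exact (U.bijective₂ X S r r').existsUnique s
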